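/- **Conventions.** All algebras are over $\mathbb Q$ and graded by $\mathbb N$; graded algebras are graded-commutative. For a graded algebra $H$, $H(n)\subseteq H$ is the subalgebra generated by the elements of degree $\le n$. Let $p$ be a prime and $G=\mathbb Z_p$. A diagram over the orbit category of $G$ (of vector spaces, graded algebras (GAs) or DGAs) is a covariant functor on it, i.e. an object $X(G/e)$ with an action of $G$, an object $X(G/G)$, and a $G$-invariant map $X(G/e)\to X(G/G)$; such a diagram is injective if its underlying diagram of vector spaces is an injective object. A minimal system is a diagram of DGAs $\mathscr M=\bigcup_n\mathscr M_n$ with $\mathscr M_0=\mathscr M_1=\mathbb Q$ and $\mathscr M_n$ an elementary extension of $\mathscr M_{n-1}$ by a diagram of vector spaces $\underline V_n$ of degree $n$, the $n$-th associated system (the generators added are a minimal injective resolution of $\underline V_n$). A minimal algebra (in the non-equivariant sense) is a DGA that is free graded-commutative on a graded vector space concentrated in degrees $\ge 2$ and is the increasing union of the Hirsch extensions given by the subalgebras generated by the generators of degree $\le i$. "Adding a space $V$ of generators" to a DGA $P$ means passing to $P\otimes\Lambda(V)$; at $G/e$ all spaces of generators carry compatible $G$-actions and all maps are $G$-equivariant.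 **Data.** Let $\mathcal A$ be an injective diagram of GAs over $G$ with every $\mathcal A^i(G/H)$ finite-dimensional. Let $\mathscr M$ be a minimal system with a quasi-isomorphism $\rho:\mathscr M\to(\mathcal A,0)$ (the minimal model of $\mathcal A$), and assume that every associated system $\underline V_n$ is injective. Fix $k\ge 2$, and let $H_1=e$, $H_2=G$. For $j=1,2$ let $P^j=\mathscr M_{k-1}(G/H_j)$, let $\sigma_{j,k-1}:H(P^j)(k)\to\mathcal A(G/H_j)$ be the map induced by $\rho$, and let $K_j$ be the kernel of $\sigma_{j,k-1}$ on $(H(P^j)(k))^{k+1}$. Let $p^j_D$ be any DGA obtained from $P^j$ by adding generators of degree $k$ whose differentials represent a basis of $K_j$. Put $$s_j=\dim\frac{\mathcal A^{k+1}(G/H_j)}{(\mathcal A(G/H_j)(k))^{k+1}},\qquad t_j=\dim\frac{H^{k+1}(p^j_D)}{(H(p^j_D)(k))^{k+1}}.$$ **The sets $O_{l_1,l_2}$.** For a subspace $W_j\subseteq H^{k+1}(p_D^j)$ let $p^{j,W_j}$ be obtained from $p_D^j$ by adding generators of degree $k$ whose differentials represent a basis of $W_j$; let $\sigma_{j,D}:H(p^{j,W_j})(k)\to\mathcal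 A(G/H_j)$ be a GA map extending $\sigma_{j,k-1}$; and let $p_k^{j,W_j}$ be obtained from $p^{j,W_j}$ by adding the cokernel of $\sigma_{j,D}:H^k(p^{j,W_j})\to\mathcal A^k(G/H_j)$ as generators of degree $k$ with zero differential. For integers $l_1,l_2$ with $\max(0,t_j-s_j)\le l_j\le t_j$, $O_{l_1,l_2}$ is the set of pairs $(W_1,W_2)$ of subspaces $W_j\subseteq H^{k+1}(p^j_D)$ (rational points of Grassmannians) such that $\dim W_j=l_j$, $W_j\cap (H(p^j_D)(k))^{k+1}=0$, and Condition (K) holds: such $\sigma_{j,D}$ exist, and there are GA maps $\sigma_{W_j,k}:H(p^{j,W_j}_k)(k+1)\to\mathcal A(G/H_j)$ that extend $\sigma_{j,D}$, send each generator in the cokernel to a lift of it in $\mathcal A^k(G/H_j)$, and induce monomorphisms $$H^{k+1}(p_k^{j,W_j})/(H(p_k^{j,W_j})(k))^{k+1}\to\mathcal A^{k+1}(G/H_j)/(\mathcal A(G/H_j)(k))^{k+1},$$ together with a $G$-invariant DGA map $\theta:p^{1,W_1}_k\to p^{2,W_2}_k$ which extends the structure map $P^1\to P^2$ and for which the square formed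 by $\theta^*$, $\sigma_{W_1,k}$, $\sigma_{W_2,k}$ and $\mathcal A(G/e)\to\mathcal A(G/G)$ commutes. We then call $(p^{1,W_1}_k,p^{2,W_2}_k,\theta)$ a diagram belonging to $(W_1,W_2)$. Let $(W_1,W_2)\mathrel{\kappa}(W_1',W_2')$ if there are diagrams $(p^{1,W_1}_k,p^{2,W_2}_k,\theta)$ and $(p^{1,W'_1}_k,p^{2,W'_2}_k,\theta')$ belonging to them and DGA isomorphisms $f_j:p_k^{j,W_j}\to p_k^{j,W_j'}$, with $f_1$ $G$-equivariant, such that $\theta' f_1=f_2\theta$. **The diagrams to be classified.** Consider the DGA diagrams $\mathscr N_k$ over $G$ such that * $\mathscr N_k$ contains $\mathscr M_{k-1}$ as a subdiagram; * $(1)_k$: $\mathscr N_k(G/e)$ and $\mathscr N_k(G/G)$ are generated by elements of degree $\le k$; * $(2)_k$: there are ($G$-equivariant) GA maps $\sigma_j:H(\mathscr N_k(G/H_j))(k+1)\to\mathcal A(G/H_j)$, $j=1,2$, that are isomorphisms in degrees $\le k$ and monomorphisms in degree $k+1$, are compatible with the structure maps of $\mathscr N_k$ and $\mathcal A$, and extend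 $\sigma_{j,k-1}$; * $\mathscr N_k(G/e)$ and $\mathscr N_k(G/G)$ are minimal algebras in the non-equivariant sense. **Theorem.** Each $\kappa$ is an equivalence relation on $O_{l_1,l_2}$, and every diagram belonging to a pair in $O_{l_1,l_2}$ is such an $\mathscr N_k$. Sending $(W_1,W_2)$ to the isomorphism class of any diagram belonging to it is a well-defined bijection $$\bigsqcup_{l_1,l_2} O_{l_1,l_2}/\kappa\ \longrightarrow\ \{\text{isomorphism classes of such diagrams }\mathscr N_k\},$$ where $(l_1,l_2)$ runs over the pairs of integers with $\max(0,t_j-s_j)\le l_j\le t_j$ for $j=1,2$. -/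

import Mathlib

universe u

namespace EqFormality

/-! ### Graded-commutative algebras and commutative DGAs over `ℚ` -/

/-- A graded-commutative `ℚ`-algebra, graded by `ℕ`. -/
structure GCAlg where
  carrier : Type u
  [ring : Ring carrier]
  [algebra : Algebra ℚ carrier]
  gr : ℕ → Submodule ℚ carrier
  [graded : GradedAlgebra gr]
  comm : ∀ i j a b, a ∈ gr i → b ∈ gr j → a * b = (-1 : ℚ) ^ (i * j) • (b * a)

attribute [instance] GCAlg.ring GCAlg.algebra GCAlg.graded

/-- Graded algebra maps. -/
structure GCAlg.Hom (A B : GCAlg.{u}) where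
  toAlgHom : A.carrier →ₐ[ℚ] B.carrier
  map_gr : ∀ i a, a ∈ A.gr i → toAlgHom a ∈ B.gr i

instance (A B : GCAlg.{u}) : CoeFun (GCAlg.Hom A B) (fun _ => A.carrier → B.carrier) :=
  ⟨fun f => f.toAlgHom⟩

/-- The subalgebra generated by the elements of degree `≤ n`; for a graded algebra `H` this is
the algebra written `(H(n))`. -/
def genLE {R : Type u} [Ring R] [Algebra ℚ R] (gr : ℕ → Submodule ℚ R) (n : ℕ) :
    Subalgebra ℚ R :=
  Algebra.adjoin ℚ {x | ∃ i ≤ n, x ∈ gr i}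

/-- A commutative differential graded algebra over `ℚ` (the differential has degree `+1`). -/
structure CDGA extends GCAlg.{u} where
  d : carrier →ₗ[ℚ] carrier
  d_gr : ∀ i a, a ∈ gr i → d a ∈ gr (i + 1)
  d_d : ∀ a, d (d a) = 0
  leibniz : ∀ i a b, a ∈ gr i → d (a * b) = d a * b + (-1 : ℚ) ^ i • (a * d b)

/-- Maps of DGAs. -/
structure CDGA.Hom (A B : CDGA.{u}) extends toGAHom : GCAlg.Hom A.toGCAlg B.toGCAlg where
  map_d : ∀ a, toAlgHom (A.d a) = B.d (toAlgHom a)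

instance (A B : CDGA.{u}) : CoeFun (CDGA.Hom A B) (fun _ => A.carrier → B.carrier) :=
  ⟨fun f => f.toAlgHom⟩

def CDGA.Hom.id (A : CDGA.{u}) : CDGA.Hom A A where
  toAlgHom := AlgHom.id ℚ _
  map_gr := fun _ _ h => h
  map_d := fun _ => rfl

def CDGA.Hom.comp {A B C : CDGA.{u}} (g : CDGA.Hom B C) (f : CDGA.Hom A B) : CDGA.Hom A C where
  toAlgHom := g.toAlgHom.comp f.toAlgHom
  map_gr := fun i a h => g.map_gr i _ (f.map_gr i a h)
  map_d := fun a => by simp [f.map_d, g.map_d]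

/-! ### Cohomology -/

namespace CDGA

variable (A : CDGA.{u})

theorem d_mul_of_cocycle (a b : A.carrier) (hb : A.d b = 0) : A.d (a * b) = A.d a * b := by
  induction a using DirectSum.Decomposition.inductionOn A.gr with
  | zero => simp
  | homogeneous m => rw [A.leibniz _ _ _ m.2, hb]; simp
  | add m m' hm hm' => rw [add_mul, map_add, map_add, hm, hm', add_mul]

theorem d_component (a : A.carrier) (i : ℕ) :
    A.d (DirectSum.decompose A.gr a i : A.carrier) =
      (DirectSum.decompose A.gr (A.d a) (i + 1) : A.carrier) := by
  induction a using DirectSum.Decomposition.inductionOn A.gr with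
  | zero => simp
  | @homogeneous j m =>
    by_cases h : j = i
    · subst h
      rw [DirectSum.decompose_of_mem_same A.gr m.2,
        DirectSum.decompose_of_mem_same A.gr (A.d_gr _ _ m.2)]
    · rw [DirectSum.decompose_of_mem_ne A.gr m.2 h,
        DirectSum.decompose_of_mem_ne A.gr (A.d_gr _ _ m.2) (by omega), map_zero]
  | add m m' hm hm' => simp [hm, hm']

/-- The subalgebra of cocycles. -/
def cocycles : Subalgebra ℚ A.carrier where
  carrier := {a | A.d a = 0}
  mul_mem' := fun {a b} ha hb => by
    have ha' : A.d a = 0 := ha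
    have hb' : A.d b = 0 := hb
    change A.d (a * b) = 0
    rw [A.d_mul_of_cocycle a b hb', ha', zero_mul]
  add_mem' := fun {a b} ha hb => by
    have ha' : A.d a = 0 := ha
    have hb' : A.d b = 0 := hb
    change A.d (a + b) = 0
    rw [map_add, ha', hb', add_zero]
  algebraMap_mem' := fun r => by
    change A.d (algebraMap ℚ _ r) = 0
    have h1 : A.d 1 = 0 := by
      have h := A.leibniz 0 1 1 SetLike.GradedOne.one_mem
      simpa using h
    rw [Algebra.algebraMap_eq_smul_one, map_smul, h1, smul_zero]

theorem cocycle_mul_d (z w : A.carrier) (hz : A.d z = 0) : ∃ v, A.d v = z * A.d w := by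
  classical
  refine ⟨∑ i ∈ (DirectSum.decompose A.gr z).support,
    (-1 : ℚ) ^ i • ((DirectSum.decompose A.gr z i : A.carrier) * w), ?_⟩
  conv_rhs => rw [← DirectSum.sum_support_decompose A.gr z]
  rw [map_sum, Finset.sum_mul]
  refine Finset.sum_congr rfl fun i _ => ?_
  rw [map_smul, A.leibniz i _ _ (SetLike.coe_mem _), A.d_component, hz]
  simp [smul_smul, ← mul_pow]

/-- The ideal of coboundaries in the algebra of cocycles. -/
def coboundaries : Ideal A.cocycles where
  carrier := {z | ∃ w, A.d w = z}
  add_mem' := by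
    rintro a b ⟨v, hv⟩ ⟨w, hw⟩
    exact ⟨v + w, by simp [hv, hw]⟩
  zero_mem' := ⟨0, by simp⟩
  smul_mem' := by
    rintro c z ⟨w, hw⟩
    obtain ⟨v, hv⟩ := A.cocycle_mul_d c w c.2
    exact ⟨v, by rw [hv, hw]; rfl⟩

instance : A.coboundaries.IsTwoSided where
  mul_mem_of_left := by
    rintro z c ⟨w, hw⟩
    exact ⟨w * c, by rw [A.d_mul_of_cocycle w c c.2, hw]; rfl⟩

/-- The cohomology algebra `H(A)`. -/
abbrev H : Type u := A.cocycles ⧸ A.coboundaries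

/-- The cohomology class of a cocycle. -/
def cls (z : A.carrier) (hz : A.d z = 0) : A.H :=
  Ideal.Quotient.mkₐ ℚ A.coboundaries (⟨z, hz⟩ : A.cocycles)

/-- The degree `i` part `H^i(A)` of the cohomology. -/
def Hgr (i : ℕ) : Submodule ℚ A.H :=
  ((A.gr i).comap A.cocycles.val.toLinearMap).map
    (Ideal.Quotient.mkₐ ℚ A.coboundaries).toLinearMap

variable {A}

/-- The map induced on cocycles. -/
def Hom.mapZ {B : CDGA.{u}} (f : Hom A B) : A.cocycles →ₐ[ℚ] B.cocycles :=
  (f.toAlgHom.comp A.cocycles.val).codRestrict B.cocycles (fun z => by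
    have hz : A.d z = 0 := z.2
    change B.d (f.toAlgHom z) = 0
    rw [← f.map_d, hz, map_zero])

/-- The map induced on cohomology. -/
def Hom.mapH {B : CDGA.{u}} (f : Hom A B) : A.H →ₐ[ℚ] B.H :=
  Ideal.Quotient.liftₐ A.coboundaries
    ((Ideal.Quotient.mkₐ ℚ B.coboundaries).comp f.mapZ) (by
      rintro z ⟨w, hw⟩
      refine Ideal.Quotient.eq_zero_iff_mem.2 ⟨f.toAlgHom w, ?_⟩
      rw [← f.map_d, hw]
      rfl)

end CDGA

/-! ### Algebras with a group action -/

/-- A graded-commutative algebra with an action of the group `Γ` by graded automorphisms. -/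
structure EqGA (Γ : Type*) [Group Γ] extends GCAlg.{u} where
  act : Γ →* (carrier ≃ₐ[ℚ] carrier)
  act_gr : ∀ g i a, a ∈ gr i → act g a ∈ gr i

/-- A DGA with an action of the group `Γ` by DGA automorphisms. -/
structure EqDGA (Γ : Type*) [Group Γ] extends CDGA.{u} where
  act : Γ →* (carrier ≃ₐ[ℚ] carrier)
  act_gr : ∀ g i a, a ∈ gr i → act g a ∈ gr i
  act_d : ∀ g a, act g (d a) = d (act g a)

section Levels

variable {Γ : Type*} [Group Γ]

/-- The action of a group element, as a DGA map. -/
def EqDGA.actHom (P : EqDGA.{u} Γ) (g : Γ) : CDGA.Hom P.toCDGA P.toCDGA where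
  toAlgHom := (P.act g).toAlgHom
  map_gr := fun i a h => P.act_gr g i a h
  map_d := fun a => P.act_d g a

/-- Equivariant DGA maps. -/
structure EqDGA.Hom (P Q : EqDGA.{u} Γ) extends
    toDGAHom : CDGA.Hom P.toCDGA Q.toCDGA where
  map_act : ∀ g a, toAlgHom (P.act g a) = Q.act g (toAlgHom a)

instance (P Q : EqDGA.{u} Γ) : CoeFun (EqDGA.Hom P Q) (fun _ => P.carrier → Q.carrier) :=
  ⟨fun f => f.toAlgHom⟩

def EqDGA.Hom.id (P : EqDGA.{u} Γ) : EqDGA.Hom P P where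
  toDGAHom := CDGA.Hom.id _
  map_act := fun _ _ => rfl

def EqDGA.Hom.comp {P Q R : EqDGA.{u} Γ} (g : EqDGA.Hom Q R) (f : EqDGA.Hom P Q) :
    EqDGA.Hom P R where
  toDGAHom := g.toDGAHom.comp f.toDGAHom
  map_act := fun γ a => by
    change g.toAlgHom (f.toAlgHom _) = R.act γ (g.toAlgHom (f.toAlgHom a))
    rw [f.map_act, g.map_act]

/-- Equivariant DGA maps from `P` to the graded algebra `A` with zero differential. -/
structure EqDGA.Aug (P : EqDGA.{u} Γ) (A : EqGA.{u} Γ) extends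
    toGAHom : GCAlg.Hom P.toGCAlg A.toGCAlg where
  map_d : ∀ a, toAlgHom (P.d a) = 0
  map_act : ∀ g a, toAlgHom (P.act g a) = A.act g (toAlgHom a)

/-- The map `H(P) → H(A, 0) = A` induced on cohomology. -/
def EqDGA.Aug.onH {P : EqDGA.{u} Γ} {A : EqGA.{u} Γ} (ρ : P.Aug A) :
    P.H →ₐ[ℚ] A.carrier :=
  Ideal.Quotient.liftₐ P.coboundaries (ρ.toAlgHom.comp P.cocycles.val) (by
    rintro z ⟨w, hw⟩
    change ρ.toAlgHom (z : P.carrier) = 0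
    rw [← hw, ρ.map_d])

def EqDGA.Aug.comp {P Q : EqDGA.{u} Γ} {A : EqGA.{u} Γ} (ρ : Q.Aug A) (f : EqDGA.Hom P Q) :
    P.Aug A where
  toAlgHom := ρ.toAlgHom.comp f.toAlgHom
  map_gr := fun i a h => ρ.map_gr i _ (f.map_gr i a h)
  map_d := fun a => by
    change ρ.toAlgHom (f.toAlgHom _) = 0
    rw [f.map_d, ρ.map_d]
  map_act := fun g a => by
    change ρ.toAlgHom (f.toAlgHom _) = A.act g (ρ.toAlgHom (f.toAlgHom a))
    rw [f.map_act, ρ.map_act]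

end Levels

/-! ### Free extensions, minimal algebras -/

/-- `E` is the algebra `P ⊗ Λ(⨁ᵢ Vᵢ)`, free graded-commutative over `P` (along `ι`) on the vector
spaces `V i` placed in degree `deg i` (along `γ i`). -/
def IsFreeExt {P E : GCAlg.{u}} (ι : GCAlg.Hom P E) {I : Type*} (deg : I → ℕ)
    (V : I → Type u) [∀ i, AddCommGroup (V i)] [∀ i, Module ℚ (V i)]
    (γ : ∀ i, V i →ₗ[ℚ] E.carrier) : Prop :=
  (∀ i v, γ i v ∈ E.gr (deg i)) ∧
  ∀ (B : GCAlg.{u}) (f : GCAlg.Hom P B) (b : ∀ i, V i →ₗ[ℚ] B.carrier),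
    (∀ i v, b i v ∈ B.gr (deg i)) →
      ∃! h : GCAlg.Hom E B, (∀ x, h (ι x) = f x) ∧ ∀ i v, h (γ i v) = b i v

/-- Minimal algebras in the non-equivariant sense: `m` is free graded-commutative on subspaces
`V i` of degree `i`, where `V 0 = V 1 = 0`, and it is the union of the Hirsch extensions
`m_{i-1} ⊆ m_i`, where `m_i` is generated by the `V j` with `j ≤ i`. -/
def CDGA.IsMinimal (m : CDGA.{u}) : Prop :=
  ∃ V : ℕ → Submodule ℚ m.carrier,
    (∀ i, V i ≤ m.gr i) ∧ V 0 = ⊥ ∧ V 1 = ⊥ ∧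
    (∀ i, ∀ v ∈ V i, m.d v ∈ Algebra.adjoin ℚ {x | ∃ j < i, x ∈ V j}) ∧
    ∀ (B : GCAlg.{u}) (b : ∀ i, V i →ₗ[ℚ] B.carrier), (∀ i v, b i v ∈ B.gr i) →
      ∃! h : GCAlg.Hom m.toGCAlg B, ∀ i (v : V i), h v = b i v

/-! ### Diagrams over the orbit category of a group of prime order

The orbit category of such a group `G` has the objects `G/e` (with automorphism group `G`) and
`G/G` (with trivial automorphism group), and exactly one map `G/e → G/G`.  A covariant functor on
it is a `G`-object `e`, an object `t`, and a map `r : e → t` that is invariant under `G`. -/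

section Diagrams

variable (G : Type) [Group G]

/-- Systems of rational vector spaces (dual rational coefficient systems). -/
structure VecSys where
  e : Type u
  t : Type u
  [addE : AddCommGroup e]
  [addT : AddCommGroup t]
  [modE : Module ℚ e]
  [modT : Module ℚ t]
  act : Representation ℚ G e
  r : e →ₗ[ℚ] t
  r_act : ∀ g x, r (act g x) = r x

attribute [instance] VecSys.addE VecSys.addT VecSys.modE VecSys.modT

variable {G}

/-- Morphisms of systems of vector spaces. -/
structure VecSys.Hom (V W : VecSys.{u} G) where
  e : V.e →ₗ[ℚ] W.e
  t : V.t →ₗ[ℚ] W.t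
  map_act : ∀ g x, e (V.act g x) = W.act g (e x)
  comm : ∀ x, t (V.r x) = W.r (e x)

def VecSys.Hom.IsInj {V W : VecSys.{u} G} (f : VecSys.Hom V W) : Prop :=
  Function.Injective f.e ∧ Function.Injective f.t

/-- Injective objects of the category of systems of vector spaces. -/
def VecSys.Injective (V : VecSys.{u} G) : Prop :=
  ∀ (X Y : VecSys.{u} G) (i : VecSys.Hom X Y) (f : VecSys.Hom X V), i.IsInj →
    ∃ h : VecSys.Hom Y V, (∀ x, h.e (i.e x) = f.e x) ∧ ∀ x, h.t (i.t x) = f.t x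

variable (G)

/-- Diagrams of graded algebras. -/
structure GADiagram where
  e : EqGA.{u} G
  t : EqGA.{u} Unit
  r : GCAlg.Hom e.toGCAlg t.toGCAlg
  r_act : ∀ g x, r (e.act g x) = r x

/-- Diagrams of DGAs. -/
structure DGADiagram where
  e : EqDGA.{u} G
  t : EqDGA.{u} Unit
  r : CDGA.Hom e.toCDGA t.toCDGA
  r_act : ∀ g x, r (e.act g x) = r x

variable {G}

/-- The underlying system of vector spaces of a diagram of graded algebras. -/
def GADiagram.toVecSys (A : GADiagram.{u} G) : VecSys.{u} G where
  e := A.e.carrier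
  t := A.t.carrier
  act :=
    { toFun := fun g => (A.e.act g).toLinearMap
      map_one' := by ext x; simp
      map_mul' := fun g h => by ext x; simp }
  r := A.r.toAlgHom.toLinearMap
  r_act := A.r_act

/-- Morphisms from a system of vector spaces to the degree `n` part of a diagram of DGAs. -/
structure VecSys.MapInto (V : VecSys.{u} G) (U : DGADiagram.{u} G) (n : ℕ) where
  e : V.e →ₗ[ℚ] U.e.carrier
  t : V.t →ₗ[ℚ] U.t.carrier
  gr_e : ∀ v, e v ∈ U.e.gr n
  gr_t : ∀ v, t v ∈ U.t.gr n
  map_act : ∀ g v, e (V.act g v) = U.e.act g (e v)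
  comm : ∀ v, t (V.r v) = U.r (e v)

/-- Morphisms of diagrams of DGAs. -/
structure DGADiagram.Hom (U U' : DGADiagram.{u} G) where
  e : EqDGA.Hom U.e U'.e
  t : EqDGA.Hom U.t U'.t
  comm : ∀ x, t (U.r x) = U'.r (e x)

def DGADiagram.Hom.id (U : DGADiagram.{u} G) : DGADiagram.Hom U U where
  e := EqDGA.Hom.id _
  t := EqDGA.Hom.id _
  comm := fun _ => rfl

def DGADiagram.Hom.comp {U V W : DGADiagram.{u} G} (g : DGADiagram.Hom V W)
    (f : DGADiagram.Hom U V) : DGADiagram.Hom U W where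
  e := g.e.comp f.e
  t := g.t.comp f.t
  comm := fun x => by
    change g.t.toAlgHom (f.t.toAlgHom _) = W.r.toAlgHom (g.e.toAlgHom (f.e.toAlgHom x))
    rw [f.comm, g.comm]

def DGADiagram.Hom.IsInj {U U' : DGADiagram.{u} G} (f : DGADiagram.Hom U U') : Prop :=
  Function.Injective f.e ∧ Function.Injective f.t

/-- Isomorphism of diagrams of DGAs. -/
def DGADiagram.Iso (U U' : DGADiagram.{u} G) : Prop :=
  ∃ (f : DGADiagram.Hom U U') (g : DGADiagram.Hom U' U),
    (∀ x, g.e (f.e x) = x) ∧ (∀ x, f.e (g.e x) = x) ∧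
    (∀ x, g.t (f.t x) = x) ∧ (∀ x, f.t (g.t x) = x)

theorem DGADiagram.iso_equivalence : Equivalence (DGADiagram.Iso (G := G)) where
  refl := fun U => ⟨.id U, .id U, fun _ => rfl, fun _ => rfl, fun _ => rfl, fun _ => rfl⟩
  symm := fun ⟨f, g, h1, h2, h3, h4⟩ => ⟨g, f, h2, h1, h4, h3⟩
  trans := fun ⟨f, g, h1, h2, h3, h4⟩ ⟨f', g', h1', h2', h3', h4'⟩ =>
    ⟨f'.comp f, g.comp g',
      fun x => (congrArg g.e.toAlgHom (h1' (f.e x))).trans (h1 x),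
      fun x => (congrArg f'.e.toAlgHom (h2 (g'.e x))).trans (h2' x),
      fun x => (congrArg g.t.toAlgHom (h3' (f.t x))).trans (h3 x),
      fun x => (congrArg f'.t.toAlgHom (h4 (g'.t x))).trans (h4' x)⟩

/-- Maps from a diagram of DGAs to a diagram of graded algebras with zero differential. -/
structure DGADiagram.Aug (U : DGADiagram.{u} G) (A : GADiagram.{u} G) where
  e : U.e.Aug A.e
  t : U.t.Aug A.t
  comm : ∀ x, t.toAlgHom (U.r x) = A.r (e.toAlgHom x)

def DGADiagram.Aug.IsQuasiIso {U : DGADiagram.{u} G} {A : GADiagram.{u} G} (ρ : U.Aug A) :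
    Prop :=
  Function.Bijective ρ.e.onH ∧ Function.Bijective ρ.t.onH

def DGADiagram.Aug.comp {U U' : DGADiagram.{u} G} {A : GADiagram.{u} G} (ρ : U'.Aug A)
    (f : DGADiagram.Hom U U') : U.Aug A where
  e := ρ.e.comp f.e
  t := ρ.t.comp f.t
  comm := fun x => by
    change ρ.t.toAlgHom (f.t.toAlgHom _) = A.r (ρ.e.toAlgHom (f.e.toAlgHom x))
    rw [f.comm, ρ.comm]

/-! ### Elementary extensions and minimal systems -/

/-- `U'` is (along `ι : U → U'`) the elementary extension of `U` by the system of vector spaces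
`V` of degree `n`: with a minimal injective resolution `V → I 0 → I 1 → ⋯` of `V` and compatible
maps `α i : I i → U^{n+1+i}`, the algebra `U'` is free over `U` on the `I i` in degree `n + i`,
with `d = (-1)^i α i + w i` on `I i`.  The attaching map of the extension is `α 0 ∘ ε`, whose
values are cocycles by the compatibility of the `α i`. -/
structure ElemExt {U U' : DGADiagram.{u} G} (ι : DGADiagram.Hom U U') (n : ℕ)
    (V : VecSys.{u} G) where
  I : ℕ → VecSys.{u} G
  inj : ∀ i, (I i).Injective
  ε : VecSys.Hom V (I 0)
  w : ∀ i, VecSys.Hom (I i) (I (i + 1))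
  ε_inj : ε.IsInj
  exact_zero : (∀ x, (w 0).e x = 0 ↔ ∃ v, ε.e v = x) ∧ (∀ x, (w 0).t x = 0 ↔ ∃ v, ε.t v = x)
  exact_succ : ∀ i, (∀ x, (w (i + 1)).e x = 0 ↔ ∃ v, (w i).e v = x) ∧
    (∀ x, (w (i + 1)).t x = 0 ↔ ∃ v, (w i).t v = x)
  /-- `I 0` is an injective envelope of `V`: the inclusion `ε` is essential. -/
  minimal_zero : ∀ (Y : VecSys.{u} G) (h : VecSys.Hom (I 0) Y),
    (∀ v, h.e (ε.e v) = 0 → v = 0) → (∀ v, h.t (ε.t v) = 0 → v = 0) → h.IsInj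
  /-- `I (i + 1)` is an injective envelope of the cokernel of the preceding map: the inclusion of
  that cokernel, which is the image of `w i`, is essential. -/
  minimal_succ : ∀ (i : ℕ) (Y : VecSys.{u} G) (h : VecSys.Hom (I (i + 1)) Y),
    (∀ v, h.e ((w i).e v) = 0 → (w i).e v = 0) → (∀ v, h.t ((w i).t v) = 0 → (w i).t v = 0) →
      h.IsInj
  α : ∀ i, VecSys.MapInto (I i) U (n + 1 + i)
  α_zero : (∀ v, U.e.d ((α 0).e (ε.e v)) = 0) ∧ (∀ v, U.t.d ((α 0).t (ε.t v)) = 0)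
  α_comm : ∀ i, (∀ v, U.e.d ((α i).e v) = (α (i + 1)).e ((w i).e v)) ∧
    (∀ v, U.t.d ((α i).t v) = (α (i + 1)).t ((w i).t v))
  γ : ∀ i, VecSys.MapInto (I i) U' (n + i)
  free_e : IsFreeExt ι.e.toGAHom (fun i => n + i) (fun i => (I i).e) (fun i => (γ i).e)
  free_t : IsFreeExt ι.t.toGAHom (fun i => n + i) (fun i => (I i).t) (fun i => (γ i).t)
  d_e : ∀ i v, U'.e.d ((γ i).e v) =
    (-1 : ℚ) ^ i • ι.e ((α i).e v) + (γ (i + 1)).e ((w i).e v)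
  d_t : ∀ i v, U'.t.d ((γ i).t v) =
    (-1 : ℚ) ^ i • ι.t ((α i).t v) + (γ (i + 1)).t ((w i).t v)

/-- The constant diagram `ℚ`. -/
def DGADiagram.IsConst (U : DGADiagram.{u} G) : Prop :=
  Function.Bijective (algebraMap ℚ U.e.carrier) ∧ Function.Bijective (algebraMap ℚ U.t.carrier)

variable (G)

/-- A minimal system of DGAs: the union `total` of `stage n`, where stages `0` and `1` are `ℚ` and
stage `n` is the elementary extension of stage `n - 1` by the system `V n` of degree `n`
(for `n ≥ 2`). -/
structure MinimalSystem where
  total : DGADiagram.{u} G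
  stage : ℕ → DGADiagram.{u} G
  step : ∀ n, DGADiagram.Hom (stage n) (stage (n + 1))
  incl : ∀ n, DGADiagram.Hom (stage n) total
  incl_inj : ∀ n, (incl n).IsInj
  incl_step : ∀ n, (∀ x, (incl (n + 1)).e ((step n).e x) = (incl n).e x) ∧
    (∀ x, (incl (n + 1)).t ((step n).t x) = (incl n).t x)
  union : (∀ x, ∃ n y, (incl n).e y = x) ∧ (∀ x, ∃ n y, (incl n).t y = x)
  const_zero : (stage 0).IsConst
  const_one : (stage 1).IsConst
  V : ℕ → VecSys.{u} G
  ext : ∀ n, 1 ≤ n → ElemExt (step n) (n + 1) (V (n + 1))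

end Diagrams

/-! ### The construction at one orbit -/

section OneLevel

variable {Γ : Type*} [Group Γ]

/-- Equivariant graded algebra maps `(H(X)(m)) → A`. -/
structure PartialMap (X : EqDGA.{u} Γ) (A : EqGA.{u} Γ) (m : ℕ) where
  toAlgHom : genLE X.Hgr m →ₐ[ℚ] A.carrier
  map_gr : ∀ i (x : genLE X.Hgr m), (x : X.H) ∈ X.Hgr i → toAlgHom x ∈ A.gr i
  map_act : ∀ g (x y : genLE X.Hgr m), (y : X.H) = (X.actHom g).mapH x →
    toAlgHom y = A.act g (toAlgHom x)

instance (X : EqDGA.{u} Γ) (A : EqGA.{u} Γ) (m : ℕ) :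
    CoeFun (PartialMap X A m) (fun _ => genLE X.Hgr m → A.carrier) :=
  ⟨fun f => f.toAlgHom⟩

/-- `σ : (H(X)(n+1)) → A` is an isomorphism in degrees `≤ n` and a monomorphism in degree
`n + 1`. -/
def PartialMap.IsNIso {X : EqDGA.{u} Γ} {A : EqGA.{u} Γ} {n : ℕ}
    (σ : PartialMap X A (n + 1)) : Prop :=
  (∀ i ≤ n, ∀ a ∈ A.gr i, ∃! x : genLE X.Hgr (n + 1), (x : X.H) ∈ X.Hgr i ∧ σ x = a) ∧
  ∀ x : genLE X.Hgr (n + 1), (x : X.H) ∈ X.Hgr (n + 1) → σ x = 0 → x = 0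

/-- `E` is obtained from `P` by adding, in an equivariant way, a space of generators of degree `n`
whose differentials represent the elements of the space `S ⊆ H^{n+1}(P)`. -/
structure HirschExt (P E : EqDGA.{u} Γ) (n : ℕ) (S : Submodule ℚ P.H) where
  ι : EqDGA.Hom P E
  γ : S →ₗ[ℚ] E.carrier
  free : IsFreeExt ι.toGAHom (fun _ : Unit => n) (fun _ => S) (fun _ => γ)
  d_γ : ∀ s : S, ∃ (z : P.carrier) (hz : P.d z = 0),
    z ∈ P.gr (n + 1) ∧ P.cls z hz = s ∧ E.d (γ s) = ι z
  γ_act : ∀ g (s s' : S), (s' : P.H) = (P.actHom g).mapH s → γ s' = E.act g (γ s)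

variable {P : EqDGA.{u} Γ} {A : EqGA.{u} Γ}

/-- The kernel `K` of `H(ρ)` on the degree `n + 1` part of `(H(P)(n))`. -/
def kerK (ρ : P.Aug A) (n : ℕ) : Submodule ℚ P.H :=
  P.Hgr (n + 1) ⊓ Subalgebra.toSubmodule (genLE P.Hgr n) ⊓ LinearMap.ker ρ.onH.toLinearMap

/-- An algebra `p_D`, obtained from `P` by adding generators of degree `n` whose differentials
form a basis of `K`. -/
structure DStage (ρ : P.Aug A) (n : ℕ) where
  pD : EqDGA.{u} Γ
  ext : HirschExt P pD n (kerK ρ n)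

/-- The image of `σ : (H(X)(n))^n → A^n`, as a subspace of `A^n`. -/
def PartialMap.imTop {X : EqDGA.{u} Γ} {n : ℕ} (σ : PartialMap X A n) :
    Submodule ℚ (A.gr n) :=
  (((X.Hgr n).comap (genLE X.Hgr n).val.toLinearMap).map σ.toAlgHom.toLinearMap).submoduleOf
    (A.gr n)

/-- The data constructed from a subspace `W` of `H^{n+1}(p_D)`:
* `pW` is obtained from `p_D` by adding generators whose differentials span `W`;
* `σW` extends the map given by `H(ρ)` on `(H(P)(n))`;
* `pn` is obtained from `pW` by adding the cokernel of `σW : (H(pW)(n))^n → A^n`, with zero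
  differential;
* `σ : (H(pn)(n+1)) → A` extends `σW`, is given on the new generators by lifting elements of the
  cokernel to `A^n`, and induces a monomorphism
  `H^{n+1}(pn) / (H(pn)(n))^{n+1} → A^{n+1} / (A(n))^{n+1}`. -/
structure LevelData {ρ : P.Aug A} {n : ℕ} (D : DStage ρ n) (W : Submodule ℚ D.pD.H) where
  pW : EqDGA.{u} Γ
  extW : HirschExt D.pD pW n W
  σW : PartialMap pW A n
  σW_ext : ∀ x ∈ genLE P.Hgr n, ∀ y : genLE pW.Hgr n,
    (y : pW.H) = extW.ι.toDGAHom.mapH (D.ext.ι.toDGAHom.mapH x) → σW y = ρ.onH x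
  pn : EqDGA.{u} Γ
  ι : EqDGA.Hom pW pn
  γ : (A.gr n ⧸ σW.imTop) →ₗ[ℚ] pn.carrier
  free : IsFreeExt ι.toGAHom (fun _ : Unit => n) (fun _ => A.gr n ⧸ σW.imTop) (fun _ => γ)
  d_γ : ∀ c, pn.d (γ c) = 0
  γ_act : ∀ g (a a' : A.gr n), (a' : A.carrier) = A.act g a →
    γ (Submodule.Quotient.mk a') = pn.act g (γ (Submodule.Quotient.mk a))
  σ : PartialMap pn A (n + 1)
  σ_ext : ∀ (x : genLE pW.Hgr n) (y : genLE pn.Hgr (n + 1)),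
    (y : pn.H) = ι.toDGAHom.mapH x → σ y = σW x
  σ_coker : ∀ (c : A.gr n ⧸ σW.imTop) (y : genLE pn.Hgr (n + 1)),
    (y : pn.H) = pn.cls (γ c) (d_γ c) →
      ∃ a : A.gr n, (a : A.carrier) = σ y ∧ Submodule.Quotient.mk a = c
  φ_inj : ∀ x : genLE pn.Hgr (n + 1), (x : pn.H) ∈ pn.Hgr (n + 1) →
    σ x ∈ genLE A.gr n → (x : pn.H) ∈ genLE pn.Hgr n

/-- The inclusion of `P` in `pn`. -/
def LevelData.inclP {ρ : P.Aug A} {n : ℕ} {D : DStage ρ n} {W : Submodule ℚ D.pD.H}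
    (L : LevelData D W) : EqDGA.Hom P L.pn :=
  L.ι.comp (L.extW.ι.comp D.ext.ι)

/-- `t = dim H^{n+1}(p_D) / (H(p_D)(n))^{n+1}`. -/
noncomputable def DStage.tdim {ρ : P.Aug A} {n : ℕ} (D : DStage ρ n) : ℕ :=
  Module.finrank ℚ (D.pD.Hgr (n + 1) ⧸
    (Subalgebra.toSubmodule (genLE D.pD.Hgr n)).submoduleOf (D.pD.Hgr (n + 1)))

/-- `s = dim A^{n+1} / (A(n))^{n+1}`. -/
noncomputable def sdim (A : EqGA.{u} Γ) (n : ℕ) : ℕ :=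
  Module.finrank ℚ (A.gr (n + 1) ⧸
    (Subalgebra.toSubmodule (genLE A.gr n)).submoduleOf (A.gr (n + 1)))

/-- `W` is an `l`-dimensional subspace of `H^{n+1}(p_D)` that meets `(H(p_D)(n))^{n+1}`
only in `0`. -/
def DStage.IsPoint {ρ : P.Aug A} {n : ℕ} (D : DStage ρ n) (l : ℕ)
    (W : Submodule ℚ D.pD.H) : Prop :=
  W ≤ D.pD.Hgr (n + 1) ∧ Module.Finite ℚ W ∧ Module.finrank ℚ W = l ∧
    W ⊓ Subalgebra.toSubmodule (genLE D.pD.Hgr n) = ⊥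

end OneLevel

/-! ### The construction for diagrams -/

section TwoLevels

variable {G : Type} [Group G] {P : DGADiagram.{u} G} {A : GADiagram.{u} G}

/-- The square formed by `σe : (H(X.e)(m)) → A.e`, `σt : (H(X.t)(m)) → A.t` and the structure maps
of `X` and `A` commutes. -/
def SquareCommutes (X : DGADiagram.{u} G) {m : ℕ} (σe : PartialMap X.e A.e m)
    (σt : PartialMap X.t A.t m) : Prop :=
  ∀ (x : genLE X.e.Hgr m) (y : genLE X.t.Hgr m), (y : X.t.H) = X.r.mapH x →
    σt y = A.r (σe x)

/-- `N` is a diagram of DGAs that contains `P`, satisfies `(1)_n` and `(2)_n`, the latter by maps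
extending those given by `H(ρ)` on `(H(P)(n))`, and is levelwise minimal. -/
def IsStage (ρ : P.Aug A) (n : ℕ) (N : DGADiagram.{u} G) : Prop :=
  genLE N.e.gr n = ⊤ ∧ genLE N.t.gr n = ⊤ ∧
  N.e.IsMinimal ∧ N.t.IsMinimal ∧
  ∃ ι : DGADiagram.Hom P N, ι.IsInj ∧
  ∃ (σe : PartialMap N.e A.e (n + 1)) (σt : PartialMap N.t A.t (n + 1)),
    σe.IsNIso ∧ σt.IsNIso ∧ SquareCommutes N σe σt ∧
    (∀ x ∈ genLE P.e.Hgr n, ∀ y : genLE N.e.Hgr (n + 1),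
      (y : N.e.H) = ι.e.toDGAHom.mapH x → σe y = ρ.e.onH x) ∧
    (∀ x ∈ genLE P.t.Hgr n, ∀ y : genLE N.t.Hgr (n + 1),
      (y : N.t.H) = ι.t.toDGAHom.mapH x → σt y = ρ.t.onH x)

/-- Isomorphism, on the diagrams satisfying `IsStage`. -/
def stageSetoid (ρ : P.Aug A) (n : ℕ) : Setoid {N : DGADiagram.{u} G // IsStage ρ n N} where
  r := fun N N' => N.1.Iso N'.1
  iseqv :=
    ⟨fun N => DGADiagram.iso_equivalence.refl N.1,
      fun h => DGADiagram.iso_equivalence.symm h,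
      fun h h' => DGADiagram.iso_equivalence.trans h h'⟩

variable {ρ : P.Aug A} {n : ℕ}

/-- Condition (K) for `(W₁, W₂)` together with a map `θ : p_n^{W₁} → p_n^{W₂}` of diagrams that
extends the structure map of `P` and makes the square with the maps to `A` commute. -/
structure PairData (D₁ : DStage ρ.e n) (D₂ : DStage ρ.t n) (W₁ : Submodule ℚ D₁.pD.H)
    (W₂ : Submodule ℚ D₂.pD.H) where
  L₁ : LevelData D₁ W₁
  L₂ : LevelData D₂ W₂
  θ : CDGA.Hom L₁.pn.toCDGA L₂.pn.toCDGA
  θ_act : ∀ g x, θ (L₁.pn.act g x) = θ x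
  θ_ext : ∀ x, θ (L₁.inclP x) = L₂.inclP (P.r x)
  square : ∀ (x : genLE L₁.pn.Hgr (n + 1)) (y : genLE L₂.pn.Hgr (n + 1)),
    (y : L₂.pn.H) = θ.mapH x → L₂.σ y = A.r (L₁.σ x)

/-- The diagram `(p_n^{W₁}, p_n^{W₂}, θ)`. -/
def PairData.diagram {D₁ : DStage ρ.e n} {D₂ : DStage ρ.t n} {W₁ : Submodule ℚ D₁.pD.H}
    {W₂ : Submodule ℚ D₂.pD.H} (X : PairData D₁ D₂ W₁ W₂) : DGADiagram.{u} G where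
  e := X.L₁.pn
  t := X.L₂.pn
  r := X.θ
  r_act := X.θ_act

/-- The set `O_{l₁,l₂}`. -/
def OSet (D₁ : DStage ρ.e n) (D₂ : DStage ρ.t n) (l₁ l₂ : ℕ) : Type u :=
  {W : Submodule ℚ D₁.pD.H × Submodule ℚ D₂.pD.H //
    D₁.IsPoint l₁ W.1 ∧ D₂.IsPoint l₂ W.2 ∧ Nonempty (PairData D₁ D₂ W.1 W.2)}

/-- The relation `κ` on `O_{l₁,l₂}`: diagrams belonging to the two pairs are related by DGA
isomorphisms `(f₁, f₂)` that commute with the maps `θ`. -/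
def kappa (D₁ : DStage ρ.e n) (D₂ : DStage ρ.t n) (l₁ l₂ : ℕ) (W W' : OSet D₁ D₂ l₁ l₂) : Prop :=
  ∃ (X : PairData D₁ D₂ W.1.1 W.1.2) (X' : PairData D₁ D₂ W'.1.1 W'.1.2),
    X.diagram.Iso X'.diagram

/-- The index set of the pairs `(l₁, l₂)` with `max(0, t_j - s_j) ≤ l_j ≤ t_j`; the subtraction is
that of natural numbers. -/
def LIndex (D₁ : DStage ρ.e n) (D₂ : DStage ρ.t n) : Type :=
  {l : ℕ × ℕ // (D₁.tdim - sdim A.e n ≤ l.1 ∧ l.1 ≤ D₁.tdim) ∧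
    (D₂.tdim - sdim A.t n ≤ l.2 ∧ l.2 ≤ D₂.tdim)}

end TwoLevels

end EqFormality

open EqFormality

namespace EqFormality

/-! ### Homogeneous elements and generators -/

/-! Write `P` for the stage `k - 1` of the minimal system at one orbit. Everything happens in degree
`k`. Since `P` is connected and zero in degree 1, new generators of degree `k` change nothing in
degrees `< k`, nor in degree `k + 1`: a new generator times an element of positive degree has degree
at least `k + 2`. Such extensions `P ⊆ N` are captured by `KExt`; a map out of `N` is a map out of
`P` together with a compatible linear map on `N^k`. With a map to `A` as in $(2)_k$ they form the
predicate `IsLevelStage`. Both sides of the classification consist of such objects: the algebras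
built from `W` by `LevelData.isLevelStage`, the minimal algebras of the theorem by
`Base.isLevelStage`.

Surjectivity. A level stage `N` receives a map from `p_D`, because elements of `K` must die in
`H(N)`. Take for `W` the kernel on `H^{k+1}(p_D)`. Elements of `N^k` bounding `W` generate a copy of
`p^W`, and modulo it `N^k` consists of cocycles, matched by `σ` with the cokernel
(`IsLevelStage.exists_fill`). The bounds on `dim W` are linear algebra (`finrank_quotient_bounds`).

Well-definedness. Two level stages with the same kernel on `H^{k+1}(P)` are isomorphic over `P`
(`IsLevelStage.exists_iso`): a linear map on `N^k` is chosen subject to linear conditions, and made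
equivariant by averaging over the finite group (`exists_equivariant_section`). For diagrams, choose
the isomorphism at `G/G` first and then one at `G/e` with prescribed image under `θ`. This can be
solved because the structure maps are onto on `A^k` and on `P^{k-1}`, which is what injectivity of
`A` and of the associated systems provides. So the diagram of a pair is unique up to isomorphism
(`PairData.iso`), which also makes `κ` transitive.

Injectivity. Once `(l₁, l₂)` is fixed, `κ` is isomorphism of diagrams by definition. The integers
are recovered from `dim N^k`, since the other summands of `N^k` do not depend on `W`
(`LevelData.finrank_eq_of_finrank_gr_eq`).

Finally, an injective system is its own minimal injective resolution, so at each orbit the minimal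
system is a `Tower` of extensions, one degree at a time. This gives the facts about `P` collected in
`Base`. -/

theorem exists_mem_of_closure {R : Type*} [Ring R] [Algebra ℚ R]
    (S : ℕ → Submodule ℚ R) (h1 : 1 ∈ S 0)
    (hmul : ∀ i j x y, x ∈ S i → y ∈ S j → x * y ∈ S (i + j))
    {X : Set R} (hX : ∀ x ∈ X, ∃ i, x ∈ S i) {x : R} (hx : x ∈ Submonoid.closure X) :
    ∃ i, x ∈ S i := by
  induction hx using Submonoid.closure_induction with
  | mem x hx => exact hX x hx
  | one => exact ⟨0, h1⟩
  | mul x y _ _ hx hy =>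
    obtain ⟨i, hi⟩ := hx
    obtain ⟨j, hj⟩ := hy
    exact ⟨i + j, hmul i j x y hi hj⟩

/-- A monomial in `X` lies in a single `S i`, so each of its projections is itself or zero. Only
projections `π` are assumed, because the lemma is also applied to cohomology, which is given no
`GradedAlgebra` structure here. The families `S` used below are smaller than the grading in some
degrees; this is how degree counts are carried out. -/
theorem proj_mem_of_mem_adjoin {R : Type*} [Ring R] [Algebra ℚ R] (π : ℕ → R →ₗ[ℚ] R)
    (S : ℕ → Submodule ℚ R) (h1 : 1 ∈ S 0)
    (hmul : ∀ i j x y, x ∈ S i → y ∈ S j → x * y ∈ S (i + j))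
    (hsame : ∀ i x, x ∈ S i → π i x = x) (hne : ∀ i j x, x ∈ S j → i ≠ j → π i x = 0)
    {X : Set R} (hX : ∀ x ∈ X, ∃ i, x ∈ S i) {x : R} (hx : x ∈ Algebra.adjoin ℚ X) (i : ℕ) :
    π i x ∈ S i := by
  rw [← Subalgebra.mem_toSubmodule, Algebra.adjoin_eq_span] at hx
  induction hx using Submodule.span_induction with
  | mem x hx =>
    obtain ⟨j, hj⟩ := exists_mem_of_closure S h1 hmul hX hx
    by_cases h : i = j
    · subst h
      rwa [hsame i x hj]
    · rw [hne i j x hj h]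
      exact zero_mem _
  | zero => simp
  | add x y _ _ hx hy => rw [map_add]; exact add_mem hx hy
  | smul c x _ hx => rw [map_smul]; exact Submodule.smul_mem _ _ hx

theorem isInternal_of_proj {R : Type*} [AddCommGroup R] [Module ℚ R] (gr : ℕ → Submodule ℚ R)
    (π : ℕ → R →ₗ[ℚ] R) (hsame : ∀ i x, x ∈ gr i → π i x = x)
    (hne : ∀ i j x, x ∈ gr j → i ≠ j → π i x = 0) (htop : ⨆ i, gr i = ⊤) :
    DirectSum.IsInternal gr := by
  classical
  rw [DirectSum.isInternal_submodule_iff_iSupIndep_and_iSup_eq_top]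
  refine ⟨?_, htop⟩
  intro i
  rw [Submodule.disjoint_def]
  intro x hx hx'
  have h : ∀ y ∈ ⨆ j, ⨆ (_ : j ≠ i), gr j, π i y = 0 := by
    intro y hy
    have : (⨆ j, ⨆ (_ : j ≠ i), gr j) ≤ LinearMap.ker (π i) :=
      iSup₂_le fun j hj z hz => hne i j z hz (Ne.symm hj)
    exact this hy
  rw [← hsame i x hx, h x hx']

/-! ### Graded algebras: projections and subalgebras generated by homogeneous elements. -/

namespace GCAlg

variable (A B : GCAlg.{u})

/-- The projection to the degree `i` part. -/
def proj (i : ℕ) : A.carrier →ₗ[ℚ] A.carrier := GradedAlgebra.proj A.gr i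

variable {A B}

theorem proj_mem (i : ℕ) (x : A.carrier) : A.proj i x ∈ A.gr i := by
  simp [proj, GradedAlgebra.proj_apply]

theorem proj_same {i : ℕ} {x : A.carrier} (h : x ∈ A.gr i) : A.proj i x = x := by
  rw [proj, GradedAlgebra.proj_apply, DirectSum.decompose_of_mem_same _ h]

theorem proj_ne {i j : ℕ} {x : A.carrier} (h : x ∈ A.gr j) (hij : i ≠ j) : A.proj i x = 0 := by
  rw [proj, GradedAlgebra.proj_apply, DirectSum.decompose_of_mem_ne _ h hij.symm]

theorem linearMap_ext {M : Type*} [AddCommGroup M] [Module ℚ M] {f g : A.carrier →ₗ[ℚ] M}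
    (h : ∀ i, ∀ x ∈ A.gr i, f x = g x) : f = g := by
  ext x
  induction x using DirectSum.Decomposition.inductionOn A.gr with
  | zero => simp
  | homogeneous m => exact h _ _ m.2
  | add m m' hm hm' => rw [map_add, map_add, hm, hm']

theorem iSup_gr : ⨆ i, A.gr i = ⊤ :=
  (DirectSum.Decomposition.isInternal A.gr).submodule_iSup_eq_top

theorem one_mem : (1 : A.carrier) ∈ A.gr 0 := SetLike.GradedOne.one_mem

theorem mul_mem {i j : ℕ} {x y : A.carrier} (hx : x ∈ A.gr i) (hy : y ∈ A.gr j) :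
    x * y ∈ A.gr (i + j) := SetLike.GradedMul.mul_mem hx hy

theorem algebraMap_mem (q : ℚ) : algebraMap ℚ A.carrier q ∈ A.gr 0 := by
  rw [Algebra.algebraMap_eq_smul_one]
  exact Submodule.smul_mem _ _ one_mem

theorem eq_zero_of_mem {i j : ℕ} {x : A.carrier} (hi : x ∈ A.gr i) (hj : x ∈ A.gr j)
    (hij : i ≠ j) : x = 0 := by
  rw [← proj_same hi, proj_ne hj hij]

theorem Hom.proj (f : Hom A B) (i : ℕ) (x : A.carrier) : f (A.proj i x) = B.proj i (f x) := by
  have : f.toAlgHom.toLinearMap ∘ₗ A.proj i = B.proj i ∘ₗ f.toAlgHom.toLinearMap := by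
    refine linearMap_ext fun j x hx => ?_
    change f (A.proj i x) = B.proj i (f x)
    by_cases h : i = j
    · subst h
      rw [proj_same hx, proj_same (f.map_gr _ _ hx)]
    · rw [proj_ne hx h, proj_ne (f.map_gr _ _ hx) h, map_zero]
  exact LinearMap.congr_fun this x

theorem Hom.mem_gr_of_injective (f : Hom A B) (hf : Function.Injective f) {i : ℕ} {x : A.carrier}
    (h : f x ∈ B.gr i) : x ∈ A.gr i := by
  have : A.proj i x = x := hf (by rw [f.proj, proj_same h])
  rw [← this]
  exact proj_mem _ _

def Hom.id (A : GCAlg.{u}) : Hom A A := ⟨AlgHom.id ℚ _, fun _ _ h => h⟩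

def Hom.comp {A B C : GCAlg.{u}} (g : Hom B C) (f : Hom A B) : Hom A C where
  toAlgHom := g.toAlgHom.comp f.toAlgHom
  map_gr := fun i a h => g.map_gr i _ (f.map_gr i a h)

theorem Hom.eqOn_adjoin (f g : Hom A B) {X : Set A.carrier} (h : ∀ x ∈ X, f x = g x)
    {x : A.carrier} (hx : x ∈ Algebra.adjoin ℚ X) : f x = g x := by
  have : Algebra.adjoin ℚ X ≤ AlgHom.equalizer f.toAlgHom g.toAlgHom := Algebra.adjoin_le h
  exact this hx

theorem proj_mem_adjoin (S : ℕ → Submodule ℚ A.carrier) (hS : ∀ i, S i ≤ A.gr i) (h1 : 1 ∈ S 0)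
    (hmul : ∀ i j x y, x ∈ S i → y ∈ S j → x * y ∈ S (i + j))
    {X : Set A.carrier} (hX : ∀ x ∈ X, ∃ i, x ∈ S i) {x : A.carrier}
    (hx : x ∈ Algebra.adjoin ℚ X) (i : ℕ) : A.proj i x ∈ S i :=
  proj_mem_of_mem_adjoin A.proj S h1 hmul (fun i _ h => proj_same (hS i h))
    (fun _ j _ h hij => proj_ne (hS j h) hij) hX hx i

/-- The subalgebra generated by homogeneous elements is stable under projections. -/
theorem proj_mem_adjoin_self {X : Set A.carrier} (hX : ∀ x ∈ X, ∃ i, x ∈ A.gr i) {x : A.carrier}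
    (hx : x ∈ Algebra.adjoin ℚ X) (i : ℕ) : A.proj i x ∈ Algebra.adjoin ℚ X := by
  refine (proj_mem_adjoin (fun i => A.gr i ⊓ Subalgebra.toSubmodule (Algebra.adjoin ℚ X))
    (fun i => inf_le_left) ⟨one_mem, Subalgebra.one_mem _⟩ ?_ ?_ hx i).2
  · rintro i j x y ⟨hx, hx'⟩ ⟨hy, hy'⟩
    exact ⟨mul_mem hx hy, Subalgebra.mul_mem _ hx' hy'⟩
  · intro x hx
    obtain ⟨i, hi⟩ := hX x hx
    exact ⟨i, hi, Algebra.subset_adjoin hx⟩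

theorem mem_of_mem_iSup_gr {T : Submodule ℚ A.carrier} (h : ∀ i, A.gr i ≤ T) (x : A.carrier) :
    x ∈ T := by
  have : (⨆ i, A.gr i) ≤ T := iSup_le h
  rw [iSup_gr] at this
  exact this trivial

theorem iSup_gr_comap {X : Set A.carrier} (hX : ∀ x ∈ X, ∃ i, x ∈ A.gr i) :
    ⨆ i, (A.gr i).comap (Algebra.adjoin ℚ X).val.toLinearMap = ⊤ := by
  classical
  rw [eq_top_iff]
  rintro ⟨x, hx⟩ -
  have hs := DirectSum.sum_support_decompose A.gr x
  have : (⟨x, hx⟩ : Algebra.adjoin ℚ X) = ∑ i ∈ (DirectSum.decompose A.gr x).support,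
      ⟨A.proj i x, proj_mem_adjoin_self hX hx i⟩ := by
    apply Subtype.ext
    rw [AddSubmonoidClass.coe_finsetSum]
    exact hs.symm
  rw [this]
  refine Submodule.sum_mem _ fun i _ => ?_
  refine Submodule.mem_iSup_of_mem i ?_
  exact proj_mem i x

/-- The subalgebra generated by a set of homogeneous elements, as a graded algebra. -/
noncomputable def sub (A : GCAlg.{u}) (X : Set A.carrier) (hX : ∀ x ∈ X, ∃ i, x ∈ A.gr i) :
    GCAlg.{u} where
  carrier := Algebra.adjoin ℚ X
  gr := fun i => (A.gr i).comap (Algebra.adjoin ℚ X).val.toLinearMap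
  graded :=
    haveI : SetLike.GradedMonoid
        (fun i => (A.gr i).comap (Algebra.adjoin ℚ X).val.toLinearMap) :=
      { one_mem := one_mem (A := A)
        mul_mem := fun _ _ _ _ hx hy => mul_mem (A := A) hx hy }
    (isInternal_of_proj (R := Algebra.adjoin ℚ X) _
      (fun i => (A.proj i).restrict (p := Subalgebra.toSubmodule (Algebra.adjoin ℚ X))
        (q := Subalgebra.toSubmodule (Algebra.adjoin ℚ X))
        fun _ hx => proj_mem_adjoin_self hX hx i)
      (fun _ _ h => Subtype.ext (proj_same h)) (fun _ _ _ h hij => Subtype.ext (proj_ne h hij))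
      (iSup_gr_comap hX)).gradedAlgebra
  comm := fun i j a b ha hb => Subtype.ext (A.comm i j a b ha hb)

/-- The inclusion of the subalgebra generated by a set of homogeneous elements. -/
noncomputable def subIncl (A : GCAlg.{u}) (X : Set A.carrier) (hX : ∀ x ∈ X, ∃ i, x ∈ A.gr i) :
    Hom (A.sub X hX) A where
  toAlgHom := (Algebra.adjoin ℚ X).val
  map_gr := fun _ _ h => h

theorem subIncl_injective (X : Set A.carrier) (hX : ∀ x ∈ X, ∃ i, x ∈ A.gr i) :
    Function.Injective (A.subIncl X hX) := Subtype.val_injective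

theorem subIncl_mem (X : Set A.carrier) (hX : ∀ x ∈ X, ∃ i, x ∈ A.gr i) (x) :
    A.subIncl X hX x ∈ Algebra.adjoin ℚ X := x.2

/-- Corestriction of a map to the subalgebra generated by a set of homogeneous elements. -/
noncomputable def Hom.toSub (f : Hom B A) (X : Set A.carrier) (hX : ∀ x ∈ X, ∃ i, x ∈ A.gr i)
    (hf : ∀ x, f x ∈ Algebra.adjoin ℚ X) : Hom B (A.sub X hX) where
  toAlgHom := f.toAlgHom.codRestrict _ hf
  map_gr := fun i x h => f.map_gr i x h

theorem Hom.ext_fun {f g : Hom A B} (h : ∀ x, f x = g x) : f = g := by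
  cases f; cases g
  congr
  exact AlgHom.ext h

/-- An algebra in which maps are determined by their values on a set of homogeneous elements, and
which maps to the subalgebra generated by these, is generated by them. -/
theorem adjoin_eq_top (X : Set A.carrier) (hX : ∀ x ∈ X, ∃ i, x ∈ A.gr i)
    (h : Hom A (A.sub X hX)) (hh : ∀ g : Hom A A, (∀ x ∈ X, g x = x) → ∀ x, g x = x)
    (hx : ∀ x ∈ X, A.subIncl X hX (h x) = x) : Algebra.adjoin ℚ X = ⊤ := by
  rw [eq_top_iff]
  intro x _
  -- The composite of `h` with the inclusion fixes `X`, hence is the identity, so every element lies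
  -- in the subalgebra.
  rw [← hh ((A.subIncl X hX).comp h) hx x]
  exact subIncl_mem X hX _

end GCAlg


/-! ### Cocycles and cohomology classes -/

namespace CDGA

variable {A B : CDGA.{u}}

theorem d_proj (i : ℕ) (a : A.carrier) : A.d (A.proj i a) = A.proj (i + 1) (A.d a) := by
  have := A.d_component a i
  simpa [GCAlg.proj, GradedAlgebra.proj_apply] using this

theorem proj_zero_d (a : A.carrier) : A.proj 0 (A.d a) = 0 := by
  have : A.proj 0 ∘ₗ A.d = 0 := GCAlg.linearMap_ext fun i x hx =>
    GCAlg.proj_ne (A.d_gr i x hx) (by omega)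
  exact LinearMap.congr_fun this a

/-- The differential is homogeneous, so a primitive can be replaced by its component of degree `i -
1`. In degree 0 every coboundary vanishes, which makes the truncated subtraction harmless. -/
theorem exists_primitive {i : ℕ} {z w : A.carrier} (hz : z ∈ A.gr i) (h : A.d w = z) :
    ∃ v ∈ A.gr (i - 1), A.d v = z := by
  cases i with
  | zero => exact ⟨0, zero_mem _, by rw [map_zero, ← GCAlg.proj_same hz, ← h, proj_zero_d]⟩
  | succ i =>
    exact ⟨A.proj i w, GCAlg.proj_mem _ _, by rw [d_proj, h, GCAlg.proj_same hz]⟩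

theorem d_one : A.d 1 = 0 := A.cocycles.one_mem

theorem d_algebraMap (q : ℚ) : A.d (algebraMap ℚ _ q) = 0 := A.cocycles.algebraMap_mem q

/-- A map of graded algebras commutes with the differentials if it does so on generators. -/
theorem map_d_of_adjoin (f : GCAlg.Hom A.toGCAlg B.toGCAlg) {X : Set A.carrier}
    (hX : ∀ x ∈ X, ∃ i, x ∈ A.gr i) (h : ∀ x ∈ X, f (A.d x) = B.d (f x))
    (htop : Algebra.adjoin ℚ X = ⊤) (a : A.carrier) : f (A.d a) = B.d (f a) := by
  have ha : a ∈ Algebra.adjoin ℚ X := htop ▸ Algebra.mem_top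
  rw [← Subalgebra.mem_toSubmodule, Algebra.adjoin_eq_span] at ha
  induction ha using Submodule.span_induction with
  | mem x hx =>
    have key : f (A.d x) = B.d (f x) ∧ ∃ i, x ∈ A.gr i := by
      induction hx using Submonoid.closure_induction with
      | mem x hx => exact ⟨h x hx, hX x hx⟩
      | one => exact ⟨by rw [d_one, map_zero, map_one, d_one], 0, GCAlg.one_mem⟩
      | mul x y _ _ hx hy =>
        obtain ⟨hx, i, hi⟩ := hx
        obtain ⟨hy, j, hj⟩ := hy
        refine ⟨?_, i + j, GCAlg.mul_mem hi hj⟩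
        rw [A.leibniz i x y hi, map_mul, B.leibniz i _ _ (f.map_gr i x hi), map_add, map_smul,
          map_mul, map_mul, hx, hy]
    exact key.1
  | zero => simp
  | add x y _ _ hx hy => simp only [map_add, hx, hy]
  | smul c x _ hx => simp only [map_smul, hx]

theorem d_mem_adjoin {X : Set A.carrier} (hX : ∀ x ∈ X, ∃ i, x ∈ A.gr i)
    (h : ∀ x ∈ X, A.d x ∈ Algebra.adjoin ℚ X) {a : A.carrier} (ha : a ∈ Algebra.adjoin ℚ X) :
    A.d a ∈ Algebra.adjoin ℚ X := by
  rw [← Subalgebra.mem_toSubmodule, Algebra.adjoin_eq_span] at ha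
  induction ha using Submodule.span_induction with
  | mem x hx =>
    have key : x ∈ Algebra.adjoin ℚ X ∧ A.d x ∈ Algebra.adjoin ℚ X ∧ ∃ i, x ∈ A.gr i := by
      induction hx using Submonoid.closure_induction with
      | mem x hx => exact ⟨Algebra.subset_adjoin hx, h x hx, hX x hx⟩
      | one => exact ⟨one_mem _, by rw [d_one]; exact zero_mem _, 0, GCAlg.one_mem⟩
      | mul x y _ _ hx hy =>
        obtain ⟨hx0, hx, i, hi⟩ := hx
        obtain ⟨hy0, hy, j, hj⟩ := hy
        refine ⟨mul_mem hx0 hy0, ?_, i + j, GCAlg.mul_mem hi hj⟩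
        rw [A.leibniz i x y hi]
        exact add_mem (mul_mem hx hy0) (Subalgebra.smul_mem _ (mul_mem hx0 hy) _)
    exact key.2.1
  | zero => rw [map_zero]; exact zero_mem _
  | add x y _ _ hx hy => rw [map_add]; exact add_mem hx hy
  | smul c x _ hx => rw [map_smul]; exact Subalgebra.smul_mem _ hx c

theorem cls_eq_zero {z : A.carrier} (hz : A.d z = 0) : A.cls z hz = 0 ↔ ∃ w, A.d w = z :=
  Ideal.Quotient.eq_zero_iff_mem

theorem cls_add {z w : A.carrier} (hz : A.d z = 0) (hw : A.d w = 0) (h : A.d (z + w) = 0) :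
    A.cls (z + w) h = A.cls z hz + A.cls w hw :=
  map_add (Ideal.Quotient.mkₐ ℚ A.coboundaries) ⟨z, hz⟩ ⟨w, hw⟩

theorem cls_sub {z w : A.carrier} (hz : A.d z = 0) (hw : A.d w = 0) (h : A.d (z - w) = 0) :
    A.cls (z - w) h = A.cls z hz - A.cls w hw :=
  map_sub (Ideal.Quotient.mkₐ ℚ A.coboundaries) ⟨z, hz⟩ ⟨w, hw⟩

theorem cls_smul (c : ℚ) {z : A.carrier} (hz : A.d z = 0) (h : A.d (c • z) = 0) :
    A.cls (c • z) h = c • A.cls z hz :=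
  map_smul (Ideal.Quotient.mkₐ ℚ A.coboundaries) c ⟨z, hz⟩

theorem cls_mul {z w : A.carrier} (hz : A.d z = 0) (hw : A.d w = 0) (h : A.d (z * w) = 0) :
    A.cls (z * w) h = A.cls z hz * A.cls w hw :=
  map_mul (Ideal.Quotient.mkₐ ℚ A.coboundaries) ⟨z, hz⟩ ⟨w, hw⟩

theorem cls_zero : A.cls 0 (map_zero _) = 0 :=
  map_zero (Ideal.Quotient.mkₐ ℚ A.coboundaries)

theorem cls_algebraMap (q : ℚ) :
    A.cls (algebraMap ℚ _ q) (d_algebraMap q) = algebraMap ℚ A.H q :=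
  (Ideal.Quotient.mkₐ ℚ A.coboundaries).commutes q

theorem cls_eq_iff {z w : A.carrier} (hz : A.d z = 0) (hw : A.d w = 0) :
    A.cls z hz = A.cls w hw ↔ ∃ v, A.d v = z - w := by
  rw [← sub_eq_zero, ← cls_sub hz hw (by rw [map_sub, hz, hw, sub_zero]), cls_eq_zero]

theorem cls_congr {z w : A.carrier} (h : z = w) (hz : A.d z = 0) :
    A.cls z hz = A.cls w (h ▸ hz) := by subst h; rfl

theorem exists_cls (x : A.H) : ∃ (z : A.carrier) (hz : A.d z = 0), A.cls z hz = x := by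
  obtain ⟨z, rfl⟩ := Ideal.Quotient.mk_surjective x
  exact ⟨z.1, z.2, rfl⟩

theorem mem_Hgr {i : ℕ} {x : A.H} :
    x ∈ A.Hgr i ↔ ∃ (z : A.carrier) (hz : A.d z = 0), z ∈ A.gr i ∧ A.cls z hz = x := by
  constructor
  · rintro ⟨z, hz, rfl⟩
    exact ⟨z.1, z.2, hz, rfl⟩
  · rintro ⟨z, hz, hi, rfl⟩
    exact ⟨⟨z, hz⟩, hi, rfl⟩

theorem cls_mem {i : ℕ} {z : A.carrier} (hz : A.d z = 0) (hi : z ∈ A.gr i) :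
    A.cls z hz ∈ A.Hgr i := mem_Hgr.2 ⟨z, hz, hi, rfl⟩

theorem mapH_cls (f : Hom A B) {z : A.carrier} (hz : A.d z = 0) (h : B.d (f z) = 0) :
    f.mapH (A.cls z hz) = B.cls (f z) h := rfl

theorem Hom.d_eq_zero (f : Hom A B) {z : A.carrier} (hz : A.d z = 0) : B.d (f z) = 0 := by
  rw [← f.map_d, hz, map_zero]

theorem mapH_mem (f : Hom A B) {i : ℕ} {x : A.H} (h : x ∈ A.Hgr i) : f.mapH x ∈ B.Hgr i := by
  obtain ⟨z, hz, hi, rfl⟩ := mem_Hgr.1 h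
  rw [mapH_cls f hz (f.d_eq_zero hz)]
  exact cls_mem _ (f.map_gr _ _ hi)

theorem mapH_genLE (f : Hom A B) {n m : ℕ} (hnm : n ≤ m) {x : A.H} (h : x ∈ genLE A.Hgr n) :
    f.mapH x ∈ genLE B.Hgr m := by
  have : genLE A.Hgr n ≤ (genLE B.Hgr m).comap f.mapH := by
    refine Algebra.adjoin_le ?_
    rintro y ⟨i, hi, hy⟩
    exact Algebra.subset_adjoin ⟨i, hi.trans hnm, mapH_mem f hy⟩
  exact this h

theorem mapH_comp {C : CDGA.{u}} (g : Hom B C) (f : Hom A B) (x : A.H) :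
    (g.comp f).mapH x = g.mapH (f.mapH x) := by
  obtain ⟨z, hz, rfl⟩ := exists_cls x
  rfl

theorem mem_genLE {n i : ℕ} (h : i ≤ n) {x : A.H} (hx : x ∈ A.Hgr i) : x ∈ genLE A.Hgr n :=
  Algebra.subset_adjoin ⟨i, h, hx⟩

theorem Hgr_mul_mem {i j : ℕ} {x y : A.H} (hx : x ∈ A.Hgr i) (hy : y ∈ A.Hgr j) :
    x * y ∈ A.Hgr (i + j) := by
  obtain ⟨z, hz, hi, rfl⟩ := mem_Hgr.1 hx
  obtain ⟨w, hw, hj, rfl⟩ := mem_Hgr.1 hy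
  have h : A.d (z * w) = 0 := A.cocycles.mul_mem hz hw
  rw [← cls_mul hz hw h]
  exact cls_mem h (GCAlg.mul_mem hi hj)

theorem Hgr_one_mem : (1 : A.H) ∈ A.Hgr 0 :=
  mem_Hgr.2 ⟨1, d_one, GCAlg.one_mem, map_one (Ideal.Quotient.mkₐ ℚ A.coboundaries)⟩

variable (A) in
/-- The projection to the degree `i` part of the cocycles. -/
def projZ (i : ℕ) : A.cocycles →ₗ[ℚ] A.cocycles :=
  LinearMap.restrict (p := Subalgebra.toSubmodule A.cocycles)
    (q := Subalgebra.toSubmodule A.cocycles) (A.proj i) fun z hz => by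
      have hz : A.d z = 0 := hz
      change A.d _ = 0
      rw [d_proj, hz, map_zero]

variable (A) in
/-- The projection to the degree `i` part of the cohomology. -/
noncomputable def Hproj (i : ℕ) : A.H →ₗ[ℚ] A.H :=
  ((A.coboundaries.restrictScalars ℚ).liftQ
    ((Ideal.Quotient.mkₐ ℚ A.coboundaries).toLinearMap ∘ₗ A.projZ i) (by
      rintro z ⟨w, hw⟩
      refine Ideal.Quotient.eq_zero_iff_mem.2 ?_
      change ∃ v, A.d v = A.proj i z
      cases i with
      | zero => exact ⟨0, by rw [← hw, proj_zero_d, map_zero]⟩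
      | succ i => exact ⟨A.proj i w, by rw [d_proj, hw]⟩)) ∘ₗ
    (Submodule.Quotient.restrictScalarsEquiv ℚ A.coboundaries).symm.toLinearMap

theorem Hproj_cls (i : ℕ) {z : A.carrier} (hz : A.d z = 0) (h : A.d (A.proj i z) = 0) :
    A.Hproj i (A.cls z hz) = A.cls (A.proj i z) h := rfl

theorem Hproj_same {i : ℕ} {x : A.H} (hx : x ∈ A.Hgr i) : A.Hproj i x = x := by
  obtain ⟨z, hz, hi, rfl⟩ := mem_Hgr.1 hx
  have h : A.d (A.proj i z) = 0 := by rwa [GCAlg.proj_same hi]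
  rw [Hproj_cls i hz h, cls_congr (GCAlg.proj_same hi)]

theorem Hproj_ne {i j : ℕ} {x : A.H} (hx : x ∈ A.Hgr j) (hij : i ≠ j) : A.Hproj i x = 0 := by
  obtain ⟨z, hz, hi, rfl⟩ := mem_Hgr.1 hx
  have h : A.d (A.proj i z) = 0 := by rw [GCAlg.proj_ne hi hij, map_zero]
  rw [Hproj_cls i hz h, cls_congr (GCAlg.proj_ne hi hij), cls_zero]

theorem Hproj_mem_adjoin (S : ℕ → Submodule ℚ A.H) (hS : ∀ i, S i ≤ A.Hgr i) (h1 : 1 ∈ S 0)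
    (hmul : ∀ i j x y, x ∈ S i → y ∈ S j → x * y ∈ S (i + j))
    {X : Set A.H} (hX : ∀ x ∈ X, ∃ i, x ∈ S i) {x : A.H}
    (hx : x ∈ Algebra.adjoin ℚ X) (i : ℕ) : A.Hproj i x ∈ S i :=
  proj_mem_of_mem_adjoin A.Hproj S h1 hmul (fun i _ h => Hproj_same (hS i h))
    (fun _ j _ h hij => Hproj_ne (hS j h) hij) hX hx i

end CDGA

/-! ### Equivariant linear maps with prescribed values up to a linear relation -/

section Average

variable {Γ : Type*} [Group Γ] [Finite Γ] {M M' : Type*} [AddCommGroup M] [Module ℚ M]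
  [AddCommGroup M'] [Module ℚ M']

/-- The projection of `R` to `X₁` is onto, hence has a linear section `s₀`. It is corrected by `F₀ -
s₀` along a projection onto `X₀`; two values over the same point differ by some `(0, y)` in `R`, so
the correction does not leave `R`. -/
theorem exists_linear_section (X₀ X₁ : Submodule ℚ M) (h01 : X₀ ≤ X₁)
    (R : Submodule ℚ (M × M')) (hR : ∀ x ∈ X₁, ∃ y, (x, y) ∈ R) (F₀ : M →ₗ[ℚ] M')
    (hF₀ : ∀ x ∈ X₀, (x, F₀ x) ∈ R) :
    ∃ F : M →ₗ[ℚ] M', (∀ x ∈ X₀, F x = F₀ x) ∧ ∀ x ∈ X₁, (x, F x) ∈ R := by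
  let R' : Submodule ℚ (M × M') := R ⊓ X₁.comap (LinearMap.fst ℚ M M')
  let q : R' →ₗ[ℚ] X₁ := ((LinearMap.fst ℚ M M').comp R'.subtype).codRestrict X₁ fun x => x.2.2
  have hq : LinearMap.range q = ⊤ := by
    rw [LinearMap.range_eq_top]
    rintro ⟨x, hx⟩
    obtain ⟨y, hy⟩ := hR x hx
    exact ⟨⟨(x, y), hy, hx⟩, rfl⟩
  obtain ⟨s, hs⟩ := q.exists_rightInverse_of_surjective hq
  obtain ⟨s₀, hs₀⟩ := ((LinearMap.snd ℚ M M') ∘ₗ R'.subtype ∘ₗ s).exists_extend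
  have hs₀R : ∀ x ∈ X₁, (x, s₀ x) ∈ R := by
    intro x hx
    have h1 : s₀ x = ((s ⟨x, hx⟩ : R') : M × M').2 := LinearMap.congr_fun hs₀ ⟨x, hx⟩
    have h2 : ((s ⟨x, hx⟩ : R') : M × M').1 = x :=
      congrArg Subtype.val (LinearMap.congr_fun hs ⟨x, hx⟩)
    have h3 : ((s ⟨x, hx⟩ : R') : M × M') = (x, s₀ x) := Prod.ext h2 h1.symm
    rw [← h3]
    exact (s ⟨x, hx⟩ : R').2.1
  obtain ⟨π, hπ⟩ := X₀.subtype.exists_leftInverse_of_injective (by simp)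
  have hπ' : ∀ x (hx : x ∈ X₀), π x = ⟨x, hx⟩ := fun x hx => LinearMap.congr_fun hπ ⟨x, hx⟩
  refine ⟨s₀ + (F₀ - s₀) ∘ₗ X₀.subtype ∘ₗ π, fun x hx => by simp [hπ' x hx], fun x hx => ?_⟩
  have h1 := hF₀ _ (π x).2
  have h2 := hs₀R _ (h01 (π x).2)
  have h3 := R.add_mem (hs₀R x hx) (R.sub_mem h1 h2)
  simpa using h3

/-- Averaging: a linear relation that is stable under a finite group and defined on a stable
subspace contains the graph of an equivariant linear map, with prescribed values on a smaller
stable subspace. -/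
theorem exists_equivariant_section (a : Representation ℚ Γ M) (a' : Representation ℚ Γ M')
    (X₀ X₁ : Submodule ℚ M) (h01 : X₀ ≤ X₁) (hX₀ : ∀ g, ∀ x ∈ X₀, a g x ∈ X₀)
    (hX₁ : ∀ g, ∀ x ∈ X₁, a g x ∈ X₁) (R : Submodule ℚ (M × M'))
    (hRact : ∀ g x y, (x, y) ∈ R → (a g x, a' g y) ∈ R) (hR : ∀ x ∈ X₁, ∃ y, (x, y) ∈ R)
    (F₀ : M →ₗ[ℚ] M') (hF₀act : ∀ g, ∀ x ∈ X₀, F₀ (a g x) = a' g (F₀ x))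
    (hF₀ : ∀ x ∈ X₀, (x, F₀ x) ∈ R) :
    ∃ F : M →ₗ[ℚ] M', (∀ g x, F (a g x) = a' g (F x)) ∧ (∀ x ∈ X₀, F x = F₀ x) ∧
      ∀ x ∈ X₁, (x, F x) ∈ R := by
  classical
  have := Fintype.ofFinite Γ
  obtain ⟨F, hF1, hF2⟩ := exists_linear_section X₀ X₁ h01 R hR F₀ hF₀
  have hc : (Fintype.card Γ : ℚ) ≠ 0 := by exact_mod_cast Fintype.card_ne_zero
  have hinv : ∀ (g : Γ) (x : M), a g (a g⁻¹ x) = x := fun g x => by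
    rw [← Module.End.mul_apply, ← map_mul]; simp
  have hinv' : ∀ (g : Γ) (x : M'), a' g (a' g⁻¹ x) = x := fun g x => by
    rw [← Module.End.mul_apply, ← map_mul]; simp
  refine ⟨(Fintype.card Γ : ℚ)⁻¹ • ∑ g, a' g ∘ₗ F ∘ₗ a g⁻¹, ?_, ?_, ?_⟩
  · intro h x
    simp only [LinearMap.smul_apply, LinearMap.sum_apply, LinearMap.comp_apply, map_smul, map_sum]
    congr 1
    refine Fintype.sum_equiv (Equiv.mulLeft h⁻¹) _ _ fun g => ?_
    simp only [Equiv.coe_mulLeft, ← Module.End.mul_apply, ← map_mul]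
    simp [Module.End.mul_apply]
  · intro x hx
    simp only [LinearMap.smul_apply, LinearMap.sum_apply, LinearMap.comp_apply]
    rw [Finset.sum_congr rfl (g := fun _ => F₀ x)]
    · rw [Finset.sum_const, Finset.card_univ, ← Nat.cast_smul_eq_nsmul ℚ, smul_smul,
        inv_mul_cancel₀ hc, one_smul]
    · intro g _
      rw [hF1 _ (hX₀ _ x hx), hF₀act _ _ hx, hinv']
  · intro x hx
    -- The point of the averaged graph over `x` is the mean of the translates by `g` of the graph
    -- points over `g⁻¹ x`, and all of these lie in `R`.
    have h : (x, ((Fintype.card Γ : ℚ)⁻¹ • ∑ g, a' g ∘ₗ F ∘ₗ a g⁻¹) x) =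
        (Fintype.card Γ : ℚ)⁻¹ • ∑ g, (x, a' g (F (a g⁻¹ x))) := by
      refine Prod.ext ?_ ?_
      · rw [Prod.smul_fst, Prod.fst_sum, Finset.sum_const, Finset.card_univ,
          ← Nat.cast_smul_eq_nsmul ℚ, smul_smul, inv_mul_cancel₀ hc, one_smul]
      · rw [Prod.smul_snd, Prod.snd_sum]
        simp
    rw [h]
    refine R.smul_mem _ (R.sum_mem fun g _ => ?_)
    have := hRact g _ _ (hF2 _ (hX₁ g⁻¹ x hx))
    rwa [hinv] at this

end Average


/-! ### Extensions by generators of one degree -/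

/-- Connected algebras without elements of degree one. -/
structure GCAlg.IsConn (A : GCAlg.{u}) : Prop where
  zero : ∀ x ∈ A.gr 0, ∃ q : ℚ, algebraMap ℚ _ q = x
  one : ∀ x ∈ A.gr 1, x = 0

/-- The homogeneous elements of the image of `ι`, together with `Z`. -/
def gens {P N : GCAlg.{u}} (ι : GCAlg.Hom P N) (Z : Submodule ℚ N.carrier) : Set N.carrier :=
  {x | (∃ i, ∃ y ∈ P.gr i, ι y = x) ∨ x ∈ Z}

/-- `N` is free over `P` on a complement of `P^k` in `N^k`, where `P ⊆ N` agree in degrees `< k`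
and in degree `k + 1`. -/
structure KExt {P N : GCAlg.{u}} (ι : GCAlg.Hom P N) (k : ℕ) : Prop where
  inj : Function.Injective ι
  low : ∀ i < k, ∀ x ∈ N.gr i, ∃ y ∈ P.gr i, ι y = x
  top : ∀ x ∈ N.gr (k + 1), ∃ y ∈ P.gr (k + 1), ι y = x
  gen : Algebra.adjoin ℚ (gens ι (N.gr k)) = ⊤
  lift : ∀ (B : GCAlg.{u}) (f : GCAlg.Hom P B) (b : N.carrier →ₗ[ℚ] B.carrier),
    (∀ x ∈ N.gr k, b x ∈ B.gr k) → (∀ x ∈ P.gr k, b (ι x) = f x) →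
      ∃ h : GCAlg.Hom N B, (∀ x, h (ι x) = f x) ∧ ∀ x ∈ N.gr k, h x = b x

/-- The family given by `Z` in degree `k`, by `T` in the other degrees `≤ k + 1` and by `S` in
the degrees `> k + 1`. -/
def cutFamily {R : Type*} [Ring R] [Algebra ℚ R] (k : ℕ) (Z : Submodule ℚ R)
    (T S : ℕ → Submodule ℚ R) (i : ℕ) : Submodule ℚ R :=
  if i = k then Z else if i ≤ k + 1 then T i else S i

section CutFamily

variable {R : Type*} [Ring R] [Algebra ℚ R] {k : ℕ} {Z : Submodule ℚ R} {T S : ℕ → Submodule ℚ R}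

theorem cutFamily_self : cutFamily k Z T S k = Z := if_pos rfl

theorem cutFamily_low {i : ℕ} (h : i ≠ k) (h' : i ≤ k + 1) : cutFamily k Z T S i = T i := by
  simp [cutFamily, h, h']

theorem cutFamily_high {i : ℕ} (h : k + 1 < i) : cutFamily k Z T S i = S i := by
  simp [cutFamily, show i ≠ k by omega, show ¬ i ≤ k + 1 by omega]

theorem cutFamily_le (hTS : ∀ i, T i ≤ S i) (hZS : Z ≤ S k) (i : ℕ) :
    cutFamily k Z T S i ≤ S i := by
  unfold cutFamily
  split_ifs with h h'
  · subst h; exact hZS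
  · exact hTS i
  · exact le_rfl

theorem le_cutFamily (hTS : ∀ i, T i ≤ S i) (hTZ : T k ≤ Z) (i : ℕ) :
    T i ≤ cutFamily k Z T S i := by
  unfold cutFamily
  split_ifs with h h'
  · subst h; exact hTZ
  · exact le_rfl
  · exact hTS i

/-- Scalars and zero aside, both factors have degree at least 2. A product in degree `≤ k + 1` then
has both factors in degrees `< k`, where the family is `T`; in higher degrees nothing is demanded
beyond `S`. So `Z` never enters a product that has to be controlled. -/
theorem cutFamily_mul (hk : 2 ≤ k) (hTS : ∀ i, T i ≤ S i) (hTZ : T k ≤ Z) (hZS : Z ≤ S k)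
    (hT : ∀ i j x y, x ∈ T i → y ∈ T j → x * y ∈ T (i + j))
    (hS : ∀ i j x y, x ∈ S i → y ∈ S j → x * y ∈ S (i + j))
    (h0 : ∀ x ∈ T 0, ∃ q : ℚ, algebraMap ℚ R q = x) (h1 : ∀ x ∈ T 1, x = 0) (i j : ℕ) (x y : R)
    (hx : x ∈ cutFamily k Z T S i) (hy : y ∈ cutFamily k Z T S j) :
    x * y ∈ cutFamily k Z T S (i + j) := by
  have hle := cutFamily_le (k := k) hTS hZS
  rw [← cutFamily_low (k := k) (Z := Z) (T := T) (S := S) (i := 0) (by omega) (by omega)] at h0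
  rw [← cutFamily_low (k := k) (Z := Z) (T := T) (S := S) (i := 1) (by omega) (by omega)] at h1
  by_cases hi0 : i = 0
  · subst hi0
    obtain ⟨q, rfl⟩ := h0 x hx
    rw [zero_add, ← Algebra.smul_def]
    exact Submodule.smul_mem _ _ hy
  by_cases hj0 : j = 0
  · subst hj0
    obtain ⟨q, rfl⟩ := h0 y hy
    rw [add_zero, ← Algebra.commutes, ← Algebra.smul_def]
    exact Submodule.smul_mem _ _ hx
  by_cases hi1 : i = 1
  · subst hi1
    rw [h1 x hx, zero_mul]
    exact zero_mem _
  by_cases hj1 : j = 1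
  · subst hj1
    rw [h1 y hy, mul_zero]
    exact zero_mem _
  by_cases hij : i + j ≤ k + 1
  · rw [cutFamily_low (by omega) (by omega)] at hx hy
    exact le_cutFamily hTS hTZ _ (hT i j x y hx hy)
  · rw [cutFamily_high (by omega)]
    exact hS i j x y (hle i hx) (hle j hy)

end CutFamily

section Extensions

variable {P E N B : GCAlg.{u}} {ι : GCAlg.Hom P N} {k : ℕ}

theorem gens_homogeneous {Z : Submodule ℚ N.carrier} (hZ : Z ≤ N.gr k) :
    ∀ x ∈ gens ι Z, ∃ i, x ∈ N.gr i := by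
  rintro x (⟨i, y, hy, rfl⟩ | hx)
  · exact ⟨i, ι.map_gr i y hy⟩
  · exact ⟨k, hZ hx⟩

theorem map_mem_adjoin_gens (ι : GCAlg.Hom P N) (Z : Submodule ℚ N.carrier) (x : P.carrier) :
    ι x ∈ Algebra.adjoin ℚ (gens ι Z) :=
  GCAlg.mem_of_mem_iSup_gr
    (T := (Subalgebra.toSubmodule (Algebra.adjoin ℚ (gens ι Z))).comap ι.toAlgHom.toLinearMap)
    (fun i y hy => Algebra.subset_adjoin (Or.inl ⟨i, y, hy, rfl⟩)) x

/-- This is the degree count showing that generators of degree `k` leave degree `k + 1` unchanged.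
-/
theorem proj_mem_of_mem_adjoin_gens (hP : P.IsConn) (hk : 2 ≤ k) {Z : Submodule ℚ N.carrier}
    (hZ : Z ≤ N.gr k) (hPZ : ∀ x ∈ P.gr k, ι x ∈ Z) {x : N.carrier}
    (hx : x ∈ Algebra.adjoin ℚ (gens ι Z)) :
    (∀ i, i ≤ k + 1 → i ≠ k → ∃ y ∈ P.gr i, ι y = N.proj i x) ∧ N.proj k x ∈ Z := by
  let T : ℕ → Submodule ℚ N.carrier := fun i => (P.gr i).map ι.toAlgHom.toLinearMap
  have hTN : ∀ i, T i ≤ N.gr i := by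
    rintro i _ ⟨y, hy, rfl⟩
    exact ι.map_gr i y hy
  have hTZ : T k ≤ Z := by
    rintro _ ⟨y, hy, rfl⟩
    exact hPZ y hy
  have hTS := le_cutFamily hTN hTZ
  have key := fun i => GCAlg.proj_mem_adjoin (cutFamily k Z T N.gr) (cutFamily_le hTN hZ)
    (hTS 0 ⟨1, GCAlg.one_mem, map_one ι.toAlgHom⟩) (cutFamily_mul hk hTN hTZ hZ ?_
      (fun _ _ _ _ => GCAlg.mul_mem) ?_ ?_) ?_ hx i
  · refine ⟨fun i hi hi' => ?_, cutFamily_self (k := k) (Z := Z) ▸ key k⟩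
    have := key i
    rw [cutFamily_low hi' hi] at this
    exact this
  · rintro i j _ _ ⟨x, hx, rfl⟩ ⟨y, hy, rfl⟩
    exact ⟨x * y, GCAlg.mul_mem hx hy, map_mul ι.toAlgHom _ _⟩
  · rintro _ ⟨y, hy, rfl⟩
    obtain ⟨q, rfl⟩ := hP.zero y hy
    exact ⟨q, (ι.toAlgHom.commutes q).symm⟩
  · rintro _ ⟨y, hy, rfl⟩
    rw [hP.one y hy, map_zero]
  · rintro x (⟨i, y, hy, rfl⟩ | hx)
    · exact ⟨i, hTS i ⟨y, hy, rfl⟩⟩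
    · exact ⟨k, by rwa [cutFamily_self]⟩

theorem KExt.hom_ext (hN : KExt ι k) {f g : GCAlg.Hom N B} (h : ∀ x, f (ι x) = g (ι x))
    (h' : ∀ x ∈ N.gr k, f x = g x) (x : N.carrier) : f x = g x := by
  refine GCAlg.Hom.eqOn_adjoin f g (X := gens ι (N.gr k)) ?_ (hN.gen ▸ Algebra.mem_top)
  rintro _ (⟨i, y, -, rfl⟩ | hx)
  · exact h y
  · exact h' _ hx

theorem KExt.conn (hN : KExt ι k) (hP : P.IsConn) (hk : 2 ≤ k) : N.IsConn where
  zero := fun x hx => by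
    obtain ⟨y, hy, rfl⟩ := hN.low 0 (by omega) x hx
    obtain ⟨q, rfl⟩ := hP.zero y hy
    exact ⟨q, (ι.toAlgHom.commutes q).symm⟩
  one := fun x hx => by
    obtain ⟨y, hy, rfl⟩ := hN.low 1 (by omega) x hx
    rw [hP.one y hy, map_zero]

/-- Free extensions by generators of degree `k`. -/
theorem IsFreeExt.kExt {I : Type*} {deg : I → ℕ} {V : I → Type u} [∀ i, AddCommGroup (V i)]
    [∀ i, Module ℚ (V i)] {γ : ∀ i, V i →ₗ[ℚ] N.carrier} (hf : IsFreeExt ι deg V γ)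
    (hP : P.IsConn) (hk : 2 ≤ k) (i₀ : I) (h₀ : deg i₀ = k)
    (hs : ∀ i, i ≠ i₀ → Subsingleton (V i)) :
    KExt ι k ∧ ∀ x ∈ N.gr k, ∃ y ∈ P.gr k, ∃ v, x = ι y + γ i₀ v := by
  classical
  -- Allowing further generating spaces, all zero, covers both a single space of generators and a
  -- resolution concentrated in degree 0.
  have hγ0 : ∀ i, i ≠ i₀ → ∀ v, γ i v = 0 := fun i hi v => by
    have := hs i hi
    rw [Subsingleton.elim v 0, map_zero]
  let Z : Submodule ℚ N.carrier :=
    (P.gr k).map ι.toAlgHom.toLinearMap ⊔ LinearMap.range (γ i₀)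
  have hZ : Z ≤ N.gr k := by
    refine sup_le ?_ ?_
    · rintro _ ⟨y, hy, rfl⟩
      exact ι.map_gr k y hy
    · rintro _ ⟨v, rfl⟩
      exact h₀ ▸ hf.1 i₀ v
  have hPZ : ∀ x ∈ P.gr k, ι x ∈ Z := fun x hx => Submodule.mem_sup_left ⟨x, hx, rfl⟩
  have hX := gens_homogeneous (ι := ι) hZ
  have hγX : ∀ i v, γ i v ∈ Algebra.adjoin ℚ (gens ι Z) := by
    intro i v
    by_cases hi : i = i₀
    · subst hi
      exact Algebra.subset_adjoin (Or.inr (Submodule.mem_sup_right ⟨v, rfl⟩))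
    · rw [hγ0 i hi v]
      exact zero_mem _
  -- Freeness gives a map to the subalgebra generated by `P` and `Z`; uniqueness of maps makes this
  -- subalgebra everything.
  have hgen : Algebra.adjoin ℚ (gens ι Z) = ⊤ := by
    obtain ⟨h, ⟨hh1, hh2⟩, -⟩ := hf.2 (N.sub _ hX) (ι.toSub _ hX (map_mem_adjoin_gens ι Z))
      (fun i => (γ i).codRestrict (Subalgebra.toSubmodule (Algebra.adjoin ℚ (gens ι Z))) (hγX i))
      (fun i v => hf.1 i v)
    refine GCAlg.adjoin_eq_top _ hX h ?_ ?_
    · intro g hg x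
      have hg1 : ∀ x, g (ι x) = ι x := by
        intro x
        have := GCAlg.mem_of_mem_iSup_gr (A := P)
          (T := LinearMap.eqLocus (g.toAlgHom.comp ι.toAlgHom).toLinearMap ι.toAlgHom.toLinearMap)
          (fun i y hy => hg _ (Or.inl ⟨i, y, hy, rfl⟩)) x
        exact this
      have hg2 : ∀ i v, g (γ i v) = γ i v := by
        intro i v
        by_cases hi : i = i₀
        · subst hi
          exact hg _ (Or.inr (Submodule.mem_sup_right ⟨v, rfl⟩))
        · rw [hγ0 i hi v, map_zero]
      obtain ⟨h', -, hu⟩ := hf.2 N ι γ hf.1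
      have e1 := hu g ⟨hg1, hg2⟩
      have e2 := hu (GCAlg.Hom.id N) ⟨fun _ => rfl, fun _ _ => rfl⟩
      rw [e1, ← e2]
      rfl
    · rintro x (⟨i, y, hy, rfl⟩ | hx)
      · rw [hh1]; rfl
      · obtain ⟨_, ⟨y, hy, rfl⟩, _, ⟨v, rfl⟩, rfl⟩ := Submodule.mem_sup.1 hx
        rw [map_add, map_add]
        congr 1
        · exact congrArg (N.subIncl _ hX) (hh1 y)
        · exact congrArg (N.subIncl _ hX) (hh2 i₀ v)
  have hF := fun x : N.carrier => proj_mem_of_mem_adjoin_gens (x := x) hP hk hZ hPZ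
    (hgen ▸ Algebra.mem_top)
  have hNZ : N.gr k ≤ Z := fun x hx => by
    have := (hF x).2
    rwa [GCAlg.proj_same hx] at this
  refine ⟨⟨?_, ?_, ?_, ?_, ?_⟩, ?_⟩
  -- Sending all new generators to 0 retracts `N` onto `P`.
  · obtain ⟨h, ⟨hh, -⟩, -⟩ := hf.2 P (GCAlg.Hom.id P) (fun _ => 0) (fun _ _ => zero_mem _)
    exact Function.LeftInverse.injective (g := h) hh
  · intro i hi x hx
    have := (hF x).1 i (by omega) (by omega)
    rwa [GCAlg.proj_same hx] at this
  · intro x hx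
    have := (hF x).1 (k + 1) (by omega) (by omega)
    rwa [GCAlg.proj_same hx] at this
  · rw [eq_top_iff, ← hgen]
    refine Algebra.adjoin_mono ?_
    rintro x (hx | hx)
    · exact Or.inl hx
    · exact Or.inr (hZ hx)
  · intro B f b hb hbf
    obtain ⟨h, ⟨hh1, hh2⟩, -⟩ := hf.2 B f (fun i => b ∘ₗ γ i) (fun i v => by
      by_cases hi : i = i₀
      · subst hi
        rw [h₀]
        exact hb _ (h₀ ▸ hf.1 i v)
      · simp [hγ0 i hi v])
    refine ⟨h, hh1, fun x hx => ?_⟩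
    obtain ⟨_, ⟨y, hy, rfl⟩, _, ⟨v, rfl⟩, rfl⟩ := Submodule.mem_sup.1 (hNZ hx)
    rw [map_add, map_add]
    congr 1
    · exact (hh1 y).trans (hbf y hy).symm
    · exact hh2 i₀ v
  · intro x hx
    obtain ⟨_, ⟨y, hy, rfl⟩, _, ⟨v, rfl⟩, rfl⟩ := Submodule.mem_sup.1 (hNZ hx)
    exact ⟨y, hy, v, rfl⟩

/-- The hypotheses say `N^k = P^k ⊕ V`, so data on `P` and on `V` amount to a linear map on `N^k`,
to which `KExt.lift` applies. This converts the working notion back to the one used in the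
definitions. -/
theorem KExt.isFreeExt (hN : KExt ι k) {V : Type u} [AddCommGroup V] [Module ℚ V]
    (γ : V →ₗ[ℚ] N.carrier) (hγ : ∀ v, γ v ∈ N.gr k)
    (hspan : ∀ x ∈ N.gr k, ∃ y ∈ P.gr k, ∃ v, x = ι y + γ v)
    (hdisj : ∀ y ∈ P.gr k, ∀ v, ι y + γ v = 0 → v = 0) :
    IsFreeExt ι (fun _ : Unit => k) (fun _ => V) (fun _ => γ) := by
  refine ⟨fun _ v => hγ v, fun B f b hb => ?_⟩
  let q : (P.gr k × V) →ₗ[ℚ] N.carrier :=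
    (ι.toAlgHom.toLinearMap ∘ₗ (P.gr k).subtype).coprod γ
  have hq : ∀ y v, q (y, v) = ι y + γ v := fun y v => by simp [q]
  have hqi : LinearMap.ker q = ⊥ := by
    rw [LinearMap.ker_eq_bot']
    rintro ⟨y, v⟩ h
    rw [hq] at h
    have hv := hdisj y y.2 v h
    subst hv
    rw [map_zero, add_zero] at h
    have : y = 0 := Subtype.ext (hN.inj (by rw [h]; simp))
    rw [this]; rfl
  obtain ⟨r, hr⟩ := q.exists_leftInverse_of_injective hqi
  have hr' : ∀ y v, r (q (y, v)) = (y, v) := fun y v => LinearMap.congr_fun hr (y, v)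
  let b' : N.carrier →ₗ[ℚ] B.carrier :=
    ((f.toAlgHom.toLinearMap ∘ₗ (P.gr k).subtype).coprod (b ())) ∘ₗ r
  have hb' : ∀ y (hy : y ∈ P.gr k) v, b' (ι y + γ v) = f y + b () v := by
    intro y hy v
    have : b' (q (⟨y, hy⟩, v)) = f y + b () v := by
      simp only [b', LinearMap.comp_apply, hr']
      simp
    rwa [hq] at this
  obtain ⟨h, h1, h2⟩ := hN.lift B f b' (by
    intro x hx
    obtain ⟨y, hy, v, rfl⟩ := hspan x hx
    rw [hb' y hy v]
    exact add_mem (f.map_gr _ _ hy) (hb () v)) (by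
    intro x hx
    have := hb' x hx 0
    simpa using this)
  refine ⟨h, ⟨h1, fun _ v => ?_⟩, ?_⟩
  · rw [h2 _ (hγ v)]
    have := hb' 0 (zero_mem _) v
    simpa using this
  · rintro g ⟨hg1, hg2⟩
    refine GCAlg.Hom.ext_fun (hN.hom_ext (fun x => (hg1 x).trans (h1 x).symm) fun x hx => ?_)
    obtain ⟨y, hy, v, rfl⟩ := hspan x hx
    rw [h2 _ hx, hb' y hy v, map_add, hg1, hg2 ()]

theorem KExt.comp {ι : GCAlg.Hom P E} {j : GCAlg.Hom E N} (hj : KExt j k) (hι : KExt ι k) :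
    KExt (j.comp ι) k where
  inj := hj.inj.comp hι.inj
  low := fun i hi x hx => by
    obtain ⟨y, hy, rfl⟩ := hj.low i hi x hx
    obtain ⟨z, hz, rfl⟩ := hι.low i hi y hy
    exact ⟨z, hz, rfl⟩
  top := fun x hx => by
    obtain ⟨y, hy, rfl⟩ := hj.top x hx
    obtain ⟨z, hz, rfl⟩ := hι.top y hy
    exact ⟨z, hz, rfl⟩
  gen := by
    rw [eq_top_iff, ← hj.gen]
    refine Algebra.adjoin_le ?_
    rintro _ (⟨i, y, -, rfl⟩ | hx)
    · have hy : y ∈ Algebra.adjoin ℚ (gens ι (E.gr k)) := hι.gen ▸ Algebra.mem_top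
      have : Algebra.adjoin ℚ (gens ι (E.gr k)) ≤
          (Algebra.adjoin ℚ (gens (j.comp ι) (N.gr k))).comap j.toAlgHom := by
        refine Algebra.adjoin_le ?_
        rintro _ (⟨i, z, hz, rfl⟩ | hx)
        · exact Algebra.subset_adjoin (Or.inl ⟨i, z, hz, rfl⟩)
        · exact Algebra.subset_adjoin (Or.inr (j.map_gr _ _ hx))
      exact this hy
    · exact Algebra.subset_adjoin (Or.inr hx)
  lift := fun B f b hb hbf => by
    obtain ⟨h, h1, h2⟩ := hι.lift B f (b ∘ₗ j.toAlgHom.toLinearMap)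
      (fun x hx => hb _ (j.map_gr _ _ hx)) hbf
    obtain ⟨h', h1', h2'⟩ := hj.lift B h b hb (fun x hx => (h2 x hx).symm)
    exact ⟨h', fun x => (h1' (ι x)).trans (h1 x), h2'⟩

/-- A map on `E` is determined by its values on `P` and on `E^k`, so lifting along `j` reduces to
lifting along the composite. Injectivity of `j` is assumed only in degree `k`: a linear left inverse
there extends, by this lifting property, to an algebra retraction onto `E`. -/
theorem KExt.cancel {ι : GCAlg.Hom P E} {j : GCAlg.Hom E N} (hN : KExt (j.comp ι) k)
    (hι : KExt ι k) (hj : ∀ x ∈ E.gr k, j x = 0 → x = 0) : KExt j k := by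
  have hlift : ∀ (B : GCAlg.{u}) (f : GCAlg.Hom E B) (b : N.carrier →ₗ[ℚ] B.carrier),
      (∀ x ∈ N.gr k, b x ∈ B.gr k) → (∀ x ∈ E.gr k, b (j x) = f x) →
      ∃ h : GCAlg.Hom N B, (∀ x, h (j x) = f x) ∧ ∀ x ∈ N.gr k, h x = b x := by
    intro B f b hb hbf
    obtain ⟨h, h1, h2⟩ := hN.lift B (f.comp ι) b hb
      (fun x hx => hbf _ (ι.map_gr _ _ hx))
    refine ⟨h, fun x => ?_, h2⟩
    exact hι.hom_ext (f := h.comp j) (g := f) h1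
      (fun x hx => (h2 _ (j.map_gr _ _ hx)).trans (hbf x hx)) x
  refine ⟨?_, ?_, ?_, ?_, hlift⟩
  · obtain ⟨r, hr⟩ := (j.toAlgHom.toLinearMap ∘ₗ (E.gr k).subtype).exists_leftInverse_of_injective
      (by
        rw [LinearMap.ker_eq_bot']
        exact fun x hx => Subtype.ext (hj x x.2 hx))
    obtain ⟨h, h1, -⟩ := hlift E (GCAlg.Hom.id E) ((E.gr k).subtype ∘ₗ r)
      (fun x _ => (r x).2)
      (fun x hx => congrArg Subtype.val (LinearMap.congr_fun hr ⟨x, hx⟩))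
    exact Function.LeftInverse.injective (g := h) h1
  · intro i hi x hx
    obtain ⟨y, hy, rfl⟩ := hN.low i hi x hx
    exact ⟨ι y, ι.map_gr _ _ hy, rfl⟩
  · intro x hx
    obtain ⟨y, hy, rfl⟩ := hN.top x hx
    exact ⟨ι y, ι.map_gr _ _ hy, rfl⟩
  · rw [eq_top_iff, ← hN.gen]
    refine Algebra.adjoin_mono ?_
    rintro _ (⟨i, y, hy, rfl⟩ | hx)
    · exact Or.inl ⟨i, ι y, ι.map_gr _ _ hy, rfl⟩
    · exact Or.inr hx

/-- Intermediate extensions. -/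
theorem KExt.sub (hN : KExt ι k) (hP : P.IsConn) (hk : 2 ≤ k) {Z : Submodule ℚ N.carrier}
    (hZ : Z ≤ N.gr k) (hPZ : ∀ x ∈ P.gr k, ι x ∈ Z)
    (hX : ∀ x ∈ gens ι Z, ∃ i, x ∈ N.gr i) :
    KExt (ι.toSub (gens ι Z) hX (map_mem_adjoin_gens ι Z)) k ∧
      ∀ x ∈ (N.sub (gens ι Z) hX).gr k, N.subIncl _ hX x ∈ Z := by
  have hk' : ∀ x ∈ (N.sub (gens ι Z) hX).gr k, N.subIncl _ hX x ∈ Z := by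
    intro x hx
    have := (proj_mem_of_mem_adjoin_gens hP hk hZ hPZ (GCAlg.subIncl_mem _ hX x)).2
    rwa [GCAlg.proj_same ((N.subIncl _ hX).map_gr _ _ hx)] at this
  refine ⟨⟨?_, ?_, ?_, ?_, ?_⟩, hk'⟩
  · intro x y h
    exact hN.inj (congrArg (N.subIncl _ hX) h)
  · intro i hi x hx
    obtain ⟨y, hy, h⟩ := hN.low i hi _ ((N.subIncl _ hX).map_gr _ _ hx)
    exact ⟨y, hy, GCAlg.subIncl_injective _ hX h⟩
  · intro x hx
    obtain ⟨y, hy, h⟩ := hN.top _ ((N.subIncl _ hX).map_gr _ _ hx)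
    exact ⟨y, hy, GCAlg.subIncl_injective _ hX h⟩
  · rw [eq_top_iff]
    rintro ⟨x, hx⟩ -
    refine Algebra.adjoin_induction (R := ℚ) (s := gens ι Z)
      (p := fun x hx => (⟨x, hx⟩ : (N.sub (gens ι Z) hX).carrier) ∈
        Algebra.adjoin ℚ (gens (ι.toSub (gens ι Z) hX (map_mem_adjoin_gens ι Z))
          ((N.sub (gens ι Z) hX).gr k))) ?_ ?_ ?_ ?_ hx
    · rintro _ (⟨i, y, hy, rfl⟩ | hx)
      · exact Algebra.subset_adjoin (Or.inl ⟨i, y, hy, rfl⟩)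
      · exact Algebra.subset_adjoin (Or.inr (hZ hx))
    · intro r
      exact Subalgebra.algebraMap_mem (Algebra.adjoin ℚ
        (gens (ι.toSub (gens ι Z) hX (map_mem_adjoin_gens ι Z)) ((N.sub (gens ι Z) hX).gr k))) r
    · intro x y _ _ hx hy
      exact add_mem hx hy
    · intro x y _ _ hx hy
      exact mul_mem hx hy
  · intro B f b hb hbf
    let W := (N.sub (gens ι Z) hX).gr k
    -- A linear left inverse of the inclusion in degree `k` transports `b` to `N`, where the lifting
    -- property is available.
    obtain ⟨r, hr⟩ := ((N.subIncl _ hX).toAlgHom.toLinearMap ∘ₗ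
      W.subtype).exists_leftInverse_of_injective (by
        rw [LinearMap.ker_eq_bot']
        exact fun x hx => Subtype.ext (GCAlg.subIncl_injective _ hX hx))
    have hr' : ∀ x (hx : x ∈ W), r (N.subIncl _ hX x) = ⟨x, hx⟩ :=
      fun x hx => LinearMap.congr_fun hr ⟨x, hx⟩
    obtain ⟨h, h1, h2⟩ := hN.lift B f (b ∘ₗ W.subtype ∘ₗ r) (fun x _ => hb _ (r x).2)
      (fun x hx => by
        have h3 : ι.toSub _ hX (map_mem_adjoin_gens ι Z) x ∈ W := ι.map_gr _ _ hx
        have h4 := hr' _ h3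
        change b (r (ι x) : (N.sub (gens ι Z) hX).carrier) = f x
        rw [← hbf x hx]
        exact congrArg b (congrArg Subtype.val h4))
    refine ⟨h.comp (N.subIncl _ hX), h1, fun x hx => ?_⟩
    change h (N.subIncl _ hX x) = b x
    rw [h2 _ (hZ (hk' x hx))]
    exact congrArg b (congrArg Subtype.val (hr' x hx))

end Extensions


/-! ### Minimal algebras -/

/-- `m` is minimal, with generators `V i` of degree `i` for `i ≤ n`. -/
structure CDGA.MinGen (m : CDGA.{u}) (n : ℕ) (V : ℕ → Submodule ℚ m.carrier) : Prop where
  le : ∀ i, V i ≤ m.gr i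
  zero : V 0 = ⊥
  one : V 1 = ⊥
  above : ∀ i, n < i → V i = ⊥
  d_mem : ∀ i, ∀ v ∈ V i, m.d v ∈ Algebra.adjoin ℚ {x | ∃ j < i, x ∈ V j}
  free : ∀ (B : GCAlg.{u}) (b : ℕ → m.carrier →ₗ[ℚ] B.carrier),
    (∀ i, ∀ v ∈ V i, b i v ∈ B.gr i) →
      ∃! h : GCAlg.Hom m.toGCAlg B, ∀ i, ∀ v ∈ V i, h v = b i v

/-- Linear maps on a subspace extend to the whole space. With globally defined `b` there are no maps
whose domain depends on `V i`, so `V` can be changed degree by degree. -/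
theorem free_iff_free_global {m : GCAlg.{u}} {V : ℕ → Submodule ℚ m.carrier} :
    (∀ (B : GCAlg.{u}) (b : ∀ i, V i →ₗ[ℚ] B.carrier), (∀ i v, b i v ∈ B.gr i) →
      ∃! h : GCAlg.Hom m B, ∀ i (v : V i), h v = b i v) ↔
    ∀ (B : GCAlg.{u}) (b : ℕ → m.carrier →ₗ[ℚ] B.carrier), (∀ i, ∀ v ∈ V i, b i v ∈ B.gr i) →
      ∃! h : GCAlg.Hom m B, ∀ i, ∀ v ∈ V i, h v = b i v := by
  constructor
  · intro H B b hb
    obtain ⟨h, h1, h2⟩ := H B (fun i => b i ∘ₗ (V i).subtype) (fun i v => hb i v v.2)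
    exact ⟨h, fun i v hv => h1 i ⟨v, hv⟩, fun g hg => h2 g fun i v => hg i v v.2⟩
  · intro H B b hb
    choose b' hb' using fun i => (b i).exists_extend
    have e : ∀ i (v : V i), b' i v = b i v := fun i v => LinearMap.congr_fun (hb' i) v
    obtain ⟨h, h1, h2⟩ := H B b' (fun i v hv => by rw [e i ⟨v, hv⟩]; exact hb _ _)
    exact ⟨h, fun i v => (h1 i v v.2).trans (e i v),
      fun g hg => h2 g fun i v hv => (hg i ⟨v, hv⟩).trans (e i ⟨v, hv⟩).symm⟩

theorem CDGA.MinGen.isMinimal {m : CDGA.{u}} {n : ℕ} {V : ℕ → Submodule ℚ m.carrier}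
    (h : m.MinGen n V) : m.IsMinimal :=
  ⟨V, h.le, h.zero, h.one, h.d_mem, free_iff_free_global.2 h.free⟩

theorem adjoin_eq_top_of_free {m : GCAlg.{u}} {V : ℕ → Submodule ℚ m.carrier}
    (hle : ∀ i, V i ≤ m.gr i)
    (hfree : ∀ (B : GCAlg.{u}) (b : ℕ → m.carrier →ₗ[ℚ] B.carrier),
      (∀ i, ∀ v ∈ V i, b i v ∈ B.gr i) → ∃! h : GCAlg.Hom m B, ∀ i, ∀ v ∈ V i, h v = b i v) :
    Algebra.adjoin ℚ {x | ∃ j, x ∈ V j} = ⊤ := by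
  have hX : ∀ x ∈ {x | ∃ j, x ∈ V j}, ∃ i, x ∈ m.gr i := fun x ⟨j, hj⟩ => ⟨j, hle j hj⟩
  obtain ⟨c, hc⟩ := (Submodule.subtype (Subalgebra.toSubmodule
    (Algebra.adjoin ℚ {x | ∃ j, x ∈ V j}))).exists_leftInverse_of_injective (by simp)
  have hc' : ∀ x (hx : x ∈ Algebra.adjoin ℚ {x | ∃ j, x ∈ V j}), c x = ⟨x, hx⟩ :=
    fun x hx => LinearMap.congr_fun hc ⟨x, hx⟩
  have hval : ∀ i, ∀ v ∈ V i, ((c v : Algebra.adjoin ℚ {x | ∃ j, x ∈ V j}) : m.carrier) = v :=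
    fun i v hv => congrArg Subtype.val (hc' v (Algebra.subset_adjoin ⟨i, hv⟩))
  obtain ⟨h, h1, -⟩ := hfree (m.sub _ hX) (fun _ => c) (fun i v hv => by
    change ((c v : Algebra.adjoin ℚ {x | ∃ j, x ∈ V j}) : m.carrier) ∈ m.gr i
    rw [hval i v hv]
    exact hle i hv)
  refine GCAlg.adjoin_eq_top _ hX h (fun g hg x => ?_) ?_
  · obtain ⟨h', -, hu⟩ := hfree m (fun _ => LinearMap.id) (fun i v hv => hle i hv)
    rw [hu g fun i v hv => hg v ⟨i, hv⟩, ← hu (GCAlg.Hom.id m) fun _ _ _ => rfl]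
    rfl
  · rintro x ⟨i, hi⟩
    rw [h1 i x hi]
    exact hval i x hi

theorem CDGA.MinGen.adjoin_eq_top {m : CDGA.{u}} {n : ℕ} {V : ℕ → Submodule ℚ m.carrier}
    (h : m.MinGen n V) : Algebra.adjoin ℚ {x | ∃ j < n + 1, x ∈ V j} = ⊤ := by
  rw [eq_top_iff, ← adjoin_eq_top_of_free h.le h.free]
  refine Algebra.adjoin_le ?_
  rintro x ⟨j, hj⟩
  by_cases hjn : j < n + 1
  · exact Algebra.subset_adjoin ⟨j, hjn, hj⟩
  · rw [h.above j (by omega), Submodule.mem_bot] at hj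
    rw [hj]
    exact zero_mem _

theorem CDGA.MinGen.genLE {m : CDGA.{u}} {n : ℕ} {V : ℕ → Submodule ℚ m.carrier}
    (h : m.MinGen n V) : genLE m.gr n = ⊤ := by
  rw [eq_top_iff, ← h.adjoin_eq_top]
  refine Algebra.adjoin_mono ?_
  rintro x ⟨j, hj, hx⟩
  exact ⟨j, by omega, h.le j hx⟩

/-- The new generators form a complement of `m^{n+1}` in `N^{n+1}`. Their differentials lie in
`N^{n+2}`, which comes from `m`, so they are polynomials in the old generators. -/
theorem CDGA.MinGen.extend {m N : CDGA.{u}} {n : ℕ} {V : ℕ → Submodule ℚ m.carrier}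
    (h : m.MinGen n V) (hn : 1 ≤ n) (ι : CDGA.Hom m N) (hι : KExt ι.toGAHom (n + 1)) :
    ∃ V', N.MinGen (n + 1) V' := by
  classical
  obtain ⟨C, hC⟩ := Submodule.exists_isCompl ((m.gr (n + 1)).map ι.toAlgHom.toLinearMap)
  let U := C ⊓ N.gr (n + 1)
  have hspan : ∀ x ∈ N.gr (n + 1), ∃ y ∈ m.gr (n + 1), ∃ v : U, x = ι y + v := by
    intro x hx
    have hx' : x ∈ (m.gr (n + 1)).map ι.toAlgHom.toLinearMap ⊔ C := hC.sup_eq_top ▸ trivial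
    obtain ⟨_, ⟨y, hy, rfl⟩, c, hc, rfl⟩ := Submodule.mem_sup.1 hx'
    exact ⟨y, hy, ⟨c, hc, (Submodule.add_mem_iff_right _ (ι.map_gr _ _ hy)).1 hx⟩, rfl⟩
  have hdisj : ∀ y ∈ m.gr (n + 1), ∀ v : U, ι y + (v : N.carrier) = 0 → v = 0 := by
    intro y hy v hv
    have h1 : (v : N.carrier) = ι (-y) := by
      rw [map_neg]; exact eq_neg_of_add_eq_zero_right hv
    exact Subtype.ext (Submodule.disjoint_def.1 hC.disjoint v
      ⟨-y, neg_mem hy, h1.symm⟩ v.2.1)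
  have hfree := hι.isFreeExt U.subtype (fun v => v.2.2) hspan hdisj
  let V' : ℕ → Submodule ℚ N.carrier := fun i =>
    if i = n + 1 then U else (V i).map ι.toAlgHom.toLinearMap
  have hVn : V' (n + 1) = U := if_pos rfl
  have hUV : ∀ v : U, (v : N.carrier) ∈ V' (n + 1) := fun v => by rw [hVn]; exact v.2
  have hV : ∀ i, i ≠ n + 1 → V' i = (V i).map ι.toAlgHom.toLinearMap := fun i hi => if_neg hi
  have hd : ∀ i ≤ n + 1, ∀ x ∈ Algebra.adjoin ℚ {x | ∃ j < i, x ∈ V j},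
      ι x ∈ Algebra.adjoin ℚ {x | ∃ j < i, x ∈ V' j} := by
    intro i hi x hx
    have : Algebra.adjoin ℚ {x | ∃ j < i, x ∈ V j} ≤
        (Algebra.adjoin ℚ {x | ∃ j < i, x ∈ V' j}).comap ι.toAlgHom := by
      refine Algebra.adjoin_le ?_
      rintro y ⟨j, hj, hy⟩
      refine Algebra.subset_adjoin ⟨j, hj, ?_⟩
      rw [hV j (by omega)]
      exact ⟨y, hy, rfl⟩
    exact this hx
  refine ⟨V', ?_, ?_, ?_, ?_, ?_, ?_⟩
  · intro i
    by_cases hi : i = n + 1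
    · subst hi; rw [hVn]; exact inf_le_right
    · rw [hV i hi]
      rintro _ ⟨y, hy, rfl⟩
      exact ι.map_gr _ _ (h.le i hy)
  · rw [hV 0 (by omega), h.zero, Submodule.map_bot]
  · rw [hV 1 (by omega), h.one, Submodule.map_bot]
  · intro i hi
    rw [hV i (by omega), h.above i (by omega), Submodule.map_bot]
  · intro i v hv
    by_cases hi : i = n + 1
    · subst hi
      rw [hVn] at hv
      obtain ⟨y, -, hy⟩ := hι.top _ (N.d_gr _ _ hv.2)
      rw [← hy]
      exact hd _ le_rfl y (h.adjoin_eq_top ▸ Algebra.mem_top)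
    · rw [hV i hi] at hv
      obtain ⟨y, hy, rfl⟩ := hv
      by_cases hi' : i ≤ n + 1
      · have := hd i hi' _ (h.d_mem i y hy)
        rw [ι.map_d] at this
        exact this
      · rw [SetLike.mem_coe, h.above i (by omega), Submodule.mem_bot] at hy
        rw [hy, map_zero, map_zero]
        exact zero_mem _
  · intro B b hb
    have hbι : ∀ i, ∀ v ∈ V i, b i (ι v) ∈ B.gr i ∧ (i = n + 1 → v = 0) := by
      intro i v hv
      by_cases hi : i = n + 1
      · rw [h.above i (by omega), Submodule.mem_bot] at hv
        rw [hv, map_zero, map_zero]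
        exact ⟨zero_mem _, fun _ => rfl⟩
      · refine ⟨hb i _ ?_, fun h => absurd h hi⟩
        rw [hV i hi]
        exact ⟨v, hv, rfl⟩
    obtain ⟨f, hf, hfu⟩ := h.free B (fun i => b i ∘ₗ ι.toAlgHom.toLinearMap)
      (fun i v hv => (hbι i v hv).1)
    obtain ⟨g, ⟨hg1, hg2⟩, hgu⟩ := hfree.2 B f (fun _ => b (n + 1) ∘ₗ U.subtype)
      (fun _ v => hb _ _ (hUV v))
    refine ⟨g, ?_, ?_⟩
    · intro i v hv
      by_cases hi : i = n + 1
      · subst hi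
        rw [hVn] at hv
        exact hg2 () ⟨v, hv⟩
      · rw [hV i hi] at hv
        obtain ⟨y, hy, rfl⟩ := hv
        exact (hg1 y).trans (hf i y hy)
    · intro g' hg'
      refine hgu g' ⟨?_, fun _ v => hg' _ _ (hUV v)⟩
      have : g'.comp ι.toGAHom = f := by
        refine hfu _ fun i v hv => ?_
        by_cases hi : i = n + 1
        · rw [(hbι i v hv).2 hi, map_zero, map_zero]
        · refine hg' i _ ?_
          rw [hV i hi]
          exact ⟨v, hv, rfl⟩
      intro x
      rw [← this]
      rfl

/-! ### Minimal algebras as extensions -/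

/-- Degrees add, so a monomial of degree `< n` uses only generators of degree `< n`. The family `S`
imposes this below degree `n` and nothing from there on. -/
theorem GCAlg.mem_adjoin_of_degree_le {m : GCAlg.{u}} {V : ℕ → Submodule ℚ m.carrier}
    (hle : ∀ i, V i ≤ m.gr i) (htop : Algebra.adjoin ℚ {x | ∃ j, x ∈ V j} = ⊤) {n i : ℕ}
    (hi : i < n) {x : m.carrier} (hx : x ∈ m.gr i) :
    x ∈ Algebra.adjoin ℚ {x | ∃ j < n, x ∈ V j} := by
  let S : ℕ → Submodule ℚ m.carrier := fun i =>
    if i < n then m.gr i ⊓ Subalgebra.toSubmodule (Algebra.adjoin ℚ {x | ∃ j < n, x ∈ V j})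
    else m.gr i
  have hS : ∀ i, S i ≤ m.gr i := fun i => by
    simp only [S]; split_ifs
    · exact inf_le_left
    · exact le_rfl
  have hS1 : ∀ i < n, S i =
      m.gr i ⊓ Subalgebra.toSubmodule (Algebra.adjoin ℚ {x | ∃ j < n, x ∈ V j}) :=
    fun i hi => if_pos hi
  have hS2 : ∀ i, ¬ i < n → S i = m.gr i := fun i hi => if_neg hi
  have := proj_mem_adjoin (x := x) S hS ?_ ?_ (X := {x | ∃ j, x ∈ V j}) ?_
    (htop ▸ Algebra.mem_top) i
  · rw [proj_same hx, hS1 i hi] at this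
    exact this.2
  · rw [hS1 0 (by omega)]
    exact ⟨one_mem, Subalgebra.one_mem _⟩
  · intro i j x y hx hy
    by_cases hij : i + j < n
    · rw [hS1 i (by omega)] at hx
      rw [hS1 j (by omega)] at hy
      rw [hS1 _ hij]
      exact ⟨mul_mem hx.1 hy.1, Subalgebra.mul_mem _ hx.2 hy.2⟩
    · rw [hS2 _ hij]
      exact mul_mem (hS i hx) (hS j hy)
  · rintro x ⟨j, hj⟩
    refine ⟨j, ?_⟩
    by_cases hjn : j < n
    · rw [hS1 j hjn]
      exact ⟨hle j hj, Algebra.subset_adjoin ⟨j, hjn, hj⟩⟩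
    · rw [hS2 j hjn]
      exact hle j hj

theorem GCAlg.isConn_of_adjoin {m : GCAlg.{u}} {V : ℕ → Submodule ℚ m.carrier}
    (hle : ∀ i, V i ≤ m.gr i) (h0 : V 0 = ⊥) (h1 : V 1 = ⊥)
    (htop : Algebra.adjoin ℚ {x | ∃ j, x ∈ V j} = ⊤) : m.IsConn := by
  have key : ∀ i < 2, ∀ x ∈ m.gr i, ∃ q : ℚ, algebraMap ℚ _ q = x := by
    intro i hi x hx
    have := mem_adjoin_of_degree_le hle htop hi hx
    have hset : {x | ∃ j < 2, x ∈ V j} ⊆ ((⊥ : Subalgebra ℚ m.carrier) : Set m.carrier) := by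
      rintro y ⟨j, hj, hy⟩
      have : y = 0 := by
        interval_cases j
        · rwa [h0, Submodule.mem_bot] at hy
        · rwa [h1, Submodule.mem_bot] at hy
      rw [this]
      exact zero_mem _
    exact Algebra.mem_bot.1 (Algebra.adjoin_le hset this)
  refine ⟨key 0 (by omega), fun x hx => ?_⟩
  obtain ⟨q, rfl⟩ := key 1 (by omega) x hx
  exact eq_zero_of_mem (algebraMap_mem q) hx (by omega)

/-- In a free algebra, `N^i` is spanned by the generators of degree `i` and by a subalgebra that
contains those of degree `< i`. -/
theorem GCAlg.mem_sup_of_adjoin {m : GCAlg.{u}} (hm : m.IsConn) {V : ℕ → Submodule ℚ m.carrier}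
    (hle : ∀ i, V i ≤ m.gr i) (htop : Algebra.adjoin ℚ {x | ∃ j, x ∈ V j} = ⊤)
    (R : Subalgebra ℚ m.carrier) {i : ℕ} (hi : 0 < i)
    (hR : ∀ j < i, ∀ x ∈ V j, x ∈ R) {x : m.carrier} (hx : x ∈ m.gr i) :
    ∃ y ∈ m.gr i, y ∈ R ∧ ∃ v ∈ V i, x = y + v := by
  -- Below degree `i` elements must lie in `R`, in degree `i` in `R` plus generators, and above
  -- there is no condition. A product landing in degree `i` has both factors in smaller degree
  -- unless one of them is a scalar.
  let S : ℕ → Submodule ℚ m.carrier := fun j =>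
    if j < i then m.gr j ⊓ Subalgebra.toSubmodule R else
      if j = i then (m.gr i ⊓ Subalgebra.toSubmodule R) ⊔ V i else m.gr j
  have hS1 : ∀ j < i, S j = m.gr j ⊓ Subalgebra.toSubmodule R := fun j hj => if_pos hj
  have hSi : S i = (m.gr i ⊓ Subalgebra.toSubmodule R) ⊔ V i := by simp [S]
  have hS2 : ∀ j, i < j → S j = m.gr j := fun j hj => by
    simp [S, show ¬ j < i by omega, show j ≠ i by omega]
  have hS : ∀ j, S j ≤ m.gr j := by
    intro j
    rcases lt_trichotomy j i with h | h | h
    · rw [hS1 j h]; exact inf_le_left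
    · subst h; rw [hSi]; exact sup_le inf_le_left (hle _)
    · rw [hS2 j h]
  have := proj_mem_adjoin (x := x) S hS ?_ ?_ (X := {x | ∃ j, x ∈ V j}) ?_
    (htop ▸ Algebra.mem_top) i
  · rw [proj_same hx, hSi] at this
    obtain ⟨y, hy, v, hv, rfl⟩ := Submodule.mem_sup.1 this
    exact ⟨y, hy.1, hy.2, v, hv, rfl⟩
  · rw [hS1 0 hi]
    exact ⟨one_mem, Subalgebra.one_mem _⟩
  · intro a b x y hx hy
    by_cases ha : a = 0
    · subst ha
      obtain ⟨q, rfl⟩ := hm.zero x (hS _ hx)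
      rw [zero_add, ← Algebra.smul_def]
      exact Submodule.smul_mem _ _ hy
    by_cases hb : b = 0
    · subst hb
      obtain ⟨q, rfl⟩ := hm.zero y (hS _ hy)
      rw [add_zero, ← Algebra.commutes, ← Algebra.smul_def]
      exact Submodule.smul_mem _ _ hx
    rcases lt_trichotomy (a + b) i with h | h | h
    · rw [hS1 a (by omega)] at hx
      rw [hS1 b (by omega)] at hy
      rw [hS1 _ h]
      exact ⟨mul_mem hx.1 hy.1, R.mul_mem hx.2 hy.2⟩
    · rw [hS1 a (by omega)] at hx
      rw [hS1 b (by omega)] at hy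
      rw [h, hSi]
      exact Submodule.mem_sup_left ⟨h ▸ mul_mem hx.1 hy.1, R.mul_mem hx.2 hy.2⟩
    · rw [hS2 _ h]
      exact mul_mem (hS a hx) (hS b hy)
  · rintro x ⟨j, hj⟩
    refine ⟨j, ?_⟩
    rcases lt_trichotomy j i with h | h | h
    · rw [hS1 j h]; exact ⟨hle j hj, hR j h x hj⟩
    · subst h; rw [hSi]; exact Submodule.mem_sup_right hj
    · rw [hS2 j h]; exact hle j hj

/-- A minimal algebra `N`, generated in degrees `≤ k`, is an extension in degree `k` of a
subalgebra `P`, generated in degrees `< k`, if the inclusion induces isomorphisms on cohomology in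
degrees `< k` and a monomorphism in degree `k`. -/
theorem CDGA.IsMinimal.kExt {P N : CDGA.{u}} {k : ℕ} (hk : 2 ≤ k) (hN : N.IsMinimal)
    (hNk : genLE N.gr k = ⊤) (hP : P.IsConn) (hPk : genLE P.gr (k - 1) = ⊤) (ι : CDGA.Hom P N)
    (hι : Function.Injective ι)
    (hsurj : ∀ i < k, ∀ z ∈ N.gr i, N.d z = 0 → ∃ p ∈ P.gr i, P.d p = 0 ∧ ∃ w, z = ι p + N.d w)
    (hinj : ∀ i ≤ k, ∀ p ∈ P.gr i, P.d p = 0 → (∃ w, N.d w = ι p) → ∃ q, P.d q = p) :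
    KExt ι.toGAHom k := by
  obtain ⟨V, hle, h0, h1, hd, hfree⟩ := hN
  rw [free_iff_free_global] at hfree
  have htop := adjoin_eq_top_of_free hle hfree
  have hconn := GCAlg.isConn_of_adjoin hle h0 h1 htop
  -- The endomorphism that kills the generators of degree `> k` and fixes the others is the identity
  -- on elements of degree `≤ k`, hence on all of `N`.
  have habove : ∀ i, k < i → ∀ v ∈ V i, v = 0 := by
    intro i hi v hv
    classical
    obtain ⟨h, hh, -⟩ := hfree N.toGCAlg (fun i => if i ≤ k then LinearMap.id else 0)
      (fun i v hv => by
        by_cases hik : i ≤ k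
        · simp only [hik, if_true]; exact hle i hv
        · simp only [hik, if_false]; exact zero_mem _)
    have h1 : ∀ x ∈ genLE N.gr k, h x = (GCAlg.Hom.id N.toGCAlg) x := by
      intro x hx
      refine GCAlg.Hom.eqOn_adjoin h _ ?_ hx
      rintro y ⟨j, hj, hy⟩
      refine GCAlg.Hom.eqOn_adjoin h _ ?_
        (GCAlg.mem_adjoin_of_degree_le hle htop (n := k + 1) (by omega) hy)
      rintro z ⟨l, hl, hz⟩
      rw [hh l z hz, if_pos (by omega)]
      rfl
    have h2 := h1 v (hNk ▸ Algebra.mem_top)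
    rw [hh i v hv, if_neg (by omega)] at h2
    exact h2.symm
  have hrange : ∀ {i} {x : N.carrier}, x ∈ N.gr i → x ∈ ι.toAlgHom.range →
      ∃ y ∈ P.gr i, ι y = x := by
    rintro i x hx ⟨y, rfl⟩
    exact ⟨y, ι.toGAHom.mem_gr_of_injective hι hx, rfl⟩
  have hdR : ∀ i, (∀ j < i, ∀ x ∈ V j, x ∈ ι.toAlgHom.range) →
      ∀ v ∈ V i, N.d v ∈ ι.toAlgHom.range := by
    intro i hi v hv
    refine Algebra.adjoin_le ?_ (hd i v hv)
    rintro x ⟨j, hj, hx⟩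
    exact hi j hj x hx
  have hlow : ∀ i < k, ∀ x ∈ N.gr i, ∃ y ∈ P.gr i, ι y = x := by
    intro i
    induction i using Nat.strong_induction_on with
    | _ i ih =>
    intro hik x hx
    refine hrange hx ?_
    rcases Nat.eq_zero_or_pos i with rfl | hipos
    · obtain ⟨q, rfl⟩ := hconn.zero x hx
      exact Subalgebra.algebraMap_mem _ q
    have hV : ∀ j < i, ∀ x ∈ V j, x ∈ ι.toAlgHom.range := by
      intro j hj x hx
      obtain ⟨y, -, rfl⟩ := ih j hj (by omega) x (hle j hx)
      exact ⟨y, rfl⟩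
    obtain ⟨y, hy, hyR, v, hv, rfl⟩ := GCAlg.mem_sup_of_adjoin hconn hle htop _ hipos hV hx
    refine add_mem hyR ?_
    -- The differential of `v` is a polynomial in lower generators, so it is some `ι p`. As `p`
    -- bounds in `N`, it bounds some `q` in `P`, and `v - ι q` is a cocycle. It agrees with a
    -- cocycle of `P` up to a coboundary, whose primitive has degree `i - 1` and lies in `P` by
    -- induction.
    obtain ⟨p, hp, hpd⟩ := hrange (N.d_gr _ _ (hle i hv)) (hdR i hV v hv)
    obtain ⟨q, hq⟩ := hinj (i + 1) (by omega) p hp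
      (hι (by rw [ι.map_d, hpd, N.d_d, map_zero])) ⟨v, hpd.symm⟩
    obtain ⟨q, hqi, hq⟩ := CDGA.exists_primitive hp hq
    rw [Nat.add_sub_cancel] at hqi
    have hz : N.d (v - ι q) = 0 := by rw [map_sub, ← ι.map_d, hq, hpd, sub_self]
    have hzi : v - ι q ∈ N.gr i := sub_mem (hle i hv) (ι.map_gr _ _ hqi)
    obtain ⟨p', hp', -, w, hw⟩ := hsurj i hik _ hzi hz
    obtain ⟨w', hw', hww⟩ := CDGA.exists_primitive (w := w)
      (sub_mem hzi (ι.map_gr _ _ hp')) (by rw [hw]; simp)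
    obtain ⟨u, -, rfl⟩ := ih (i - 1) (by omega) (by omega) w' hw'
    have : v = ι (q + p' + P.d u) := by
      rw [map_add, map_add, ι.map_d, hww]
      simp
    rw [this]
    exact ⟨_, rfl⟩
  have hVR : ∀ j < k, ∀ x ∈ V j, x ∈ ι.toAlgHom.range := by
    intro j hj x hx
    obtain ⟨y, -, rfl⟩ := hlow j hj x (hle j hx)
    exact ⟨y, rfl⟩
  have hgen : Algebra.adjoin ℚ (gens ι.toGAHom (N.gr k)) = ⊤ := by
    rw [eq_top_iff, ← htop]
    refine Algebra.adjoin_le ?_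
    rintro x ⟨j, hx⟩
    rcases lt_trichotomy j k with h | h | h
    · obtain ⟨y, hy, rfl⟩ := hlow j h x (hle j hx)
      exact Algebra.subset_adjoin (Or.inl ⟨j, y, hy, rfl⟩)
    · subst h
      exact Algebra.subset_adjoin (Or.inr (hle _ hx))
    · rw [habove j h x hx]
      exact zero_mem _
  refine ⟨hι, hlow, ?_, hgen, ?_⟩
  · intro x hx
    have := (proj_mem_of_mem_adjoin_gens (ι := ι.toGAHom) (x := x) hP hk le_rfl
      (fun x hx => ι.map_gr _ _ hx) (hgen ▸ Algebra.mem_top)).1 (k + 1) le_rfl (by omega)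
    rwa [GCAlg.proj_same hx] at this
  · intro B f b hb hbf
    classical
    obtain ⟨r, hr⟩ := ι.toAlgHom.toLinearMap.exists_leftInverse_of_injective
      (LinearMap.ker_eq_bot.2 hι)
    have hr' : ∀ x, r (ι x) = x := fun x => LinearMap.congr_fun hr x
    obtain ⟨h, hh, -⟩ := hfree B (fun i => if i < k then f.toAlgHom.toLinearMap ∘ₗ r else b)
      (fun i v hv => by
        by_cases hi : i < k
        · simp only [hi, if_true]
          obtain ⟨y, hy, rfl⟩ := hlow i hi v (hle i hv)
          change f (r (ι y)) ∈ _
          rw [hr']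
          exact f.map_gr _ _ hy
        · simp only [hi, if_false]
          rcases Nat.eq_or_lt_of_le (Nat.le_of_not_lt hi) with h | h
          · subst h
            exact hb v (hle _ hv)
          · rw [habove i h v hv, map_zero]
            exact zero_mem _)
    -- On the subalgebra generated in degrees `< k` the map `h` agrees with `f` by the choice of its
    -- values. Since `P` is generated in degrees `< k`, this settles all of `P`.
    have hT : ∀ x ∈ Algebra.adjoin ℚ {x | ∃ j < k, x ∈ V j}, ∃ p, ι p = x ∧ h x = f p := by
      intro x hx
      induction hx using Algebra.adjoin_induction with
      | mem x hx =>
        obtain ⟨j, hj, hx⟩ := hx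
        obtain ⟨y, hy, rfl⟩ := hlow j hj x (hle j hx)
        refine ⟨y, rfl, ?_⟩
        rw [hh j _ hx, if_pos hj]
        change f (r (ι y)) = f y
        rw [hr']
      | algebraMap q => exact ⟨algebraMap ℚ _ q, by simp, by simp⟩
      | add x y _ _ hx hy =>
        obtain ⟨p, rfl, hp⟩ := hx
        obtain ⟨q, rfl, hq⟩ := hy
        exact ⟨p + q, map_add _ _ _, by rw [map_add, map_add, hp, hq]⟩
      | mul x y _ _ hx hy =>
        obtain ⟨p, rfl, hp⟩ := hx
        obtain ⟨q, rfl, hq⟩ := hy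
        exact ⟨p * q, map_mul _ _ _, by rw [map_mul, map_mul, hp, hq]⟩
    have hhι : ∀ x, h (ι x) = f x := by
      intro x
      refine GCAlg.Hom.eqOn_adjoin (h.comp ι.toGAHom) f
        (X := {x | ∃ i ≤ k - 1, x ∈ P.gr i}) ?_ (x := x) (by
          change x ∈ genLE P.gr (k - 1)
          rw [hPk]; exact Algebra.mem_top)
      rintro y ⟨i, hi, hy⟩
      obtain ⟨p, hp, hp'⟩ := hT (ι y)
        (GCAlg.mem_adjoin_of_degree_le hle htop (by omega : i < k) (ι.map_gr _ _ hy))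
      rw [← hι hp]
      rw [← hp] at hp'
      exact hp'
    refine ⟨h, hhι, fun x hx => ?_⟩
    obtain ⟨y, hy, hyR, v, hv, rfl⟩ :=
      GCAlg.mem_sup_of_adjoin hconn hle htop _ (by omega) hVR hx
    obtain ⟨p, hp, rfl⟩ := hrange hy hyR
    rw [map_add, map_add, hhι, hbf p hp, hh k v hv, if_neg (lt_irrefl k)]


/-! ### Extensions of DGAs -/

section

variable {P E N : CDGA.{u}} {k : ℕ}

/-- The decomposable classes of degree `k + 1` come from the base of an extension. -/
theorem KExt.exists_decomposable {ι : CDGA.Hom P N} (h : KExt ι.toGAHom k) (hP : P.IsConn)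
    (hk : 2 ≤ k) {x : N.H} (hx : x ∈ N.Hgr (k + 1)) (hx' : x ∈ genLE N.Hgr k) :
    ∃ y ∈ P.Hgr (k + 1), y ∈ genLE P.Hgr k ∧ ι.mapH y = x := by
  -- `T` consists of the classes coming from `(H(P)(k))`. Degree `k` is left free; by the degree
  -- count its classes do not enter decomposables of degree `k + 1`.
  let T : ℕ → Submodule ℚ N.H := fun i =>
    (P.Hgr i ⊓ Subalgebra.toSubmodule (genLE P.Hgr k)).map ι.mapH.toLinearMap
  have hTN : ∀ i, T i ≤ N.Hgr i := by
    rintro i _ ⟨y, hy, rfl⟩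
    exact CDGA.mapH_mem ι hy.1
  have key := CDGA.Hproj_mem_adjoin (cutFamily k (N.Hgr k) T N.Hgr) (cutFamily_le hTN le_rfl)
    (le_cutFamily hTN (hTN k) 0 ⟨1, ⟨CDGA.Hgr_one_mem, Subalgebra.one_mem _⟩, map_one ι.mapH⟩)
    (cutFamily_mul hk hTN (hTN k) le_rfl ?_ (fun _ _ _ _ => CDGA.Hgr_mul_mem) ?_ ?_) ?_ hx' (k + 1)
  · rw [CDGA.Hproj_same hx, cutFamily_low (by omega) le_rfl] at key
    obtain ⟨y, hy, rfl⟩ := key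
    exact ⟨y, hy.1, hy.2, rfl⟩
  · rintro i j _ _ ⟨x, hx, rfl⟩ ⟨y, hy, rfl⟩
    exact ⟨x * y, ⟨CDGA.Hgr_mul_mem hx.1 hy.1, Subalgebra.mul_mem _ hx.2 hy.2⟩, map_mul ι.mapH _ _⟩
  · rintro _ ⟨y, ⟨hy, -⟩, rfl⟩
    obtain ⟨z, hz, hz0, rfl⟩ := CDGA.mem_Hgr.1 hy
    obtain ⟨q, rfl⟩ := hP.zero z hz0
    refine ⟨q, ?_⟩
    rw [CDGA.cls_algebraMap]
    exact (ι.mapH.commutes q).symm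
  · rintro _ ⟨y, ⟨hy, -⟩, rfl⟩
    obtain ⟨z, hz, hz0, rfl⟩ := CDGA.mem_Hgr.1 hy
    have := hP.one z hz0
    subst this
    rw [CDGA.cls_zero, map_zero]
  · rintro x ⟨i, hi, hx⟩
    refine ⟨i, ?_⟩
    by_cases hik : i = k
    · subst hik
      rwa [cutFamily_self]
    · refine le_cutFamily hTN (hTN k) i ?_
      obtain ⟨z, hz, hzi, rfl⟩ := CDGA.mem_Hgr.1 hx
      obtain ⟨y, hy, rfl⟩ := h.low i (by omega) z hzi
      have hdy : P.d y = 0 := h.inj (by rw [ι.map_d, map_zero]; exact hz)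
      have hc := CDGA.cls_mem hdy hy
      exact ⟨P.cls y hdy, ⟨hc, CDGA.mem_genLE hi hc⟩, rfl⟩

theorem KExt.d_eq_zero {ι : CDGA.Hom P N} (h : KExt ι.toGAHom k) {y : P.carrier}
    (hy : N.d (ι y) = 0) : P.d y = 0 :=
  h.inj (by rw [ι.map_d, hy, map_zero])

/-- A graded algebra map on an extension is a map of DGAs if it commutes with the differentials
on the base and in degree `k`. -/
theorem KExt.map_d {ι : CDGA.Hom P N} (h : KExt ι.toGAHom k) (f : GCAlg.Hom N.toGCAlg E.toGCAlg)
    (h1 : ∀ x, f (N.d (ι x)) = E.d (f (ι x))) (h2 : ∀ x ∈ N.gr k, f (N.d x) = E.d (f x))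
    (a : N.carrier) : f (N.d a) = E.d (f a) := by
  refine CDGA.map_d_of_adjoin f (gens_homogeneous le_rfl) ?_ h.gen a
  rintro _ (⟨i, y, -, rfl⟩ | hx)
  · exact h1 y
  · exact h2 _ hx

end

/-! ### Actions and partial maps -/

section

variable {Γ : Type*} [Group Γ]

/-- The action on a DGA, as a representation. -/
def EqDGA.rep (P : EqDGA.{u} Γ) : Representation ℚ Γ P.carrier where
  toFun g := (P.act g).toLinearMap
  map_one' := by ext x; simp
  map_mul' g h := by ext x; simp

theorem EqDGA.rep_apply (P : EqDGA.{u} Γ) (g : Γ) (x : P.carrier) : P.rep g x = P.act g x := rfl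

/-- The action on a graded algebra, as a representation. -/
def EqGA.rep (A : EqGA.{u} Γ) : Representation ℚ Γ A.carrier where
  toFun g := (A.act g).toLinearMap
  map_one' := by ext x; simp
  map_mul' g h := by ext x; simp

theorem EqDGA.d_act (P : EqDGA.{u} Γ) (g : Γ) {z : P.carrier} (hz : P.d z = 0) :
    P.d (P.act g z) = 0 := by rw [← P.act_d, hz, map_zero]

theorem EqDGA.actHom_mapH_cls (P : EqDGA.{u} Γ) (g : Γ) {z : P.carrier} (hz : P.d z = 0) :
    (P.actHom g).mapH (P.cls z hz) = P.cls (P.act g z) (P.d_act g hz) := rfl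

/-- The action on cohomology, as a representation. -/
def EqDGA.repH (P : EqDGA.{u} Γ) : Representation ℚ Γ P.H where
  toFun g := (P.actHom g).mapH.toLinearMap
  map_one' := by
    refine LinearMap.ext fun x => ?_
    obtain ⟨z, hz, rfl⟩ := CDGA.exists_cls x
    refine (P.actHom_mapH_cls 1 hz).trans (CDGA.cls_congr ?_ _)
    rw [map_one, AlgEquiv.one_apply]
  map_mul' g h := by
    refine LinearMap.ext fun x => ?_
    obtain ⟨z, hz, rfl⟩ := CDGA.exists_cls x
    refine (P.actHom_mapH_cls (g * h) hz).trans ((CDGA.cls_congr ?_ _).trans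
      (P.actHom_mapH_cls g (P.d_act h hz)).symm)
    rw [map_mul, AlgEquiv.mul_apply]

variable {P N X Y : EqDGA.{u} Γ} {A : EqGA.{u} Γ} {m n : ℕ}

/-- `σ` lives on a subalgebra of a quotient of a subalgebra. Composing with the class map and
extending linearly, with arbitrary values off the relevant cocycles, lets later arguments work with
elements of `X` itself. -/
theorem PartialMap.exists_ev (σ : PartialMap X A m) :
    ∃ s : X.carrier →ₗ[ℚ] A.carrier, ∀ z (hz : X.d z = 0) (h : X.cls z hz ∈ genLE X.Hgr m),
      s z = σ ⟨X.cls z hz, h⟩ := by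
  let Z : Submodule ℚ X.cocycles := (Subalgebra.toSubmodule (genLE X.Hgr m)).comap
    (Ideal.Quotient.mkₐ ℚ X.coboundaries).toLinearMap
  let q : Z →ₗ[ℚ] genLE X.Hgr m := LinearMap.codRestrict
    (Subalgebra.toSubmodule (genLE X.Hgr m))
    ((Ideal.Quotient.mkₐ ℚ X.coboundaries).toLinearMap ∘ₗ Z.subtype) fun z => z.2
  obtain ⟨r, hr⟩ := (X.cocycles.val.toLinearMap ∘ₗ Z.subtype).exists_leftInverse_of_injective
    (LinearMap.ker_eq_bot.2 (Subtype.val_injective.comp Subtype.val_injective))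
  refine ⟨σ.toAlgHom.toLinearMap ∘ₗ q ∘ₗ r, fun z hz h => ?_⟩
  have h1 : r z = ⟨⟨z, hz⟩, h⟩ := LinearMap.congr_fun hr (⟨⟨z, hz⟩, h⟩ : Z)
  simp only [LinearMap.comp_apply, h1]
  rfl

/-- A linear map that represents a partial map on cocycles. -/
noncomputable def PartialMap.ev (σ : PartialMap X A m) : X.carrier →ₗ[ℚ] A.carrier :=
  σ.exists_ev.choose

theorem PartialMap.ev_eq (σ : PartialMap X A m) {z : X.carrier} (hz : X.d z = 0)
    (h : X.cls z hz ∈ genLE X.Hgr m) : σ.ev z = σ ⟨X.cls z hz, h⟩ :=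
  σ.exists_ev.choose_spec z hz h

theorem PartialMap.ev_mem (σ : PartialMap X A m) {i : ℕ} (hi : i ≤ m) {z : X.carrier}
    (hzi : z ∈ X.gr i) (hz : X.d z = 0) : σ.ev z ∈ A.gr i := by
  have hc := CDGA.cls_mem hz hzi
  rw [σ.ev_eq hz (CDGA.mem_genLE hi hc)]
  exact σ.map_gr i _ hc

theorem PartialMap.ev_act (σ : PartialMap X A m) {i : ℕ} (hi : i ≤ m) {z : X.carrier}
    (hzi : z ∈ X.gr i) (hz : X.d z = 0) (g : Γ) : σ.ev (X.act g z) = A.act g (σ.ev z) := by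
  rw [σ.ev_eq hz (CDGA.mem_genLE hi (CDGA.cls_mem hz hzi)),
    σ.ev_eq (X.d_act g hz)
      (CDGA.mem_genLE hi (CDGA.cls_mem (X.d_act g hz) (X.act_gr g i z hzi)))]
  exact σ.map_act g _ _ rfl

theorem PartialMap.ev_d (σ : PartialMap X A m) (w : X.carrier) : σ.ev (X.d w) = 0 := by
  have h : X.cls (X.d w) (X.d_d w) = 0 := (CDGA.cls_eq_zero _).2 ⟨w, rfl⟩
  rw [σ.ev_eq (X.d_d w) (h ▸ zero_mem _)]
  have : (⟨X.cls (X.d w) (X.d_d w), h ▸ zero_mem _⟩ : genLE X.Hgr m) = 0 := Subtype.ext h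
  rw [this, map_zero]

theorem PartialMap.IsNIso.surj {σ : PartialMap X A (n + 1)} (h : σ.IsNIso) {i : ℕ} (hi : i ≤ n)
    {a : A.carrier} (ha : a ∈ A.gr i) : ∃ z ∈ X.gr i, X.d z = 0 ∧ σ.ev z = a := by
  obtain ⟨⟨x, hx⟩, ⟨hxi, rfl⟩, -⟩ := h.1 i hi a ha
  obtain ⟨z, hz, hzi, rfl⟩ := CDGA.mem_Hgr.1 hxi
  exact ⟨z, hzi, hz, σ.ev_eq hz hx⟩

theorem PartialMap.IsNIso.inj {σ : PartialMap X A (n + 1)} (h : σ.IsNIso) {i : ℕ} (hi : i ≤ n + 1)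
    {z : X.carrier} (hzi : z ∈ X.gr i) (hz : X.d z = 0) (h0 : σ.ev z = 0) : ∃ w, X.d w = z := by
  have hc := CDGA.cls_mem hz hzi
  have hg := CDGA.mem_genLE hi hc
  rw [σ.ev_eq hz hg] at h0
  rw [← CDGA.cls_eq_zero hz]
  rcases Nat.lt_or_ge n i with hni | hni
  · obtain rfl : i = n + 1 := by omega
    exact congrArg Subtype.val (h.2 _ hc h0)
  · obtain ⟨x, -, hx⟩ := h.1 i hni 0 (zero_mem _)
    have h1 := hx ⟨_, hg⟩ ⟨hc, h0⟩
    have h2 := hx 0 ⟨zero_mem _, map_zero _⟩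
    exact congrArg Subtype.val (h1.trans h2.symm)

theorem PartialMap.isNIso_of_ev {σ : PartialMap X A (n + 1)}
    (h1 : ∀ i ≤ n, ∀ a ∈ A.gr i, ∃ z ∈ X.gr i, X.d z = 0 ∧ σ.ev z = a)
    (h2 : ∀ i ≤ n + 1, ∀ z ∈ X.gr i, X.d z = 0 → σ.ev z = 0 → ∃ w, X.d w = z) : σ.IsNIso := by
  have key : ∀ i ≤ n + 1, ∀ x : genLE X.Hgr (n + 1), (x : X.H) ∈ X.Hgr i → σ x = 0 → x = 0 := by
    rintro i hi ⟨x, hx⟩ hxi h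
    obtain ⟨z, hz, hzi, rfl⟩ := CDGA.mem_Hgr.1 hxi
    exact Subtype.ext ((CDGA.cls_eq_zero hz).2 (h2 i hi z hzi hz ((σ.ev_eq hz hx).trans h)))
  refine ⟨fun i hi a ha => ?_, key (n + 1) le_rfl⟩
  obtain ⟨z, hzi, hz, rfl⟩ := h1 i hi a ha
  have hc := CDGA.cls_mem hz hzi
  have hg := CDGA.mem_genLE (show i ≤ n + 1 by omega) hc
  refine ⟨⟨X.cls z hz, hg⟩, ⟨hc, (σ.ev_eq hz hg).symm⟩, ?_⟩
  rintro y ⟨hy, hy'⟩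
  rw [← sub_eq_zero]
  refine key i (by omega) _ (sub_mem hy hc) ?_
  rw [map_sub, hy', σ.ev_eq hz hg, sub_self]

/-- Restriction of a partial map along a map of DGAs. -/
noncomputable def PartialMap.pull (σ : PartialMap Y A m) (f : EqDGA.Hom X Y) (h : n ≤ m) :
    PartialMap X A n where
  toAlgHom := σ.toAlgHom.comp ((f.toDGAHom.mapH.comp (genLE X.Hgr n).val).codRestrict
    (genLE Y.Hgr m) fun x => CDGA.mapH_genLE _ h x.2)
  map_gr := fun i x hx => σ.map_gr i _ (CDGA.mapH_mem _ hx)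
  map_act := fun g x y hy => by
    refine σ.map_act g _ _ ?_
    change f.toDGAHom.mapH y = (Y.actHom g).mapH (f.toDGAHom.mapH x)
    rw [hy]
    obtain ⟨z, hz, hzx⟩ := CDGA.exists_cls (x : X.H)
    rw [← hzx]
    exact CDGA.cls_congr (f.map_act g z) _

theorem PartialMap.pull_apply (σ : PartialMap Y A m) (f : EqDGA.Hom X Y) (h : n ≤ m)
    (x : genLE X.Hgr n) (y : genLE Y.Hgr m) (hy : (y : Y.H) = f.toDGAHom.mapH x) :
    σ.pull f h x = σ y := congrArg σ.toAlgHom (Subtype.ext hy.symm)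

theorem PartialMap.pull_ev (σ : PartialMap Y A m) (f : EqDGA.Hom X Y) (h : n ≤ m)
    {z : X.carrier} (hz : X.d z = 0) (hg : X.cls z hz ∈ genLE X.Hgr n) :
    (σ.pull f h).ev z = σ.ev (f z) := by
  rw [PartialMap.ev_eq _ hz hg, σ.ev_eq (f.toDGAHom.d_eq_zero hz) (CDGA.mapH_genLE f.toDGAHom h hg)]
  exact σ.pull_apply f h _ _ rfl

theorem PartialMap.mem_imTop {σ : PartialMap X A n} {a : A.gr n} :
    a ∈ σ.imTop ↔ ∃ z ∈ X.gr n, X.d z = 0 ∧ σ.ev z = a := by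
  constructor
  · rintro ⟨⟨x, hx⟩, hxn, hxa⟩
    obtain ⟨z, hz, hzn, rfl⟩ := CDGA.mem_Hgr.1 hxn
    exact ⟨z, hzn, hz, (σ.ev_eq hz hx).trans hxa⟩
  · rintro ⟨z, hzn, hz, hza⟩
    have hc := CDGA.cls_mem hz hzn
    have hg := CDGA.mem_genLE (le_refl n) hc
    exact ⟨⟨X.cls z hz, hg⟩, hc, (σ.ev_eq hz hg).symm.trans hza⟩

end


/-! ### Hirsch extensions -/

section

variable {Γ : Type*} [Group Γ] {P E : EqDGA.{u} Γ} {k : ℕ} {S : Submodule ℚ P.H}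

theorem HirschExt.γ_mem (X : HirschExt P E k S) (s : S) : X.γ s ∈ E.gr k := X.free.1 () s

theorem HirschExt.kExt (X : HirschExt P E k S) (hP : P.IsConn) (hk : 2 ≤ k) :
    KExt X.ι.toGAHom k :=
  (X.free.kExt hP hk () rfl (fun _ hi => absurd rfl hi)).1

theorem HirschExt.exists_eq (X : HirschExt P E k S) (hP : P.IsConn) (hk : 2 ≤ k) {x : E.carrier}
    (hx : x ∈ E.gr k) : ∃ y ∈ P.gr k, ∃ s, x = X.ι y + X.γ s :=
  (X.free.kExt hP hk () rfl (fun _ hi => absurd rfl hi)).2 x hx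

/-- The differential of `γ s` represents `s`, so it can be cancelled by a coboundary from `P` only
if `s = 0`. Hence a Hirsch extension creates no new cocycles in degree `k`. -/
theorem HirschExt.eq_zero_of_d (X : HirschExt P E k S) (hι : KExt X.ι.toGAHom k) {y : P.carrier}
    {s : S} (h : E.d (X.ι y + X.γ s) = 0) : s = 0 := by
  obtain ⟨z, hz, -, hs, hd⟩ := X.d_γ s
  rw [map_add, hd, ← X.ι.map_d, ← map_add] at h
  have h' : P.d y + z = 0 := hι.inj (by rw [h, map_zero])
  refine Subtype.ext ?_
  rw [← hs]
  exact (CDGA.cls_eq_zero hz).2 ⟨-y, by rw [map_neg]; exact neg_eq_of_add_eq_zero_right h'⟩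

theorem HirschExt.exists_cocycle (X : HirschExt P E k S) (hP : P.IsConn) (hk : 2 ≤ k)
    {x : E.carrier} (hx : x ∈ E.gr k) (hd : E.d x = 0) : ∃ y ∈ P.gr k, P.d y = 0 ∧ X.ι y = x := by
  have hι := X.kExt hP hk
  obtain ⟨y, hy, s, rfl⟩ := X.exists_eq hP hk hx
  have hs := X.eq_zero_of_d hι hd
  subst hs
  rw [map_zero, add_zero] at hd ⊢
  exact ⟨y, hy, KExt.d_eq_zero hι hd, rfl⟩

/-- A primitive of degree `k` has the form `ι y + γ s`, and its differential represents `s`. So the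
kernel on `H^{k+1}` is exactly `S`. -/
theorem HirschExt.exact_iff (X : HirschExt P E k S) (hP : P.IsConn) (hk : 2 ≤ k) {z : P.carrier}
    (hzk : z ∈ P.gr (k + 1)) (hz : P.d z = 0) : (∃ v, E.d v = X.ι z) ↔ P.cls z hz ∈ S := by
  have hι := X.kExt hP hk
  constructor
  · rintro ⟨v, hv⟩
    obtain ⟨v, hvk, hv⟩ := CDGA.exists_primitive (X.ι.map_gr _ _ hzk) hv
    obtain ⟨y, -, s, rfl⟩ := X.exists_eq hP hk hvk
    obtain ⟨z', hz', -, hs, hd⟩ := X.d_γ s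
    rw [map_add, hd, ← X.ι.map_d, ← map_add] at hv
    have h' : P.d y + z' = z := hι.inj hv
    have : P.cls z hz = s := by
      rw [← hs, CDGA.cls_eq_iff]
      exact ⟨y, by rw [← h', add_sub_cancel_right]⟩
    rw [this]
    exact s.2
  · intro h
    obtain ⟨z', hz', -, hs, hd⟩ := X.d_γ ⟨_, h⟩
    obtain ⟨e, he⟩ := (CDGA.cls_eq_iff hz' hz).1 hs
    refine ⟨X.γ ⟨_, h⟩ - X.ι e, ?_⟩
    rw [map_sub, hd, ← X.ι.map_d, he, map_sub, sub_sub_cancel]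

theorem KExt.finrank_gr {P N : GCAlg.{u}} {ι : GCAlg.Hom P N} (hN : KExt ι k) {V : Type*}
    [AddCommGroup V] [Module ℚ V] (γ : V →ₗ[ℚ] N.carrier) (hγ : ∀ v, γ v ∈ N.gr k)
    (hspan : ∀ x ∈ N.gr k, ∃ y ∈ P.gr k, ∃ v, x = ι y + γ v)
    (hdisj : ∀ y ∈ P.gr k, ∀ v, ι y + γ v = 0 → v = 0) [Module.Finite ℚ (P.gr k)]
    [Module.Finite ℚ V] :
    Module.Finite ℚ (N.gr k) ∧
      Module.finrank ℚ (N.gr k) = Module.finrank ℚ (P.gr k) + Module.finrank ℚ V := by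
  let q : (P.gr k × V) →ₗ[ℚ] N.gr k := LinearMap.codRestrict (N.gr k)
    ((ι.toAlgHom.toLinearMap ∘ₗ (P.gr k).subtype).coprod γ) fun x => by
      rw [LinearMap.coprod_apply]
      exact add_mem (ι.map_gr _ _ x.1.2) (hγ x.2)
  have hq : ∀ y v, (q (y, v) : N.carrier) = ι y + γ v := fun y v => by simp [q]
  have hb : Function.Bijective q := by
    constructor
    · rw [← LinearMap.ker_eq_bot, LinearMap.ker_eq_bot']
      rintro ⟨y, v⟩ h
      have h : ι y + γ v = 0 := by rw [← hq, h]; rfl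
      have hv := hdisj y y.2 v h
      subst hv
      rw [map_zero, add_zero] at h
      have : y = 0 := Subtype.ext (hN.inj (by rw [h]; simp))
      rw [this]; rfl
    · rintro ⟨x, hx⟩
      obtain ⟨y, hy, v, rfl⟩ := hspan x hx
      exact ⟨(⟨y, hy⟩, v), Subtype.ext (hq _ _)⟩
  let e := LinearEquiv.ofBijective q hb
  exact ⟨Module.Finite.equiv e, by rw [← e.finrank_eq, Module.finrank_prod]⟩

end

/-! ### The base and the stages at one level -/

section

variable {Γ : Type*} [Group Γ] {P : EqDGA.{u} Γ} {A : EqGA.{u} Γ}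

/-- The properties of `P = M_{k-1}(G/H)` and of its map to `A` that are used below. -/
structure Base (ρ : P.Aug A) (k : ℕ) : Prop where
  conn : P.IsConn
  surj : ∀ i < k, ∀ a ∈ A.gr i, ∃ z ∈ P.gr i, P.d z = 0 ∧ ρ.toAlgHom z = a
  inj : ∀ i ≤ k, ∀ z ∈ P.gr i, P.d z = 0 → ρ.toAlgHom z = 0 → ∃ w, P.d w = z
  min : ∃ V, P.MinGen (k - 1) V
  fin : ∀ i, Module.Finite ℚ (P.gr i)

/-- Extensions in degree `k` with a map to `A` as in condition `(2)_k`. -/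
structure IsLevelStage {N : EqDGA.{u} Γ} (ρ : P.Aug A) (k : ℕ) (i : EqDGA.Hom P N)
    (σ : PartialMap N A (k + 1)) : Prop where
  ext : KExt i.toGAHom k
  iso : σ.IsNIso
  compat : ∀ x ∈ genLE P.Hgr k, ∀ y : genLE N.Hgr (k + 1),
    (y : N.H) = i.toDGAHom.mapH x → σ y = ρ.onH x

variable {ρ : P.Aug A} {k : ℕ}

theorem ev_of_compat {N : EqDGA.{u} Γ} {i : EqDGA.Hom P N} {σ : PartialMap N A (k + 1)}
    (h : ∀ x ∈ genLE P.Hgr k, ∀ y : genLE N.Hgr (k + 1),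
      (y : N.H) = i.toDGAHom.mapH x → σ y = ρ.onH x) {p : P.carrier} (hp : P.d p = 0)
    (hg : P.cls p hp ∈ genLE P.Hgr k) : σ.ev (i p) = ρ.toAlgHom p := by
  rw [σ.ev_eq (i.toDGAHom.d_eq_zero hp) (CDGA.mapH_genLE i.toDGAHom (Nat.le_succ k) hg)]
  exact h _ hg _ rfl

theorem IsLevelStage.ev {N : EqDGA.{u} Γ} {i : EqDGA.Hom P N} {σ : PartialMap N A (k + 1)}
    (h : IsLevelStage ρ k i σ) {j : ℕ} (hj : j ≤ k) {p : P.carrier} (hpj : p ∈ P.gr j)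
    (hp : P.d p = 0) : σ.ev (i p) = ρ.toAlgHom p :=
  ev_of_compat h.compat hp (CDGA.mem_genLE hj (CDGA.cls_mem hp hpj))

namespace LevelData

variable {D : DStage ρ k} {W : Submodule ℚ D.pD.H} (L : LevelData D W) (B : Base ρ k) (hk : 2 ≤ k)

include B hk

theorem _root_.EqFormality.DStage.conn (D : DStage ρ k) : D.pD.IsConn :=
  (D.ext.kExt B.conn hk).conn B.conn hk

theorem connW : L.pW.IsConn := (L.extW.kExt (D.conn B hk) hk).conn (D.conn B hk) hk

theorem kExtN : KExt L.ι.toGAHom k :=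
  (L.free.kExt (L.connW B hk) hk () rfl (fun _ hi => absurd rfl hi)).1

theorem exists_eq {x : L.pn.carrier} (hx : x ∈ L.pn.gr k) :
    ∃ y ∈ L.pW.gr k, ∃ c, x = L.ι y + L.γ c :=
  (L.free.kExt (L.connW B hk) hk () rfl (fun _ hi => absurd rfl hi)).2 x hx

theorem kExt : KExt L.inclP.toGAHom k :=
  (L.kExtN B hk).comp ((L.extW.kExt (D.conn B hk) hk).comp (D.ext.kExt B.conn hk))

omit B hk in
theorem compat (x : P.H) (hx : x ∈ genLE P.Hgr k) (y : genLE L.pn.Hgr (k + 1))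
    (hy : (y : L.pn.H) = L.inclP.toDGAHom.mapH x) : L.σ y = ρ.onH x := by
  have h := CDGA.mapH_genLE L.extW.ι.toDGAHom le_rfl (CDGA.mapH_genLE D.ext.ι.toDGAHom le_rfl hx)
  rw [L.σ_ext ⟨_, h⟩ y ?_]
  · exact L.σW_ext x hx _ rfl
  · rw [hy]
    exact (CDGA.mapH_comp _ _ _).trans (congrArg _ (CDGA.mapH_comp _ _ _))

theorem exists_cocycleW {x : L.pW.carrier} (hx : x ∈ L.pW.gr k) (hd : L.pW.d x = 0) :
    ∃ p ∈ P.gr k, P.d p = 0 ∧ L.extW.ι (D.ext.ι p) = x := by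
  obtain ⟨y, hy, hdy, rfl⟩ := L.extW.exists_cocycle (D.conn B hk) hk hx hd
  obtain ⟨p, hp, hdp, rfl⟩ := D.ext.exists_cocycle B.conn hk hy hdy
  exact ⟨p, hp, hdp, rfl⟩

omit B hk in
theorem evW {p : P.carrier} (hpk : p ∈ P.gr k) (hp : P.d p = 0) :
    L.σW.ev (L.extW.ι (D.ext.ι p)) = ρ.toAlgHom p := by
  have hg := CDGA.mem_genLE (le_refl k) (CDGA.cls_mem hp hpk)
  have h := CDGA.mapH_genLE L.extW.ι.toDGAHom le_rfl (CDGA.mapH_genLE D.ext.ι.toDGAHom le_rfl hg)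
  rw [L.σW.ev_eq (L.extW.ι.toDGAHom.d_eq_zero (D.ext.ι.toDGAHom.d_eq_zero hp)) h]
  exact L.σW_ext _ hg _ rfl

omit B hk in
theorem ev_ι {x : L.pW.carrier} (hx : x ∈ L.pW.gr k) (hd : L.pW.d x = 0) :
    L.σ.ev (L.ι x) = L.σW.ev x := by
  have hg := CDGA.mem_genLE (le_refl k) (CDGA.cls_mem hd hx)
  rw [L.σ.ev_eq (L.ι.toDGAHom.d_eq_zero hd) (CDGA.mapH_genLE L.ι.toDGAHom (Nat.le_succ k) hg),
    L.σW.ev_eq hd hg]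
  exact L.σ_ext _ _ rfl

omit B hk in
theorem ev_γ (c : A.gr k ⧸ L.σW.imTop) :
    ∃ a : A.gr k, (a : A.carrier) = L.σ.ev (L.γ c) ∧ Submodule.Quotient.mk a = c := by
  have hg := CDGA.mem_genLE (Nat.le_succ k) (CDGA.cls_mem (L.d_γ c) (L.free.1 () c))
  rw [L.σ.ev_eq (L.d_γ c) hg]
  exact L.σ_coker c ⟨_, hg⟩ rfl

/-- Neither `p_D` nor `p^W` has new cocycles in degree `k`, so the cokernel added at the last step
depends only on `P`, and not on `W`. -/
theorem mem_imTop_iff (a : A.gr k) :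
    a ∈ L.σW.imTop ↔ ∃ p ∈ P.gr k, P.d p = 0 ∧ ρ.toAlgHom p = a := by
  rw [PartialMap.mem_imTop]
  constructor
  · rintro ⟨z, hz, hd, h⟩
    obtain ⟨p, hp, hdp, rfl⟩ := L.exists_cocycleW B hk hz hd
    exact ⟨p, hp, hdp, (L.evW hp hdp).symm.trans h⟩
  · rintro ⟨p, hp, hdp, h⟩
    exact ⟨L.extW.ι (D.ext.ι p), L.extW.ι.map_gr _ _ (D.ext.ι.map_gr _ _ hp),
      L.extW.ι.toDGAHom.d_eq_zero (D.ext.ι.toDGAHom.d_eq_zero hdp), (L.evW hp hdp).trans h⟩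

omit B hk in
theorem d_ι_add (x : L.pW.carrier) (c : A.gr k ⧸ L.σW.imTop) :
    L.pn.d (L.ι x + L.γ c) = L.ι (L.pW.d x) := by
  rw [map_add, L.d_γ, add_zero, L.ι.map_d]

theorem eq_zero_of_ev {x : L.pW.carrier} (hx : x ∈ L.pW.gr k) {c : A.gr k ⧸ L.σW.imTop}
    (hd : L.pn.d (L.ι x + L.γ c) = 0) (h : L.σ.ev (L.ι x + L.γ c) = 0) :
    L.pW.d x = 0 ∧ c = 0 := by
  rw [L.d_ι_add] at hd
  have hdx : L.pW.d x = 0 := (L.kExtN B hk).inj (by rw [hd, map_zero])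
  refine ⟨hdx, ?_⟩
  rw [map_add, L.ev_ι hx hdx] at h
  obtain ⟨a, ha, rfl⟩ := L.ev_γ c
  rw [Submodule.Quotient.mk_eq_zero, PartialMap.mem_imTop]
  refine ⟨-x, neg_mem hx, by rw [map_neg, hdx, neg_zero], ?_⟩
  rw [map_neg, ha]
  exact neg_eq_of_add_eq_zero_right h

/-- Nothing changes below degree `k`. In degree `k` the added cokernel makes `σ` onto, and there are
no other new cocycles. In degree `k + 1` a class killed by `σ` is decomposable by `φ_inj`, hence
comes from `(H(P)(k))`; there it lies in `K`, which was killed in `p_D`. -/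
theorem isNIso : L.σ.IsNIso := by
  have hK := L.kExt B hk
  have hev : ∀ {j : ℕ}, j ≤ k → ∀ {p : P.carrier}, p ∈ P.gr j → P.d p = 0 →
      L.σ.ev (L.inclP p) = ρ.toAlgHom p := fun hj _ hpj hp =>
    ev_of_compat L.compat hp (CDGA.mem_genLE hj (CDGA.cls_mem hp hpj))
  refine PartialMap.isNIso_of_ev (fun i hi a ha => ?_) (fun i hi z hz hd h0 => ?_)
  · rcases Nat.eq_or_lt_of_le hi with rfl | hi
    · obtain ⟨a', ha', hc⟩ := L.ev_γ (Submodule.Quotient.mk ⟨a, ha⟩)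
      rw [eq_comm, Submodule.Quotient.eq, PartialMap.mem_imTop] at hc
      obtain ⟨z, hz, hd, h⟩ := hc
      refine ⟨L.ι z + L.γ (Submodule.Quotient.mk ⟨a, ha⟩),
        add_mem (L.ι.map_gr _ _ hz) (L.free.1 () _), ?_, ?_⟩
      · rw [L.d_ι_add, hd, map_zero]
      · rw [map_add, L.ev_ι hz hd, h, ← ha', Submodule.coe_sub, sub_add_cancel]
    · obtain ⟨p, hp, hdp, rfl⟩ := B.surj i hi a ha
      exact ⟨L.inclP p, L.inclP.map_gr _ _ hp, L.inclP.toDGAHom.d_eq_zero hdp, hev hi.le hp hdp⟩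
  · have fromP : ∀ j ≤ k, ∀ p ∈ P.gr j, P.d p = 0 → L.σ.ev (L.inclP p) = 0 →
        ∃ w, L.pn.d w = L.inclP p := by
      intro j hj p hp hdp h
      rw [hev hj hp hdp] at h
      obtain ⟨q, rfl⟩ := B.inj j hj p hp hdp h
      exact ⟨L.inclP q, (L.inclP.map_d q).symm⟩
    rcases lt_trichotomy i k with hik | rfl | hik
    · obtain ⟨p, hp, rfl⟩ := hK.low i hik z hz
      exact fromP i hik.le p hp (hK.d_eq_zero hd) h0
    · obtain ⟨x, hx, c, rfl⟩ := L.exists_eq B hk hz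
      obtain ⟨hdx, rfl⟩ := L.eq_zero_of_ev B hk hx hd h0
      obtain ⟨p, hp, hdp, rfl⟩ := L.exists_cocycleW B hk hx hdx
      rw [map_zero, add_zero] at h0 ⊢
      exact fromP i le_rfl p hp hdp h0
    · obtain rfl : i = k + 1 := by omega
      have hc := CDGA.cls_mem hd hz
      have hg := CDGA.mem_genLE hi hc
      rw [L.σ.ev_eq hd hg] at h0
      have h1 := L.φ_inj ⟨_, hg⟩ hc (by rw [h0]; exact zero_mem _)
      obtain ⟨y, hy, hyg, hyz⟩ := hK.exists_decomposable (ι := L.inclP.toDGAHom) B.conn hk hc h1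
      have h2 : y ∈ kerK ρ k := ⟨⟨hy, hyg⟩, (L.compat y hyg ⟨_, hg⟩ hyz.symm).symm.trans h0⟩
      obtain ⟨p, hp, hpk, rfl⟩ := CDGA.mem_Hgr.1 hy
      obtain ⟨v, hv⟩ := (D.ext.exact_iff B.conn hk hpk hp).2 h2
      rw [← CDGA.cls_eq_zero hd, ← hyz]
      refine (CDGA.cls_eq_zero (L.inclP.toDGAHom.d_eq_zero hp)).2 ⟨L.ι (L.extW.ι v), ?_⟩
      rw [← L.ι.map_d, ← L.extW.ι.map_d, hv]
      rfl

theorem isLevelStage : IsLevelStage ρ k L.inclP L.σ :=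
  ⟨L.kExt B hk, L.isNIso B hk, L.compat⟩

/-- The generators from the cokernel are cocycles, so they bound nothing. The resulting kernel on
`H^{k+1}(P)` is all that needs to be known of `W` when two constructions are compared. -/
theorem exact_iff {z : P.carrier} (hzk : z ∈ P.gr (k + 1)) (hz : P.d z = 0) :
    (∃ v, L.pn.d v = L.inclP z) ↔ D.pD.cls (D.ext.ι z) (D.ext.ι.toDGAHom.d_eq_zero hz) ∈ W := by
  rw [← L.extW.exact_iff (D.conn B hk) hk (D.ext.ι.map_gr _ _ hzk)]
  constructor
  · rintro ⟨v, hv⟩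
    obtain ⟨v, hvk, hv⟩ := CDGA.exists_primitive (L.inclP.map_gr _ _ hzk) hv
    obtain ⟨x, -, c, rfl⟩ := L.exists_eq B hk hvk
    rw [L.d_ι_add] at hv
    exact ⟨x, (L.kExtN B hk).inj hv⟩
  · rintro ⟨v, hv⟩
    exact ⟨L.ι v, by rw [← L.ι.map_d, hv]; rfl⟩

theorem exists_minGen : ∃ V, L.pn.MinGen k V := by
  obtain ⟨V, hV⟩ := B.min
  obtain ⟨m, rfl⟩ : ∃ m, k = m + 1 := ⟨k - 1, by omega⟩
  exact hV.extend (by omega) L.inclP.toDGAHom (L.kExt B hk)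

theorem finrank_gr [Module.Finite ℚ (A.gr k)] [Module.Finite ℚ (kerK ρ k)] [Module.Finite ℚ W] :
    Module.finrank ℚ (L.pn.gr k) = Module.finrank ℚ (P.gr k) + Module.finrank ℚ (kerK ρ k) +
      Module.finrank ℚ W + Module.finrank ℚ (A.gr k ⧸ L.σW.imTop) := by
  have := B.fin k
  have h1 := D.ext.kExt B.conn hk
  obtain ⟨f1, e1⟩ := h1.finrank_gr D.ext.γ D.ext.γ_mem
    (fun x hx => D.ext.exists_eq B.conn hk hx)
    (fun y _ s h => D.ext.eq_zero_of_d h1 (by rw [h, map_zero]))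
  have h2 := L.extW.kExt (D.conn B hk) hk
  obtain ⟨f2, e2⟩ := h2.finrank_gr L.extW.γ L.extW.γ_mem
    (fun x hx => L.extW.exists_eq (D.conn B hk) hk hx)
    (fun y _ s h => L.extW.eq_zero_of_d h2 (by rw [h, map_zero]))
  obtain ⟨f3, e3⟩ := (L.kExtN B hk).finrank_gr L.γ (L.free.1 ())
    (fun x hx => L.exists_eq B hk hx)
    (fun y hy c h => (L.eq_zero_of_ev B hk hy (by rw [h, map_zero]) (by rw [h, map_zero])).2)
  rw [e3, e2, e1]

/-- In `N^k = P^k ⊕ K ⊕ W ⊕ coker` all summands but `W` are independent of `W`. This is how `(l₁,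
l₂)` is recovered from the isomorphism class. -/
theorem finrank_eq_of_finrank_gr_eq [Module.Finite ℚ (A.gr k)] [Module.Finite ℚ (kerK ρ k)]
    [Module.Finite ℚ W] {W' : Submodule ℚ D.pD.H} [Module.Finite ℚ W'] (L' : LevelData D W')
    (h : Module.finrank ℚ (L.pn.gr k) = Module.finrank ℚ (L'.pn.gr k)) :
    Module.finrank ℚ W = Module.finrank ℚ W' := by
  rw [L.finrank_gr B hk, L'.finrank_gr B hk] at h
  have : L.σW.imTop = L'.σW.imTop := by
    ext a
    rw [L.mem_imTop_iff B hk, L'.mem_imTop_iff B hk]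
  rw [this] at h
  omega

end LevelData

end


/-! ### Uniqueness of the diagrams belonging to a pair -/

section

variable {Γ : Type*} [Group Γ]

/-- An equivariant linear map in degree `k` that is compatible with the differentials extends to
an equivariant map of DGAs on an extension in degree `k`. -/
theorem KExt.exists_eqDGAHom {P N M : EqDGA.{u} Γ} {k : ℕ} {i : EqDGA.Hom P N}
    (h : KExt i.toGAHom k) (i' : EqDGA.Hom P M) (F : N.carrier →ₗ[ℚ] M.carrier)
    (hFact : ∀ g x, F (N.act g x) = M.act g (F x)) (hFP : ∀ p ∈ P.gr k, F (i p) = i' p)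
    (hF : ∀ v ∈ N.gr k, F v ∈ M.gr k ∧ ∃ p ∈ P.gr (k + 1), N.d v = i p ∧ M.d (F v) = i' p) :
    ∃ f : EqDGA.Hom N M, (∀ x, f (i x) = i' x) ∧ ∀ v ∈ N.gr k, f v = F v := by
  obtain ⟨f, h1, h2⟩ := h.lift M.toGCAlg i'.toGAHom F (fun v hv => (hF v hv).1) hFP
  have hd : ∀ a, f (N.d a) = M.d (f a) := by
    refine KExt.map_d (ι := i.toDGAHom) h f (fun x => ?_) (fun v hv => ?_)
    · have e : N.d (i x) = i (P.d x) := (i.map_d x).symm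
      change f (N.d (i x)) = M.d (f (i x))
      rw [e, h1, h1]
      exact i'.map_d x
    · obtain ⟨-, p, hp, h3, h4⟩ := hF v hv
      rw [h3, h1, h2 v hv, h4]
  have hact : ∀ g x, f (N.act g x) = M.act g (f x) := by
    intro g x
    refine h.hom_ext (f := f.comp (N.actHom g).toGAHom) (g := (M.actHom g).toGAHom.comp f)
      (fun x => ?_) (fun v hv => ?_) x
    · change f (N.act g (i x)) = M.act g (f (i x))
      rw [h1, ← i.map_act, h1]
      exact i'.map_act g x
    · change f (N.act g v) = M.act g (f v)
      rw [h2 _ (N.act_gr g _ _ hv), h2 v hv, hFact]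
  exact ⟨⟨⟨f, hd⟩, hact⟩, h1, h2⟩

/-- A linear map over `P` that is equivariant. -/
theorem exists_equivariant_over [Finite Γ] {P N M : EqDGA.{u} Γ} (k : ℕ) (i : EqDGA.Hom P N)
    (hi : Function.Injective i) (i' : EqDGA.Hom P M) :
    ∃ F : N.carrier →ₗ[ℚ] M.carrier, (∀ g x, F (N.act g x) = M.act g (F x)) ∧
      ∀ p ∈ P.gr k, F (i p) = i' p := by
  obtain ⟨F, hF, -, hF'⟩ := exists_equivariant_section N.rep M.rep ⊥
    ((P.gr k).map i.toAlgHom.toLinearMap) bot_le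
    (by rintro g x hx; rw [(Submodule.mem_bot ℚ).1 hx, map_zero]; exact zero_mem _)
    (by rintro g _ ⟨p, hp, rfl⟩; exact ⟨P.act g p, P.act_gr g _ _ hp, i.map_act g p⟩)
    ((P.gr k).map (i.toAlgHom.toLinearMap.prod i'.toAlgHom.toLinearMap)) (by
      rintro g x y ⟨p, hp, h⟩
      refine ⟨P.act g p, P.act_gr g _ _ hp, ?_⟩
      obtain ⟨rfl, rfl⟩ := Prod.ext_iff.1 h
      exact Prod.ext (i.map_act g p) (i'.map_act g p))
    (by rintro _ ⟨p, hp, rfl⟩; exact ⟨i' p, p, hp, rfl⟩) 0 (by simp)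
    (by rintro x hx; rw [(Submodule.mem_bot ℚ).1 hx, map_zero]; exact zero_mem _)
  refine ⟨F, hF, fun p hp => ?_⟩
  obtain ⟨q, -, hq⟩ := hF' _ ⟨p, hp, rfl⟩
  obtain ⟨h1, h2⟩ := Prod.ext_iff.1 hq
  have : q = p := hi h1
  rw [← this] at h2 ⊢
  exact h2.symm

end

section

variable {Γ : Type*} [Group Γ] [Finite Γ] {P N N' : EqDGA.{u} Γ} {A : EqGA.{u} Γ} {ρ : P.Aug A}
  {k : ℕ} {i : EqDGA.Hom P N} {i' : EqDGA.Hom P N'} {σ : PartialMap N A (k + 1)}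
  {σ' : PartialMap N' A (k + 1)}

/-- The cocycles of degree `k`. -/
def CDGA.Zgr (A : CDGA.{u}) (k : ℕ) : Submodule ℚ A.carrier := A.gr k ⊓ LinearMap.ker A.d

/-- The degree `k` part of a comparison map, found in three equivariant choices, each extending the
one before: forced on `P^k`, preserving `σ` on cocycles, and preserving the differential on all of
`N^k`. The maps `c`, `c'` carry one more linear constraint; at `G/e` it makes the square with `θ`
commute. -/
theorem IsLevelStage.exists_linearMap (S : IsLevelStage ρ k i σ) (S' : IsLevelStage ρ k i' σ')
    {C : Type*} [AddCommGroup C] [Module ℚ C] (c : N.carrier →ₗ[ℚ] C) (c' : N'.carrier →ₗ[ℚ] C)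
    (hc : ∀ g x, c (N.act g x) = c x) (hc' : ∀ g x, c' (N'.act g x) = c' x)
    (hcP : ∀ x, c (i x) = c' (i' x))
    (hZ : ∀ z ∈ N.Zgr k, ∃ z' ∈ N'.Zgr k, σ'.ev z' = σ.ev z ∧ c' z' = c z)
    (hN : ∀ v ∈ N.gr k, ∀ p ∈ P.gr (k + 1), N.d v = i p →
      ∃ y ∈ N'.gr k, N'.d y = i' p ∧ c' y = c v) :
    ∃ F : N.carrier →ₗ[ℚ] N'.carrier, (∀ g x, F (N.act g x) = N'.act g (F x)) ∧
      (∀ p ∈ P.gr k, F (i p) = i' p) ∧ (∀ z ∈ N.Zgr k, σ'.ev (F z) = σ.ev z) ∧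
      ∀ v ∈ N.gr k, F v ∈ N'.gr k ∧ c' (F v) = c v ∧
        ∃ p ∈ P.gr (k + 1), N.d v = i p ∧ N'.d (F v) = i' p := by
  let X₀ : Submodule ℚ N.carrier := (P.gr k).map i.toAlgHom.toLinearMap
  -- `RG` is the prescription on `P^k`, `RZ` pairs cocycles with equal values under `σ` and under
  -- `c`, and `RB` pairs elements whose differentials come from the same element of `P`, again with
  -- equal values under `c`.
  let RG : Submodule ℚ (N.carrier × N'.carrier) :=
    (P.gr k).map (i.toAlgHom.toLinearMap.prod i'.toAlgHom.toLinearMap)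
  let RZ : Submodule ℚ (N.carrier × N'.carrier) :=
    { carrier := {x | x.1 ∈ N.Zgr k ∧ x.2 ∈ N'.Zgr k ∧ σ'.ev x.2 = σ.ev x.1 ∧ c' x.2 = c x.1}
      zero_mem' := ⟨zero_mem _, zero_mem _, by simp, by simp⟩
      add_mem' := fun {x y} hx hy => ⟨add_mem hx.1 hy.1, add_mem hx.2.1 hy.2.1,
        by rw [Prod.snd_add, Prod.fst_add, map_add, map_add, hx.2.2.1, hy.2.2.1],
        by rw [Prod.snd_add, Prod.fst_add, map_add, map_add, hx.2.2.2, hy.2.2.2]⟩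
      smul_mem' := fun q x hx => ⟨Submodule.smul_mem _ _ hx.1, Submodule.smul_mem _ _ hx.2.1,
        by rw [Prod.smul_snd, Prod.smul_fst, map_smul, map_smul, hx.2.2.1],
        by rw [Prod.smul_snd, Prod.smul_fst, map_smul, map_smul, hx.2.2.2]⟩ }
  let RB : Submodule ℚ (N.carrier × N'.carrier) :=
    { carrier := {x | x.2 ∈ N'.gr k ∧ c' x.2 = c x.1 ∧
        ∃ p ∈ P.gr (k + 1), N.d x.1 = i p ∧ N'.d x.2 = i' p}
      zero_mem' := ⟨zero_mem _, by simp, 0, zero_mem _, by simp, by simp⟩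
      add_mem' := by
        rintro x y ⟨hx, hx', p, hp, hp1, hp2⟩ ⟨hy, hy', q, hq, hq1, hq2⟩
        refine ⟨add_mem hx hy, ?_, p + q, add_mem hp hq, ?_, ?_⟩
        · rw [Prod.snd_add, Prod.fst_add, map_add, map_add, hx', hy']
        · rw [Prod.fst_add, map_add, map_add, hp1, hq1]
        · rw [Prod.snd_add, map_add, map_add, hp2, hq2]
      smul_mem' := by
        rintro q x ⟨hx, hx', p, hp, hp1, hp2⟩
        refine ⟨Submodule.smul_mem _ _ hx, ?_, q • p, Submodule.smul_mem _ _ hp, ?_, ?_⟩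
        · rw [Prod.smul_snd, Prod.smul_fst, map_smul, map_smul, hx']
        · rw [Prod.smul_fst, map_smul, map_smul, hp1]
        · rw [Prod.smul_snd, map_smul, map_smul, hp2] }
  have hX₀ : ∀ g, ∀ x ∈ X₀, N.rep g x ∈ X₀ := by
    rintro g _ ⟨p, hp, rfl⟩
    exact ⟨P.act g p, P.act_gr g _ _ hp, i.map_act g p⟩
  have hZact : ∀ {M : EqDGA.{u} Γ} g, ∀ x ∈ M.Zgr k, M.act g x ∈ M.Zgr k :=
    fun {M} g x hx => ⟨M.act_gr g _ _ hx.1, M.d_act g hx.2⟩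
  have hRG : ∀ g x y, (x, y) ∈ RG → (N.rep g x, N'.rep g y) ∈ RG := by
    rintro g x y ⟨p, hp, h⟩
    refine ⟨P.act g p, P.act_gr g _ _ hp, ?_⟩
    obtain ⟨rfl, rfl⟩ := Prod.ext_iff.1 h
    exact Prod.ext (i.map_act g p) (i'.map_act g p)
  have hRZ : ∀ g x y, (x, y) ∈ RZ → (N.rep g x, N'.rep g y) ∈ RZ := by
    rintro g x y ⟨hx, hy, h1, h2⟩
    refine ⟨hZact g x hx, hZact g y hy, ?_, ?_⟩
    · change σ'.ev (N'.act g y) = σ.ev (N.act g x)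
      rw [σ'.ev_act (Nat.le_succ k) hy.1 hy.2, σ.ev_act (Nat.le_succ k) hx.1 hx.2]
      exact congrArg _ h1
    · change c' (N'.act g y) = c (N.act g x)
      rw [hc, hc']
      exact h2
  have hRB : ∀ g x y, (x, y) ∈ RB → (N.rep g x, N'.rep g y) ∈ RB := by
    rintro g x y ⟨hy, h1, p, hp, h2, h3⟩
    refine ⟨N'.act_gr g _ _ hy, ?_, P.act g p, P.act_gr g _ _ hp, ?_, ?_⟩
    · change c' (N'.act g y) = c (N.act g x)
      rw [hc, hc']
      exact h1
    · exact (N.act_d g x).symm.trans ((congrArg _ h2).trans (i.map_act g p).symm)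
    · exact (N'.act_d g y).symm.trans ((congrArg _ h3).trans (i'.map_act g p).symm)
  have hRA : ∀ g x y, (x, y) ∈ RG ⊔ RZ → (N.rep g x, N'.rep g y) ∈ RG ⊔ RZ := by
    intro g x y h
    obtain ⟨⟨a, a'⟩, ha, ⟨b, b'⟩, hb, hab⟩ := Submodule.mem_sup.1 h
    obtain ⟨rfl, rfl⟩ := Prod.ext_iff.1 hab
    refine Submodule.mem_sup.2 ⟨_, hRG g a a' ha, _, hRZ g b b' hb, ?_⟩
    exact Prod.ext (map_add _ _ _).symm (map_add _ _ _).symm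
  obtain ⟨F₁, hF₁act, hF₁P⟩ := exists_equivariant_over k i S.ext.inj i'
  obtain ⟨F₂, hF₂act, hF₂₁, hF₂⟩ := exists_equivariant_section N.rep N'.rep X₀ (X₀ ⊔ N.Zgr k)
    le_sup_left hX₀ (by
      intro g x hx
      obtain ⟨a, ha, b, hb, rfl⟩ := Submodule.mem_sup.1 hx
      rw [map_add]
      exact Submodule.add_mem_sup (hX₀ g a ha) (hZact g b hb)) (RG ⊔ RZ) hRA (by
      intro x hx
      obtain ⟨_, ⟨p, hp, rfl⟩, b, hb, rfl⟩ := Submodule.mem_sup.1 hx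
      obtain ⟨b', hb', h1, h2⟩ := hZ b hb
      exact ⟨i' p + b', Submodule.mem_sup.2
        ⟨(i p, i' p), ⟨p, hp, rfl⟩, (b, b'), ⟨hb, hb', h1, h2⟩, rfl⟩⟩) F₁
    (fun g x _ => hF₁act g x) (by
      rintro _ ⟨p, hp, rfl⟩
      exact Submodule.mem_sup_left ⟨p, hp, Prod.ext rfl (hF₁P p hp).symm⟩)
  have hle : RG ⊔ RZ ≤ RB := by
    refine sup_le ?_ ?_
    · rintro _ ⟨p, hp, rfl⟩
      exact ⟨i'.map_gr _ _ hp, (hcP p).symm, P.d p, P.d_gr _ _ hp, (i.map_d p).symm,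
        (i'.map_d p).symm⟩
    · rintro ⟨x, y⟩ ⟨hx, hy, -, h⟩
      exact ⟨hy.1, h, 0, zero_mem _, by rw [map_zero]; exact hx.2, by rw [map_zero]; exact hy.2⟩
  obtain ⟨F, hFact, hF₂', hF⟩ := exists_equivariant_section N.rep N'.rep (X₀ ⊔ N.Zgr k) (N.gr k)
    (sup_le (by rintro _ ⟨p, hp, rfl⟩; exact i.map_gr _ _ hp) inf_le_left) (by
      intro g x hx
      obtain ⟨a, ha, b, hb, rfl⟩ := Submodule.mem_sup.1 hx
      rw [map_add]
      exact Submodule.add_mem_sup (hX₀ g a ha) (hZact g b hb)) (fun g x => N.act_gr g _ _) RB hRB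
    (by
      intro x hx
      obtain ⟨p, hp, h⟩ := S.ext.top _ (N.d_gr _ _ hx)
      obtain ⟨y, hy, h1, h2⟩ := hN x hx p hp h.symm
      exact ⟨y, hy, h2, p, hp, h.symm, h1⟩) F₂ (fun g x _ => hF₂act g x)
    (fun x hx => hle (hF₂ x hx))
  refine ⟨F, hFact, fun p hp => ?_, fun z hz => ?_, fun v hv => hF v hv⟩
  · have h0 : i p ∈ X₀ := ⟨p, hp, rfl⟩
    rw [hF₂' _ (Submodule.mem_sup_left h0), hF₂₁ _ h0, hF₁P p hp]
  · have hz' : z ∈ X₀ ⊔ N.Zgr k := Submodule.mem_sup_right hz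
    rw [hF₂' _ hz']
    obtain ⟨_, ⟨p, hp, rfl⟩, ⟨b, b'⟩, ⟨hb, hb', h1, -⟩, hab⟩ := Submodule.mem_sup.1 (hF₂ z hz')
    obtain ⟨h2, h3⟩ := Prod.ext_iff.1 hab
    have h2 : i p + b = z := h2
    have h3 : i' p + b' = F₂ z := h3
    -- As `z` and `b` are cocycles, so is `p`; on `i p` and `i' p` both partial maps are given by
    -- `ρ`.
    have hdp : P.d p = 0 := S.ext.d_eq_zero (ι := i.toDGAHom) (by
      have e1 : N.d z = 0 := hz.2
      have e2 : N.d b = 0 := hb.2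
      rw [← h2, map_add, e2, add_zero] at e1
      exact e1)
    have h1 : σ'.ev b' = σ.ev b := h1
    rw [← h3, ← h2, map_add, map_add, S.ev le_rfl hp hdp, S'.ev le_rfl hp hdp, h1]

/-- Two extensions of `P` with the same kernel on `H^{k+1}(P)` are isomorphic over `P`,
compatibly with the maps to `A` and with linear maps to `C`. -/
theorem IsLevelStage.exists_iso (hk : 2 ≤ k) (S : IsLevelStage ρ k i σ)
    (S' : IsLevelStage ρ k i' σ')
    (hS : ∀ z ∈ P.gr (k + 1), P.d z = 0 → (∃ v, N'.d v = i' z) → ∃ v, N.d v = i z)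
    {C : Type*} [AddCommGroup C] [Module ℚ C] (c : N.carrier →ₗ[ℚ] C) (c' : N'.carrier →ₗ[ℚ] C)
    (hc : ∀ g x, c (N.act g x) = c x) (hc' : ∀ g x, c' (N'.act g x) = c' x)
    (hcP : ∀ x, c (i x) = c' (i' x))
    (hZ : ∀ z ∈ N.Zgr k, ∃ z' ∈ N'.Zgr k, σ'.ev z' = σ.ev z ∧ c' z' = c z)
    (hN : ∀ v ∈ N.gr k, ∀ p ∈ P.gr (k + 1), N.d v = i p →
      ∃ y ∈ N'.gr k, N'.d y = i' p ∧ c' y = c v) :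
    ∃ (f : EqDGA.Hom N N') (g : EqDGA.Hom N' N), (∀ x, g (f x) = x) ∧ (∀ x, f (g x) = x) ∧
      (∀ x, f (i x) = i' x) ∧ (∀ v ∈ N.gr k, c' (f v) = c v) ∧
      ∀ z ∈ N.Zgr k, σ'.ev (f z) = σ.ev z := by
  obtain ⟨F, hFact, hFP, hFσ, hF⟩ := S.exists_linearMap S' c c' hc hc' hcP hZ hN
  -- If `F v = 0`, then `v` is a cocycle with `σ`-value zero, so it bounds. The primitive has degree
  -- `k - 1`, hence lies in `P`, where `F` is the injective map `i'`.
  have hinj : ∀ v ∈ N.gr k, F v = 0 → v = 0 := by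
    intro v hv h0
    obtain ⟨-, -, p, hp, h1, h2⟩ := hF v hv
    rw [h0, map_zero] at h2
    have hp0 : p = 0 := S'.ext.inj (by rw [map_zero]; exact h2.symm)
    rw [hp0, map_zero] at h1
    have h3 := hFσ v ⟨hv, h1⟩
    rw [h0, map_zero] at h3
    obtain ⟨w, hw⟩ := S.iso.inj (Nat.le_succ k) hv h1 h3.symm
    obtain ⟨w, hwk, rfl⟩ := CDGA.exists_primitive hv hw
    obtain ⟨u, hu, rfl⟩ := S.ext.low _ (by omega) w hwk
    have hdu : P.d u ∈ P.gr k := by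
      have := P.d_gr _ _ hu
      rwa [Nat.sub_add_cancel (by omega)] at this
    have e : N.d (i u) = i (P.d u) := (i.map_d u).symm
    have h0' : F (N.d (i u)) = 0 := h0
    change N.d (i u) = 0
    rw [e, hFP _ hdu] at h0'
    have h4 : P.d u = 0 := S'.ext.inj (by rw [map_zero]; exact h0')
    rw [e, h4, map_zero]
  -- By `hS` some `v` has the same differential as `y`. The difference `y - F v` is a cocycle,
  -- matched through `σ` by some `z`; what remains is a coboundary from `P^{k-1}`.
  have hsurj : ∀ y ∈ N'.gr k, ∃ v ∈ N.gr k, F v = y := by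
    intro y hy
    obtain ⟨p, hp, hpy⟩ := S'.ext.top _ (N'.d_gr _ _ hy)
    have hdp : P.d p = 0 := S'.ext.d_eq_zero (ι := i'.toDGAHom) (by rw [hpy, N'.d_d])
    obtain ⟨v, hv⟩ := hS p hp hdp ⟨y, hpy.symm⟩
    obtain ⟨v, hvk, hv⟩ := CDGA.exists_primitive (i.map_gr _ _ hp) hv
    rw [Nat.add_sub_cancel] at hvk
    obtain ⟨hFv, -, q, hq, h1, h2⟩ := hF v hvk
    have hqp : q = p := S.ext.inj (h1.symm.trans hv)
    subst hqp
    have hd : N'.d (y - F v) = 0 := by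
      rw [map_sub, h2, sub_eq_zero]
      exact hpy.symm
    obtain ⟨z, hz, hdz, hzy⟩ := S.iso.surj le_rfl (σ'.ev_mem (Nat.le_succ k) (sub_mem hy hFv) hd)
    obtain ⟨hFz, -, q', hq', h1', h2'⟩ := hF z hz
    rw [hdz] at h1'
    have hq0 : q' = 0 := S.ext.inj (by rw [map_zero]; exact h1'.symm)
    rw [hq0, map_zero] at h2'
    have hyz : y - F v - F z ∈ N'.gr k := sub_mem (sub_mem hy hFv) hFz
    obtain ⟨w, hw⟩ := S'.iso.inj (Nat.le_succ k) hyz (by rw [map_sub, hd, h2', sub_zero])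
      (by rw [map_sub, hFσ z ⟨hz, hdz⟩, hzy, sub_self])
    obtain ⟨w, hwk, hw⟩ := CDGA.exists_primitive hyz hw
    obtain ⟨u, hu, rfl⟩ := S'.ext.low _ (by omega) w hwk
    have hdu : P.d u ∈ P.gr k := by
      have := P.d_gr _ _ hu
      rwa [Nat.sub_add_cancel (by omega)] at this
    refine ⟨v + z + i (P.d u), add_mem (add_mem hvk hz) (i.map_gr _ _ hdu), ?_⟩
    have e : i' (P.d u) = y - F v - F z := (i'.map_d u).trans hw
    rw [map_add, map_add, hFP _ hdu, e]
    abel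
  obtain ⟨h, h1, h2⟩ := KExt.exists_eqDGAHom S.ext i' F hFact hFP
    (fun v hv => ⟨(hF v hv).1, (hF v hv).2.2⟩)
  let e : N.gr k ≃ₗ[ℚ] N'.gr k := LinearEquiv.ofBijective
    (F.restrict fun v hv => (hF v hv).1) ⟨by
      rw [← LinearMap.ker_eq_bot, LinearMap.ker_eq_bot']
      exact fun v hv => Subtype.ext (hinj v v.2 (congrArg Subtype.val hv)), by
      rintro ⟨y, hy⟩
      obtain ⟨v, hv, rfl⟩ := hsurj y hy
      exact ⟨⟨v, hv⟩, rfl⟩⟩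
  obtain ⟨G, hG⟩ := ((N.gr k).subtype ∘ₗ e.symm.toLinearMap).exists_extend
  have hG' : ∀ y (hy : y ∈ N'.gr k), G y = e.symm ⟨y, hy⟩ := fun y hy =>
    LinearMap.congr_fun hG ⟨y, hy⟩
  have hGF : ∀ v ∈ N.gr k, G (F v) = v := by
    intro v hv
    rw [hG' _ (hF v hv).1]
    exact congrArg Subtype.val (e.symm_apply_apply ⟨v, hv⟩)
  have hFG : ∀ y ∈ N'.gr k, F (G y) = y := by
    intro y hy
    rw [hG' _ hy]
    exact congrArg Subtype.val (e.apply_symm_apply ⟨y, hy⟩)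
  have hGm : ∀ y ∈ N'.gr k, G y ∈ N.gr k := fun y hy => by
    rw [hG' y hy]
    exact Subtype.property _
  obtain ⟨g, g1, g2⟩ := S'.ext.lift N.toGCAlg i.toGAHom G hGm (fun p hp => by
    have := hGF _ (i.map_gr _ _ hp)
    rw [hFP p hp] at this
    exact this)
  have hgh : ∀ x, g (h x) = x := by
    refine S.ext.hom_ext (f := g.comp h.toGAHom) (g := GCAlg.Hom.id _) (fun x => ?_)
      (fun v hv => ?_)
    · exact (congrArg g (h1 x)).trans (g1 x)
    · change g (h v) = v
      rw [h2 v hv, g2 _ (hF v hv).1, hGF v hv]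
  have hhg : ∀ x, h (g x) = x := by
    refine S'.ext.hom_ext (f := h.toGAHom.comp g) (g := GCAlg.Hom.id _) (fun x => ?_)
      (fun v hv => ?_)
    · exact (congrArg h (g1 x)).trans (h1 x)
    · change h (g v) = v
      rw [g2 v hv, h2 _ (hGm v hv), hFG v hv]
  refine ⟨h, ⟨⟨g, fun a => ?_⟩, fun γ a => ?_⟩, hgh, hhg, h1, ?_, ?_⟩
  · rw [← hhg a, ← h.map_d, hgh, hhg]
  · change g (N'.act γ a) = N.act γ (g a)
    conv_lhs => rw [← hhg a, ← h.map_act, hgh]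
  · intro v hv
    rw [h2 v hv]
    exact (hF v hv).2.1
  · intro z hz
    rw [h2 z hz.1, hFσ z hz]

end

section

variable {G : Type} [Group G] [Finite G] {P : DGADiagram.{u} G} {A : GADiagram.{u} G}
  {ρ : P.Aug A} {k : ℕ} {D₁ : DStage ρ.e k} {D₂ : DStage ρ.t k} {W₁ : Submodule ℚ D₁.pD.H}
  {W₂ : Submodule ℚ D₂.pD.H}

omit [Finite G] in
theorem PairData.ev_θ (X : PairData D₁ D₂ W₁ W₂) {z : X.L₁.pn.carrier} (hz : z ∈ X.L₁.pn.Zgr k) :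
    X.L₂.σ.ev (X.θ z) = A.r (X.L₁.σ.ev z) := by
  have hg := CDGA.mem_genLE (Nat.le_succ k) (CDGA.cls_mem hz.2 hz.1)
  rw [X.L₁.σ.ev_eq hz.2 hg, X.L₂.σ.ev_eq (X.θ.d_eq_zero hz.2)
    (CDGA.mapH_genLE X.θ le_rfl hg)]
  exact X.square _ _ rfl

/-- The diagrams belonging to a pair are isomorphic. -/
theorem PairData.iso (B₁ : Base ρ.e k) (B₂ : Base ρ.t k) (hk : 2 ≤ k)
    (hA : ∀ a ∈ A.t.gr k, ∃ b ∈ A.e.gr k, A.r b = a)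
    (hP : ∀ a ∈ P.t.gr (k - 1), ∃ b ∈ P.e.gr (k - 1), P.r b = a)
    (X X' : PairData D₁ D₂ W₁ W₂) : X.diagram.Iso X'.diagram := by
  have S₁ := X.L₁.isLevelStage B₁ hk
  have S₂ := X.L₂.isLevelStage B₂ hk
  have S₁' := X'.L₁.isLevelStage B₁ hk
  have S₂' := X'.L₂.isLevelStage B₂ hk
  have hW₁ : ∀ z ∈ P.e.gr (k + 1), P.e.d z = 0 →
      ((∃ v, X'.L₁.pn.d v = X'.L₁.inclP z) ↔ ∃ v, X.L₁.pn.d v = X.L₁.inclP z) :=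
    fun z hz hd => (X'.L₁.exact_iff B₁ hk hz hd).trans (X.L₁.exact_iff B₁ hk hz hd).symm
  have hW₂ : ∀ z ∈ P.t.gr (k + 1), P.t.d z = 0 →
      ((∃ v, X'.L₂.pn.d v = X'.L₂.inclP z) ↔ ∃ v, X.L₂.pn.d v = X.L₂.inclP z) :=
    fun z hz hd => (X'.L₂.exact_iff B₂ hk hz hd).trans (X.L₂.exact_iff B₂ hk hz hd).symm
  -- At `G/G` there is no square to respect yet, so the constraint takes values in the zero space.
  obtain ⟨ft, gt, gft, fgt, fti, -, ftσ⟩ := S₂.exists_iso hk S₂'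
    (fun z hz hd => (hW₂ z hz hd).1) (C := PUnit.{1}) 0 0 (fun _ _ => rfl) (fun _ _ => rfl)
    (fun _ => rfl) (by
      intro z hz
      obtain ⟨z', hz', hd, h⟩ := S₂'.iso.surj le_rfl (X.L₂.σ.ev_mem (Nat.le_succ k) hz.1 hz.2)
      exact ⟨z', ⟨hz', hd⟩, h, rfl⟩) (by
      intro v hv p hp hvp
      have hdp : P.t.d p = 0 := S₂.ext.d_eq_zero (ι := X.L₂.inclP.toDGAHom)
        (by rw [← hvp, CDGA.d_d])
      obtain ⟨y, hy⟩ := (hW₂ p hp hdp).2 ⟨v, hvp⟩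
      obtain ⟨y, hyk, hy⟩ := CDGA.exists_primitive (X'.L₂.inclP.map_gr _ _ hp) hy
      exact ⟨y, hyk, hy, rfl⟩)
  -- A cocycle at `G/G` with `σ`-value zero bounds an element of `P^{k-1}(G/G)`. That element lifts
  -- to `G/e` by `hP`, and so does the coboundary.
  have hB : ∀ δ ∈ X'.L₂.pn.Zgr k, X'.L₂.σ.ev δ = 0 →
      ∃ y ∈ X'.L₁.pn.gr k, (∃ w, X'.L₁.pn.d w = y) ∧ X'.θ y = δ := by
    rintro δ ⟨hδ, hdδ⟩ h0
    obtain ⟨w, hw⟩ := S₂'.iso.inj (Nat.le_succ k) hδ hdδ h0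
    obtain ⟨w, hwk, rfl⟩ := CDGA.exists_primitive hδ hw
    obtain ⟨u, hu, rfl⟩ := S₂'.ext.low _ (by omega) w hwk
    obtain ⟨u', hu', rfl⟩ := hP u hu
    refine ⟨X'.L₁.pn.d (X'.L₁.inclP u'), ?_, ⟨_, rfl⟩, ?_⟩
    · have := X'.L₁.pn.d_gr _ _ (X'.L₁.inclP.map_gr _ _ hu')
      rwa [Nat.sub_add_cancel (by omega)] at this
    · rw [X'.θ.map_d, X'.θ_ext]
  -- `θ` is onto on cocycles of degree `k`: lift the value in `A^k` by `hA`, then correct by `hB`.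
  have hZs : ∀ δ ∈ X'.L₂.pn.Zgr k, ∃ y ∈ X'.L₁.pn.Zgr k, X'.θ y = δ := by
    intro δ hδ
    obtain ⟨b, hb, hbδ⟩ := hA _ (X'.L₂.σ.ev_mem (Nat.le_succ k) hδ.1 hδ.2)
    obtain ⟨y, hy, hdy, rfl⟩ := S₁'.iso.surj le_rfl hb
    have hθy : X'.θ y ∈ X'.L₂.pn.Zgr k := ⟨X'.θ.map_gr _ _ hy, X'.θ.d_eq_zero hdy⟩
    obtain ⟨y', hy', ⟨w, rfl⟩, hθ⟩ := hB (δ - X'.θ y) (sub_mem hδ hθy)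
      (by rw [map_sub, X'.ev_θ ⟨hy, hdy⟩, hbδ, sub_self])
    refine ⟨y + X'.L₁.pn.d w, ⟨add_mem hy hy', ?_⟩, ?_⟩
    · rw [SetLike.mem_coe, LinearMap.mem_ker, map_add, hdy, CDGA.d_d, add_zero]
    · rw [map_add, hθ, add_sub_cancel]
  -- With `ft` fixed, the constraint is that `X'.θ` after the new map equals `ft` after `X.θ` in
  -- degree `k`.
  obtain ⟨fe, ge, gfe, fge, fei, fec, -⟩ := S₁.exists_iso hk S₁'
    (fun z hz hd => (hW₁ z hz hd).1)
    (ft.toAlgHom.toLinearMap ∘ₗ X.θ.toAlgHom.toLinearMap) X'.θ.toAlgHom.toLinearMap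
    (fun g x => congrArg ft (X.θ_act g x)) (fun g x => X'.θ_act g x)
    (fun x => (congrArg ft (X.θ_ext x)).trans ((fti _).trans (X'.θ_ext x).symm)) (by
      intro z hz
      obtain ⟨z₀, hz₀, hd₀, h₀⟩ :=
        S₁'.iso.surj le_rfl (X.L₁.σ.ev_mem (Nat.le_succ k) hz.1 hz.2)
      have hθz : X.θ z ∈ X.L₂.pn.Zgr k := ⟨X.θ.map_gr _ _ hz.1, X.θ.d_eq_zero hz.2⟩
      have hfz : ft (X.θ z) ∈ X'.L₂.pn.Zgr k :=
        ⟨ft.map_gr _ _ hθz.1, ft.toDGAHom.d_eq_zero hθz.2⟩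
      have hθz₀ : X'.θ z₀ ∈ X'.L₂.pn.Zgr k := ⟨X'.θ.map_gr _ _ hz₀, X'.θ.d_eq_zero hd₀⟩
      obtain ⟨y', hy', ⟨w, rfl⟩, hθ⟩ := hB (X'.θ z₀ - ft (X.θ z)) (sub_mem hθz₀ hfz)
        (by rw [map_sub, X'.ev_θ ⟨hz₀, hd₀⟩, ftσ _ hθz, X.ev_θ hz, h₀, sub_self])
      refine ⟨z₀ - X'.L₁.pn.d w, ⟨sub_mem hz₀ hy', ?_⟩, ?_, ?_⟩
      · rw [SetLike.mem_coe, LinearMap.mem_ker, map_sub, hd₀, CDGA.d_d, sub_zero]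
      · rw [map_sub, PartialMap.ev_d, sub_zero, h₀]
      · change X'.θ (z₀ - X'.L₁.pn.d w) = ft (X.θ z)
        rw [map_sub, hθ, sub_sub_cancel]) (by
      intro v hv p hp hvp
      have hdp : P.e.d p = 0 := S₁.ext.d_eq_zero (ι := X.L₁.inclP.toDGAHom)
        (by rw [← hvp, CDGA.d_d])
      obtain ⟨y, hy⟩ := (hW₁ p hp hdp).2 ⟨v, hvp⟩
      obtain ⟨y, hyk, hy⟩ := CDGA.exists_primitive (X'.L₁.inclP.map_gr _ _ hp) hy
      obtain ⟨y', hy', hθ⟩ := hZs (X'.θ y - ft (X.θ v))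
        ⟨sub_mem (X'.θ.map_gr _ _ hyk) (ft.map_gr _ _ (X.θ.map_gr _ _ hv)), by
          rw [SetLike.mem_coe, LinearMap.mem_ker, map_sub, ← X'.θ.map_d, ← ft.map_d, ← X.θ.map_d,
            hy, hvp, X'.θ_ext, X.θ_ext, fti, sub_self]⟩
      refine ⟨y - y', sub_mem hyk hy'.1, ?_, ?_⟩
      · rw [map_sub, hy, hy'.2, sub_zero]
      · change X'.θ (y - y') = ft (X.θ v)
        rw [map_sub, hθ, sub_sub_cancel])
  have hcomm : ∀ x, ft (X.θ x) = X'.θ (fe x) := by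
    refine S₁.ext.hom_ext (f := ft.toGAHom.comp X.θ.toGAHom) (g := X'.θ.toGAHom.comp fe.toGAHom)
      (fun x => ?_) (fun v hv => (fec v hv).symm)
    change ft (X.θ (X.L₁.inclP x)) = X'.θ (fe (X.L₁.inclP x))
    rw [X.θ_ext, fti, fei, X'.θ_ext]
  refine ⟨⟨fe, ft, hcomm⟩, ⟨ge, gt, fun y => ?_⟩, gfe, fge, gft, fgt⟩
  change gt (X'.θ y) = X.θ (ge y)
  conv_lhs => rw [← fge y]
  exact (congrArg gt (hcomm (ge y)).symm).trans (gft _)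

end


/-! ### Sub-DGAs -/

/-- The subalgebra generated by homogeneous elements, as a DGA. -/
noncomputable def CDGA.sub (A : CDGA.{u}) (X : Set A.carrier) (hX : ∀ x ∈ X, ∃ i, x ∈ A.gr i)
    (hd : ∀ x ∈ X, A.d x ∈ Algebra.adjoin ℚ X) : CDGA.{u} where
  toGCAlg := A.toGCAlg.sub X hX
  d := A.d.restrict (p := Subalgebra.toSubmodule (Algebra.adjoin ℚ X))
    (q := Subalgebra.toSubmodule (Algebra.adjoin ℚ X)) fun _ h => CDGA.d_mem_adjoin hX hd h
  d_gr := fun i a h => A.d_gr i a.1 h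
  d_d := fun a => Subtype.ext (A.d_d a.1)
  leibniz := fun i a b h => Subtype.ext (A.leibniz i a.1 b.1 h)

section

variable {Γ : Type*} [Group Γ]

theorem EqDGA.act_mem_adjoin {A : EqDGA.{u} Γ} {X : Set A.carrier}
    (ha : ∀ g, ∀ x ∈ X, A.act g x ∈ Algebra.adjoin ℚ X) (g : Γ) (x : A.carrier)
    (hx : x ∈ Algebra.adjoin ℚ X) : A.act g x ∈ Algebra.adjoin ℚ X := by
  have : Algebra.adjoin ℚ X ≤ (Algebra.adjoin ℚ X).comap (A.act g).toAlgHom :=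
    Algebra.adjoin_le (ha g)
  exact this hx

/-- The subalgebra generated by homogeneous elements, as a DGA with an action. -/
noncomputable def EqDGA.sub (A : EqDGA.{u} Γ) (X : Set A.carrier)
    (hX : ∀ x ∈ X, ∃ i, x ∈ A.gr i) (hd : ∀ x ∈ X, A.d x ∈ Algebra.adjoin ℚ X)
    (ha : ∀ g, ∀ x ∈ X, A.act g x ∈ Algebra.adjoin ℚ X) : EqDGA.{u} Γ where
  toCDGA := A.toCDGA.sub X hX hd
  act :=
    { toFun := fun g => AlgEquiv.ofAlgHom
        (((A.act g).toAlgHom.comp (Algebra.adjoin ℚ X).val).codRestrict (Algebra.adjoin ℚ X)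
          fun x => EqDGA.act_mem_adjoin ha g _ x.2)
        (((A.act g⁻¹).toAlgHom.comp (Algebra.adjoin ℚ X).val).codRestrict (Algebra.adjoin ℚ X)
          fun x => EqDGA.act_mem_adjoin ha g⁻¹ _ x.2)
        (AlgHom.ext fun x => Subtype.ext (by
          change A.act g (A.act g⁻¹ x.1) = x.1
          rw [← AlgEquiv.mul_apply, ← map_mul, mul_inv_cancel, map_one, AlgEquiv.one_apply]))
        (AlgHom.ext fun x => Subtype.ext (by
          change A.act g⁻¹ (A.act g x.1) = x.1
          rw [← AlgEquiv.mul_apply, ← map_mul, inv_mul_cancel, map_one, AlgEquiv.one_apply]))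
      map_one' := AlgEquiv.ext fun x => Subtype.ext (by
        change A.act 1 x.1 = x.1
        rw [map_one, AlgEquiv.one_apply])
      map_mul' := fun g h => AlgEquiv.ext fun x => Subtype.ext (by
        change A.act (g * h) x.1 = A.act g (A.act h x.1)
        rw [map_mul, AlgEquiv.mul_apply]) }
  act_gr := fun g i a h => A.act_gr g i a.1 h
  act_d := fun g a => Subtype.ext (A.act_d g a.1)

/-- The inclusion of the sub-DGA generated by homogeneous elements. -/
noncomputable def EqDGA.subIncl (A : EqDGA.{u} Γ) (X : Set A.carrier)
    (hX : ∀ x ∈ X, ∃ i, x ∈ A.gr i) (hd : ∀ x ∈ X, A.d x ∈ Algebra.adjoin ℚ X)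
    (ha : ∀ g, ∀ x ∈ X, A.act g x ∈ Algebra.adjoin ℚ X) : EqDGA.Hom (A.sub X hX hd ha) A where
  toGAHom := A.toGCAlg.subIncl X hX
  map_d := fun _ => rfl
  map_act := fun _ _ => rfl

/-- Corestriction to the sub-DGA generated by homogeneous elements. -/
noncomputable def EqDGA.Hom.toSub {P A : EqDGA.{u} Γ} (f : EqDGA.Hom P A) (X : Set A.carrier)
    (hX : ∀ x ∈ X, ∃ i, x ∈ A.gr i) (hd : ∀ x ∈ X, A.d x ∈ Algebra.adjoin ℚ X)
    (ha : ∀ g, ∀ x ∈ X, A.act g x ∈ Algebra.adjoin ℚ X)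
    (hf : ∀ x, f x ∈ Algebra.adjoin ℚ X) : EqDGA.Hom P (A.sub X hX hd ha) where
  toGAHom := f.toGAHom.toSub X hX hf
  map_d := fun x => Subtype.ext (f.map_d x)
  map_act := fun g x => Subtype.ext (f.map_act g x)

end

/-! ### Intermediate Hirsch extensions -/

section

variable {Γ : Type*} [Group Γ] [Finite Γ] {Q N : EqDGA.{u} Γ} {k : ℕ}

omit [Finite Γ] in
theorem KExt.d_mem_adjoin {j : EqDGA.Hom Q N} (hj : KExt j.toGAHom k)
    {Z : Submodule ℚ N.carrier} (hZ : Z ≤ N.gr k) :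
    ∀ x ∈ gens j.toGAHom Z, N.d x ∈ Algebra.adjoin ℚ (gens j.toGAHom Z) := by
  rintro _ (⟨i, y, -, rfl⟩ | hx)
  · exact (j.map_d y) ▸ map_mem_adjoin_gens j.toGAHom Z _
  · obtain ⟨y, -, hy⟩ := hj.top _ (N.d_gr _ _ (hZ hx))
    rw [← hy]
    exact map_mem_adjoin_gens j.toGAHom Z _

/-- An extension in degree `k` contains the Hirsch extension of the base by the kernel on
`H^{k+1}`, which contains all elements of degree `k` up to cocycles. -/
theorem KExt.exists_hirschExt (hQ : Q.IsConn) (hk : 2 ≤ k) {j : EqDGA.Hom Q N}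
    (hj : KExt j.toGAHom k) :
    ∃ (pW : EqDGA.{u} Γ)
      (X : HirschExt Q pW k (Q.Hgr (k + 1) ⊓ LinearMap.ker j.toDGAHom.mapH.toLinearMap))
      (ι : EqDGA.Hom pW N), (∀ x, ι (X.ι x) = j x) ∧ KExt ι.toGAHom k ∧
        ∀ v ∈ N.gr k, ∃ x ∈ pW.gr k, N.d (v - ι x) = 0 := by
  let W : Submodule ℚ Q.H := Q.Hgr (k + 1) ⊓ LinearMap.ker j.toDGAHom.mapH.toLinearMap
  -- A class is related to the elements of `N^k` that bound one of its representatives. An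
  -- equivariant section of this relation over `W` yields the generators.
  let R : Submodule ℚ (Q.H × N.carrier) :=
    { carrier := {x | x.2 ∈ N.gr k ∧ ∃ z ∈ Q.gr (k + 1), ∃ hz : Q.d z = 0,
        Q.cls z hz = x.1 ∧ N.d x.2 = j z}
      zero_mem' := ⟨zero_mem _, 0, zero_mem _, map_zero _, CDGA.cls_zero, by simp⟩
      add_mem' := by
        rintro x y ⟨hx, z, hz, hdz, h1, h2⟩ ⟨hy, w, hw, hdw, h3, h4⟩
        refine ⟨add_mem hx hy, z + w, add_mem hz hw, by rw [map_add, hdz, hdw, add_zero], ?_, ?_⟩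
        · rw [CDGA.cls_add hdz hdw, h1, h3, Prod.fst_add]
        · rw [Prod.snd_add, map_add, map_add, h2, h4]
      smul_mem' := by
        rintro q x ⟨hx, z, hz, hdz, h1, h2⟩
        refine ⟨Submodule.smul_mem _ _ hx, q • z, Submodule.smul_mem _ _ hz,
          by rw [map_smul, hdz, smul_zero], ?_, ?_⟩
        · rw [CDGA.cls_smul q hdz, h1, Prod.smul_fst]
        · rw [Prod.smul_snd, map_smul, map_smul, h2] }
  have hW : ∀ {z : Q.carrier} (hz : Q.d z = 0), z ∈ Q.gr (k + 1) → ∀ {v : N.carrier},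
      N.d v = j z → Q.cls z hz ∈ W := by
    intro z hz hzk v hv
    exact ⟨CDGA.cls_mem hz hzk, (CDGA.cls_eq_zero (j.toDGAHom.d_eq_zero hz)).2 ⟨v, hv⟩⟩
  obtain ⟨F, hFact, -, hF⟩ := exists_equivariant_section Q.repH N.rep ⊥ W bot_le
    (by rintro g x hx; rw [(Submodule.mem_bot ℚ).1 hx, map_zero]; exact zero_mem _) (by
      rintro g x ⟨hx, hx'⟩
      obtain ⟨z, hz, hzk, rfl⟩ := CDGA.mem_Hgr.1 hx
      obtain ⟨w, hw⟩ := (CDGA.cls_eq_zero (j.toDGAHom.d_eq_zero hz)).1 hx'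
      refine hW (Q.d_act g hz) (Q.act_gr g _ _ hzk) (v := N.act g w) ?_
      exact (N.act_d g w).symm.trans ((congrArg _ hw).trans (j.map_act g z).symm)) R (by
      rintro g x y ⟨hy, z, hz, hdz, hzx, h⟩
      have hzx : Q.cls z hdz = x := hzx
      subst hzx
      refine ⟨N.act_gr g _ _ hy, Q.act g z, Q.act_gr g _ _ hz, Q.d_act g hdz, rfl, ?_⟩
      exact (N.act_d g y).symm.trans ((congrArg _ h).trans (j.map_act g z).symm)) (by
      rintro x ⟨hx, hx'⟩
      obtain ⟨z, hz, hzk, rfl⟩ := CDGA.mem_Hgr.1 hx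
      obtain ⟨w, hw⟩ := (CDGA.cls_eq_zero (j.toDGAHom.d_eq_zero hz)).1 hx'
      obtain ⟨w, hwk, hw⟩ := CDGA.exists_primitive (j.map_gr _ _ hzk) hw
      exact ⟨w, hwk, z, hzk, hz, rfl, hw⟩) 0 (by simp)
    (by rintro x hx; rw [(Submodule.mem_bot ℚ).1 hx, map_zero]; exact zero_mem _)
  let Z : Submodule ℚ N.carrier := (Q.gr k).map j.toAlgHom.toLinearMap ⊔ W.map F
  have hZ : Z ≤ N.gr k := by
    refine sup_le ?_ ?_
    · rintro _ ⟨y, hy, rfl⟩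
      exact j.map_gr k y hy
    · rintro _ ⟨s, hs, rfl⟩
      exact (hF s hs).1
  have hQZ : ∀ x ∈ Q.gr k, j x ∈ Z := fun x hx => Submodule.mem_sup_left ⟨x, hx, rfl⟩
  have hX := gens_homogeneous (ι := j.toGAHom) hZ
  have hd := hj.d_mem_adjoin hZ
  have ha : ∀ g, ∀ x ∈ gens j.toGAHom Z, N.act g x ∈ Algebra.adjoin ℚ (gens j.toGAHom Z) := by
    rintro g _ (⟨i, y, hy, rfl⟩ | hx)
    · exact (j.map_act g y) ▸ map_mem_adjoin_gens j.toGAHom Z _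
    · obtain ⟨_, ⟨y, hy, rfl⟩, _, ⟨s, hs, rfl⟩, rfl⟩ := Submodule.mem_sup.1 hx
      refine Algebra.subset_adjoin (Or.inr ?_)
      rw [map_add, ← N.rep_apply g (F s), ← hFact]
      refine Submodule.add_mem_sup ⟨Q.act g y, Q.act_gr g _ _ hy, j.map_act g y⟩
        ⟨Q.repH g s, ?_, rfl⟩
      obtain ⟨-, z, hz, hdz, hzs, h⟩ := hF s hs
      have hzs : Q.cls z hdz = s := hzs
      rw [← hzs] at h ⊢
      refine hW (Q.d_act g hdz) (Q.act_gr g _ _ hz) (v := N.act g (F (Q.cls z hdz))) ?_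
      exact (N.act_d g _).symm.trans ((congrArg _ h).trans (j.map_act g z).symm)
  let pW := N.sub (gens j.toGAHom Z) hX hd ha
  let ι : EqDGA.Hom pW N := N.subIncl _ hX hd ha
  let jW : EqDGA.Hom Q pW := j.toSub _ hX hd ha (map_mem_adjoin_gens j.toGAHom Z)
  have hsub := hj.sub hQ hk hZ hQZ hX
  have hFZ : ∀ s ∈ W, F s ∈ Z := fun s hs => Submodule.mem_sup_right ⟨s, hs, rfl⟩
  let γ : W →ₗ[ℚ] pW.carrier := LinearMap.codRestrict
    (Subalgebra.toSubmodule (Algebra.adjoin ℚ (gens j.toGAHom Z))) (F ∘ₗ W.subtype)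
    fun s => Algebra.subset_adjoin (Or.inr (hFZ s s.2))
  have hιγ : ∀ s, ι (γ s) = F s := fun _ => rfl
  have hιj : ∀ x, ι (jW x) = j x := fun _ => rfl
  have hιinj : Function.Injective ι := GCAlg.subIncl_injective _ hX
  have hιk : KExt ι.toGAHom k :=
    KExt.cancel (ι := jW.toGAHom) (j := ι.toGAHom) hj hsub.1
      (fun x _ h => hιinj (by rw [map_zero]; exact h))
  refine ⟨pW, ⟨jW, γ, ?_, ?_, ?_⟩, ι, hιj, hιk, ?_⟩
  · refine hsub.1.isFreeExt γ (fun s => hZ (hFZ s s.2)) ?_ ?_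
    · intro x hx
      obtain ⟨_, ⟨y, hy, rfl⟩, _, ⟨s, hs, rfl⟩, h⟩ := Submodule.mem_sup.1 (hsub.2 x hx)
      exact ⟨y, hy, ⟨s, hs⟩, hιinj h.symm⟩
    · intro y hy s h
      have h : j y + F s = 0 := congrArg ι h
      obtain ⟨-, z, hz, hdz, hzs, hd'⟩ := hF s s.2
      have h1 := congrArg N.d h
      rw [map_add, hd', ← j.map_d, ← map_add, map_zero] at h1
      have h2 : Q.d y + z = 0 := hj.inj (by rw [map_zero]; exact h1)
      refine Subtype.ext ?_
      exact hzs.symm.trans <| (CDGA.cls_eq_zero hdz).2 ⟨-y, by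
        rw [map_neg]; exact neg_eq_of_add_eq_zero_right h2⟩
  · intro s
    obtain ⟨-, z, hz, hdz, hzs, h⟩ := hF s s.2
    exact ⟨z, hdz, hz, hzs, hιinj h⟩
  · intro g s s' h
    refine hιinj ?_
    change F s' = N.act g (F s)
    rw [h]
    exact hFact g s
  · intro v hv
    obtain ⟨q, hq, hqv⟩ := hj.top _ (N.d_gr _ _ hv)
    have hdq : Q.d q = 0 := hj.d_eq_zero (ι := j.toDGAHom) (by rw [hqv, N.d_d])
    have hs := hW hdq hq hqv.symm
    obtain ⟨-, z, hz, hdz, hzs, h⟩ := hF _ hs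
    obtain ⟨e, he⟩ := (CDGA.cls_eq_iff hdz hdq).1 hzs
    obtain ⟨e, hek, he⟩ := CDGA.exists_primitive (sub_mem hz hq) he
    -- The differentials of `v` and of the generator `γ ⟨_, hs⟩` represent the same class of `Q`;
    -- `e` accounts for the coboundary between the representatives.
    refine ⟨γ ⟨_, hs⟩ - jW e, sub_mem (hZ (hFZ _ hs)) (jW.map_gr _ _ hek), ?_⟩
    have e1 : N.d (j e) = j z - j q := by rw [← j.map_d, he, map_sub]
    have e2 : j q = N.d v := hqv
    rw [map_sub ι.toAlgHom, hιγ, hιj, map_sub, map_sub, h, e1, e2]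
    abel

end

/-! ### Stages come from level data -/

section

variable {Γ : Type*} [Group Γ] {P N : EqDGA.{u} Γ} {A : EqGA.{u} Γ} {ρ : P.Aug A} {k : ℕ}

/-- The data that exhibit `N`, with its map `σ` to `A`, as an algebra constructed from `W`. -/
structure LevelFill (D : DStage ρ k) (W : Submodule ℚ D.pD.H) (i : EqDGA.Hom P N)
    (σ : PartialMap N A (k + 1)) where
  pW : EqDGA.{u} Γ
  extW : HirschExt D.pD pW k W
  σW : PartialMap pW A k
  σW_ext : ∀ x ∈ genLE P.Hgr k, ∀ y : genLE pW.Hgr k,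
    (y : pW.H) = extW.ι.toDGAHom.mapH (D.ext.ι.toDGAHom.mapH x) → σW y = ρ.onH x
  ι : EqDGA.Hom pW N
  γ : (A.gr k ⧸ σW.imTop) →ₗ[ℚ] N.carrier
  free : IsFreeExt ι.toGAHom (fun _ : Unit => k) (fun _ => A.gr k ⧸ σW.imTop) (fun _ => γ)
  d_γ : ∀ c, N.d (γ c) = 0
  γ_act : ∀ g (a a' : A.gr k), (a' : A.carrier) = A.act g a →
    γ (Submodule.Quotient.mk a') = N.act g (γ (Submodule.Quotient.mk a))
  σ_ext : ∀ (x : genLE pW.Hgr k) (y : genLE N.Hgr (k + 1)),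
    (y : N.H) = ι.toDGAHom.mapH x → σ y = σW x
  σ_coker : ∀ (c : A.gr k ⧸ σW.imTop) (y : genLE N.Hgr (k + 1)),
    (y : N.H) = N.cls (γ c) (d_γ c) →
      ∃ a : A.gr k, (a : A.carrier) = σ y ∧ Submodule.Quotient.mk a = c
  φ_inj : ∀ x : genLE N.Hgr (k + 1), (x : N.H) ∈ N.Hgr (k + 1) →
    σ x ∈ genLE A.gr k → (x : N.H) ∈ genLE N.Hgr k
  incl : ∀ x, ι (extW.ι (D.ext.ι x)) = i x

/-- The level data on `N`. -/
def LevelFill.toLevelData {D : DStage ρ k} {W : Submodule ℚ D.pD.H} {i : EqDGA.Hom P N}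
    {σ : PartialMap N A (k + 1)} (L : LevelFill D W i σ) : LevelData D W where
  pW := L.pW
  extW := L.extW
  σW := L.σW
  σW_ext := L.σW_ext
  pn := N
  ι := L.ι
  γ := L.γ
  free := L.free
  d_γ := L.d_γ
  γ_act := L.γ_act
  σ := σ
  σ_ext := L.σ_ext
  σ_coker := L.σ_coker
  φ_inj := L.φ_inj

variable {i : EqDGA.Hom P N} {σ : PartialMap N A (k + 1)}

/-- `A` and `H(N)` agree through `σ` in degrees `≤ k`, so a decomposable value is the value of a
decomposable class `y` of degree `k + 1`. Injectivity of `σ` in that degree gives `x = y`. -/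
theorem IsLevelStage.φ_inj (S : IsLevelStage ρ k i σ) (x : genLE N.Hgr (k + 1))
    (hx : (x : N.H) ∈ N.Hgr (k + 1)) (hσ : σ x ∈ genLE A.gr k) : (x : N.H) ∈ genLE N.Hgr k := by
  have key := GCAlg.proj_mem_adjoin (A := A.toGCAlg)
    (fun m => ((N.Hgr m ⊓ Subalgebra.toSubmodule (genLE N.Hgr k)).comap
      (genLE N.Hgr (k + 1)).val.toLinearMap).map σ.toAlgHom.toLinearMap)
    (by
      rintro m _ ⟨y, hy, rfl⟩
      exact σ.map_gr m y hy.1)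
    ⟨1, ⟨CDGA.Hgr_one_mem, Subalgebra.one_mem _⟩, map_one σ.toAlgHom⟩
    (by
      rintro a b _ _ ⟨y, hy, rfl⟩ ⟨z, hz, rfl⟩
      exact ⟨y * z, ⟨CDGA.Hgr_mul_mem hy.1 hz.1, Subalgebra.mul_mem _ hy.2 hz.2⟩,
        map_mul σ.toAlgHom _ _⟩)
    (by
      rintro a ⟨m, hm, ha⟩
      obtain ⟨y, ⟨hy, rfl⟩, -⟩ := S.iso.1 m hm a ha
      exact ⟨m, y, ⟨hy, CDGA.mem_genLE hm hy⟩, rfl⟩) hσ (k + 1)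
  rw [GCAlg.proj_same (σ.map_gr _ x hx)] at key
  obtain ⟨y, hy, hyx⟩ := key
  have h := S.iso.2 (x - y) (sub_mem hx hy.1) (by rw [map_sub, sub_eq_zero]; exact hyx.symm)
  rw [sub_eq_zero.1 h]
  exact hy.2

end


/-! ### Level data from stages -/

/-- Lower bound: the kernel of `q` lies in `W + C`, and its codimension in `H` is at most `dim U`.
Upper bound: `W` injects into `H / C`. Subtraction of natural numbers builds in the maximum with 0.
-/
theorem finrank_quotient_bounds {V U : Type*} [AddCommGroup V] [Module ℚ V] [AddCommGroup U]
    [Module ℚ U] {H W C : Submodule ℚ V} [Module.Finite ℚ H] [Module.Finite ℚ U] (hWH : W ≤ H)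
    (hWC : W ⊓ C = ⊥) (q : H →ₗ[ℚ] U)
    (hq : ∀ x, q x = 0 → ∃ y : H, (y : V) ∈ C ∧ (x - y : V) ∈ W) :
    Module.Finite ℚ W ∧
      Module.finrank ℚ (H ⧸ C.submoduleOf H) - Module.finrank ℚ U ≤ Module.finrank ℚ W ∧
      Module.finrank ℚ W ≤ Module.finrank ℚ (H ⧸ C.submoduleOf H) := by
  have hWf : Module.Finite ℚ W := Module.Finite.of_injective
    (Submodule.inclusion hWH) (Submodule.inclusion_injective _)
  refine ⟨hWf, ?_, ?_⟩
  · have hk : LinearMap.ker q ≤ W.submoduleOf H ⊔ C.submoduleOf H := by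
      intro x hx
      obtain ⟨y, hy, hxy⟩ := hq x hx
      exact Submodule.mem_sup.2 ⟨x - y, hxy, y, hy, sub_add_cancel _ _⟩
    have h1 := LinearMap.finrank_range_add_finrank_ker q
    have h2 := Submodule.finrank_le (LinearMap.range q)
    have h3 := Submodule.finrank_mono hk
    have h4 := Submodule.finrank_add_le_finrank_add_finrank (W.submoduleOf H) (C.submoduleOf H)
    have h5 : Module.finrank ℚ (W.submoduleOf H) = Module.finrank ℚ W :=
      (Submodule.submoduleOfEquivOfLe hWH).finrank_eq
    have h6 := Submodule.finrank_quotient_add_finrank (C.submoduleOf H)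
    omega
  · refine LinearMap.finrank_le_finrank_of_injective
      (f := (C.submoduleOf H).mkQ ∘ₗ Submodule.inclusion hWH) ?_
    rw [← LinearMap.ker_eq_bot, LinearMap.ker_eq_bot']
    intro x hx
    have hx : Submodule.inclusion hWH x ∈ C.submoduleOf H := (Submodule.Quotient.mk_eq_zero _).1 hx
    have : (x : V) ∈ (⊥ : Submodule ℚ V) := hWC ▸ ⟨x.2, hx⟩
    exact Subtype.ext ((Submodule.mem_bot ℚ).1 this)

theorem CDGA.finite_Hgr (A : CDGA.{u}) (i : ℕ) [Module.Finite ℚ (A.gr i)] :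
    Module.Finite ℚ (A.Hgr i) := by
  have : Module.Finite ℚ ((A.gr i).comap A.cocycles.val.toLinearMap) :=
    Module.Finite.of_injective
      ((A.cocycles.val.toLinearMap ∘ₗ Submodule.subtype _).codRestrict (A.gr i) fun x => x.2)
      fun _ _ h => Subtype.ext (Subtype.ext (congrArg (fun y : A.gr i => (y : A.carrier)) h))
  exact Module.Finite.map _ _

section

variable {Γ : Type*} [Group Γ] {P N : EqDGA.{u} Γ} {A : EqGA.{u} Γ} {ρ : P.Aug A} {k : ℕ}
  {i : EqDGA.Hom P N} {σ : PartialMap N A (k + 1)}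

/-- A stage receives a map from `p_D`. -/
theorem IsLevelStage.exists_hom [Finite Γ] (S : IsLevelStage ρ k i σ) (B : Base ρ k) (hk : 2 ≤ k)
    (D : DStage ρ k) :
    ∃ j : EqDGA.Hom D.pD N, (∀ x, j (D.ext.ι x) = i x) ∧ KExt j.toGAHom k := by
  have hι := D.ext.kExt B.conn hk
  obtain ⟨F₁, hF₁act, hF₁P⟩ := exists_equivariant_over k D.ext.ι hι.inj i
  let R : Submodule ℚ (D.pD.carrier × N.carrier) :=
    { carrier := {x | x.2 ∈ N.gr k ∧ ∃ p ∈ P.gr (k + 1), D.pD.d x.1 = D.ext.ι p ∧ N.d x.2 = i p}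
      zero_mem' := ⟨zero_mem _, 0, zero_mem _, by simp, by simp⟩
      add_mem' := by
        rintro x y ⟨hx, p, hp, hp1, hp2⟩ ⟨hy, q, hq, hq1, hq2⟩
        refine ⟨add_mem hx hy, p + q, add_mem hp hq, ?_, ?_⟩
        · rw [Prod.fst_add, map_add, map_add, hp1, hq1]
        · rw [Prod.snd_add, map_add, map_add, hp2, hq2]
      smul_mem' := by
        rintro q x ⟨hx, p, hp, hp1, hp2⟩
        refine ⟨Submodule.smul_mem _ _ hx, q • p, Submodule.smul_mem _ _ hp, ?_, ?_⟩
        · rw [Prod.smul_fst, map_smul, map_smul, hp1]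
        · rw [Prod.smul_snd, map_smul, map_smul, hp2] }
  obtain ⟨F, hFact, hFP, hF⟩ := exists_equivariant_section D.pD.rep N.rep
    ((P.gr k).map D.ext.ι.toAlgHom.toLinearMap) (D.pD.gr k)
    (by rintro _ ⟨p, hp, rfl⟩; exact D.ext.ι.map_gr _ _ hp)
    (by rintro g _ ⟨p, hp, rfl⟩; exact ⟨P.act g p, P.act_gr g _ _ hp, D.ext.ι.map_act g p⟩)
    (fun g x => D.pD.act_gr g _ _) R (by
      rintro g x y ⟨hy, p, hp, h1, h2⟩
      refine ⟨N.act_gr g _ _ hy, P.act g p, P.act_gr g _ _ hp, ?_, ?_⟩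
      · exact (D.pD.act_d g x).symm.trans ((congrArg _ h1).trans (D.ext.ι.map_act g p).symm)
      · exact (N.act_d g y).symm.trans ((congrArg _ h2).trans (i.map_act g p).symm)) (by
      intro x hx
      obtain ⟨p, hp, s, rfl⟩ := D.ext.exists_eq B.conn hk hx
      obtain ⟨z, hz, hzk, hs, hd⟩ := D.ext.d_γ s
      have hs' : P.cls z hz ∈ kerK ρ k := hs ▸ s.2
      -- An element of `K` is killed by `ρ`, hence its image in `N` is killed by `σ`. Injectivity of
      -- `σ` in degree `k + 1` then gives a primitive in `N`, to serve as image of the generator.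
      have h0 : σ.ev (i z) = 0 := (ev_of_compat S.compat hz hs'.1.2).trans hs'.2
      obtain ⟨w, hw⟩ := S.iso.inj le_rfl (i.map_gr _ _ hzk) (i.toDGAHom.d_eq_zero hz) h0
      obtain ⟨w, hwk, hw⟩ := CDGA.exists_primitive (i.map_gr _ _ hzk) hw
      refine ⟨i p + w, add_mem (i.map_gr _ _ hp) hwk, P.d p + z, add_mem (P.d_gr _ _ hp) hzk,
        ?_, ?_⟩
      · rw [map_add, map_add, hd, D.ext.ι.map_d]
      · rw [map_add, map_add, hw, i.map_d]) F₁ (fun g x _ => hF₁act g x) (by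
      rintro _ ⟨p, hp, rfl⟩
      have h : F₁ (D.ext.ι.toAlgHom.toLinearMap p) = i p := hF₁P p hp
      rw [h]
      exact ⟨i.map_gr _ _ hp, P.d p, P.d_gr _ _ hp, (D.ext.ι.map_d p).symm, (i.map_d p).symm⟩)
  obtain ⟨j, hj, -⟩ := KExt.exists_eqDGAHom hι i F hFact
    (fun p hp => (hFP _ ⟨p, hp, rfl⟩).trans (hF₁P p hp)) hF
  refine ⟨j, hj, KExt.cancel (ι := D.ext.ι.toGAHom) (j := j.toGAHom) ?_ hι ?_⟩
  · have : i.toGAHom = j.toGAHom.comp D.ext.ι.toGAHom :=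
      GCAlg.Hom.ext_fun fun x => (hj x).symm
    exact this ▸ S.ext
  · intro v hv h0
    have h0 : j v = 0 := h0
    obtain ⟨q, hq, hqv⟩ := hι.top _ (D.pD.d_gr _ _ hv)
    have hqv : D.ext.ι q = D.pD.d v := hqv
    have h1 : i q = 0 := by rw [← hj, hqv, j.map_d, h0, map_zero]
    have hq0 : q = 0 := S.ext.inj (by rw [map_zero]; exact h1)
    obtain ⟨y, hy, -, rfl⟩ := D.ext.exists_cocycle B.conn hk hv (by rw [← hqv, hq0, map_zero])
    have hy0 : y = 0 := S.ext.inj (by rw [map_zero]; exact (hj y).symm.trans h0)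
    rw [hy0, map_zero]

/-- A decomposable class of `p_D` comes from one of `P`. If it dies in `N`, then `ρ` kills it, so it
lies in `K` and already vanishes in `p_D`. -/
theorem IsLevelStage.inf_genLE (S : IsLevelStage ρ k i σ) (B : Base ρ k) (hk : 2 ≤ k)
    {D : DStage ρ k} {j : EqDGA.Hom D.pD N} (hj : ∀ x, j (D.ext.ι x) = i x) :
    D.pD.Hgr (k + 1) ⊓ LinearMap.ker j.toDGAHom.mapH.toLinearMap ⊓
      Subalgebra.toSubmodule (genLE D.pD.Hgr k) = ⊥ := by
  rw [eq_bot_iff]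
  rintro x ⟨⟨hx, hx0⟩, hx'⟩
  obtain ⟨y, hy, hyg, rfl⟩ := KExt.exists_decomposable (ι := D.ext.ι.toDGAHom)
    (D.ext.kExt B.conn hk) B.conn hk hx hx'
  obtain ⟨z, hz, hzk, rfl⟩ := CDGA.mem_Hgr.1 hy
  obtain ⟨w, hw⟩ := (CDGA.cls_eq_zero
    (j.toDGAHom.d_eq_zero (D.ext.ι.toDGAHom.d_eq_zero hz))).1 hx0
  have h0 : ρ.toAlgHom z = 0 := by
    rw [← ev_of_compat S.compat hz hyg, ← hj, ← σ.ev_d w]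
    exact congrArg σ.ev hw.symm
  have hK : P.cls z hz ∈ kerK ρ k := ⟨⟨hy, hyg⟩, h0⟩
  exact (CDGA.cls_eq_zero (D.ext.ι.toDGAHom.d_eq_zero hz)).2
    ((D.ext.exact_iff B.conn hk hzk hz).2 hK)

/-- The bounds come from the map of `H^{k+1}(p_D)` to `A^{k+1} / (A(k))^{k+1}`. A class in its
kernel becomes decomposable in `H(N)`; decomposables of `H(N)` lift to decomposables of `p_D`, so it
is decomposable modulo `W`. -/
theorem IsLevelStage.isPoint (S : IsLevelStage ρ k i σ) (B : Base ρ k) (hk : 2 ≤ k)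
    [Module.Finite ℚ (A.gr (k + 1))] {D : DStage ρ k} {j : EqDGA.Hom D.pD N}
    (hj : ∀ x, j (D.ext.ι x) = i x) (hjk : KExt j.toGAHom k) :
    ∃ l, D.IsPoint l (D.pD.Hgr (k + 1) ⊓ LinearMap.ker j.toDGAHom.mapH.toLinearMap) ∧
      D.tdim - sdim A k ≤ l ∧ l ≤ D.tdim := by
  let H := D.pD.Hgr (k + 1)
  let W : Submodule ℚ D.pD.H := H ⊓ LinearMap.ker j.toDGAHom.mapH.toLinearMap
  have : Module.Finite ℚ (D.pD.gr (k + 1)) := by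
    have := B.fin (k + 1)
    refine Module.Finite.of_surjective ((D.ext.ι.toAlgHom.toLinearMap ∘ₗ
      (P.gr (k + 1)).subtype).codRestrict (D.pD.gr (k + 1)) fun x => D.ext.ι.map_gr _ _ x.2) ?_
    rintro ⟨x, hx⟩
    obtain ⟨y, hy, hyx⟩ := (D.ext.kExt B.conn hk).top x hx
    exact ⟨⟨y, hy⟩, Subtype.ext hyx⟩
  have : Module.Finite ℚ H := D.pD.finite_Hgr (k + 1)
  let e : H →ₗ[ℚ] genLE N.Hgr (k + 1) := LinearMap.codRestrict
    (Subalgebra.toSubmodule (genLE N.Hgr (k + 1))) (j.toDGAHom.mapH.toLinearMap ∘ₗ H.subtype)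
    fun x => CDGA.mem_genLE le_rfl (CDGA.mapH_mem j.toDGAHom x.2)
  let s : H →ₗ[ℚ] A.gr (k + 1) := LinearMap.codRestrict _ (σ.toAlgHom.toLinearMap ∘ₗ e)
    fun x => σ.map_gr _ _ (CDGA.mapH_mem j.toDGAHom x.2)
  obtain ⟨hWf, h1, h2⟩ := finrank_quotient_bounds (H := H) (W := W)
    (C := Subalgebra.toSubmodule (genLE D.pD.Hgr k)) inf_le_left (S.inf_genLE B hk hj)
    (((Subalgebra.toSubmodule (genLE A.gr k)).submoduleOf (A.gr (k + 1))).mkQ ∘ₗ s) (by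
      intro x hx
      have hx : σ (e x) ∈ genLE A.gr k := (Submodule.Quotient.mk_eq_zero _).1 hx
      have hxN : (e x : N.H) ∈ N.Hgr (k + 1) := CDGA.mapH_mem j.toDGAHom x.2
      obtain ⟨y, hy, hyg, hyx⟩ := KExt.exists_decomposable (ι := j.toDGAHom) hjk
        (D.conn B hk) hk hxN (S.φ_inj _ hxN hx)
      refine ⟨⟨y, hy⟩, hyg, sub_mem x.2 hy, ?_⟩
      change j.toDGAHom.mapH (x - y) = 0
      rw [map_sub, hyx, sub_eq_zero]
      rfl)
  exact ⟨Module.finrank ℚ W, ⟨inf_le_left, hWf, rfl, S.inf_genLE B hk hj⟩, h1, h2⟩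

/-- A stage is obtained by the construction from a subspace `W`. -/
theorem IsLevelStage.exists_fill [Finite Γ] (S : IsLevelStage ρ k i σ) (B : Base ρ k) (hk : 2 ≤ k)
    [Module.Finite ℚ (A.gr (k + 1))] (D : DStage ρ k) :
    ∃ W : Submodule ℚ D.pD.H, Nonempty (LevelFill D W i σ) ∧
      ∃ l, D.IsPoint l W ∧ D.tdim - sdim A k ≤ l ∧ l ≤ D.tdim := by
  obtain ⟨j, hj, hjk⟩ := S.exists_hom B hk D
  refine ⟨_, ?_, S.isPoint B hk hj hjk⟩
  obtain ⟨pW, X, ι, hι, hιk, hιd⟩ := hjk.exists_hirschExt (D.conn B hk) hk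
  let σW : PartialMap pW A k := σ.pull ι (Nat.le_succ k)
  have hev : ∀ z ∈ pW.gr k, pW.d z = 0 → σW.ev z = σ.ev (ι z) := fun z hzk hz =>
    σ.pull_ev ι _ hz (CDGA.mem_genLE le_rfl (CDGA.cls_mem hz hzk))
  let T : Submodule ℚ A.carrier := σW.imTop.map (A.gr k).subtype
  have hT : ∀ a, a ∈ T ↔ ∃ z ∈ pW.gr k, pW.d z = 0 ∧ σ.ev (ι z) = a := by
    intro a
    constructor
    · rintro ⟨a, ha, rfl⟩
      obtain ⟨z, hzk, hz, h⟩ := PartialMap.mem_imTop.1 ha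
      exact ⟨z, hzk, hz, (hev z hzk hz).symm.trans h⟩
    · rintro ⟨z, hzk, hz, rfl⟩
      rw [← hev z hzk hz]
      exact ⟨⟨_, σW.ev_mem le_rfl hzk hz⟩, PartialMap.mem_imTop.2 ⟨z, hzk, hz, rfl⟩, rfl⟩
  have hTact : ∀ g, ∀ a ∈ T, A.act g a ∈ T := by
    intro g a ha
    obtain ⟨z, hzk, hz, rfl⟩ := (hT a).1 ha
    refine (hT _).2 ⟨pW.act g z, pW.act_gr g _ _ hzk, pW.d_act g hz, ?_⟩
    rw [ι.map_act]
    exact σ.ev_act (Nat.le_succ k) (ι.map_gr _ _ hzk) (ι.toDGAHom.d_eq_zero hz) g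
  have hTk : T ≤ A.gr k := by
    rintro _ ⟨a, -, rfl⟩
    exact a.2
  -- Here `a` is related to the cocycles whose value is `a` modulo the image `T` of `σW`. Working
  -- modulo `T` allows the section to vanish on `T`, hence to descend to the cokernel.
  let R : Submodule ℚ (A.carrier × N.carrier) :=
    { carrier := {x | x.2 ∈ N.Zgr k ∧ σ.ev x.2 - x.1 ∈ T}
      zero_mem' := ⟨zero_mem _, by simp⟩
      add_mem' := fun {x y} hx hy => ⟨add_mem hx.1 hy.1, by
        rw [Prod.fst_add, Prod.snd_add, map_add, add_sub_add_comm]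
        exact add_mem hx.2 hy.2⟩
      smul_mem' := fun q x hx => ⟨Submodule.smul_mem _ _ hx.1, by
        rw [Prod.smul_fst, Prod.smul_snd, map_smul, ← smul_sub]
        exact Submodule.smul_mem _ _ hx.2⟩ }
  obtain ⟨F, hFact, hFT, hF⟩ := exists_equivariant_section A.rep N.rep T (A.gr k) hTk hTact
    (fun g x => A.act_gr g _ _) R (by
      rintro g a y ⟨hy, h⟩
      refine ⟨⟨N.act_gr g _ _ hy.1, N.d_act g hy.2⟩, ?_⟩
      change σ.ev (N.act g y) - A.act g a ∈ T
      rw [σ.ev_act (Nat.le_succ k) hy.1 hy.2, ← map_sub]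
      exact hTact g _ h) (by
      intro a ha
      obtain ⟨z, hzk, hz, rfl⟩ := S.iso.surj le_rfl ha
      exact ⟨z, ⟨hzk, hz⟩, by simp⟩) 0 (by simp) (by
      intro a ha
      refine ⟨zero_mem _, ?_⟩
      change σ.ev 0 - a ∈ T
      rw [map_zero, zero_sub]
      exact neg_mem ha)
  let γ : (A.gr k ⧸ σW.imTop) →ₗ[ℚ] N.carrier := σW.imTop.liftQ (F ∘ₗ (A.gr k).subtype)
    fun a ha => hFT a ⟨a, ha, rfl⟩
  have hγ : ∀ a : A.gr k, γ (Submodule.Quotient.mk a) = F a := fun _ => rfl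
  have hTmk : ∀ a : A.gr k, (a : A.carrier) ∈ T → a ∈ σW.imTop := by
    rintro a ⟨b, hb, hba⟩
    exact (Subtype.ext hba : b = a) ▸ hb
  have hZ : ∀ a : A.gr k, F a ∈ N.Zgr k := fun a => (hF a a.2).1
  have hFσ : ∀ a : A.gr k, σ.ev (F a) - a ∈ T := fun a => (hF a a.2).2
  have hdγ : ∀ c, N.d (γ c) = 0 := by
    intro c
    obtain ⟨a, rfl⟩ := Submodule.Quotient.mk_surjective _ c
    exact (hZ a).2
  have hγk : ∀ c, γ c ∈ N.gr k := by
    intro c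
    obtain ⟨a, rfl⟩ := Submodule.Quotient.mk_surjective _ c
    exact (hZ a).1
  -- Up to `pW`, `v` is a cocycle with some value `a`. Subtracting `F a` leaves a value in `T`,
  -- removed by a cocycle `z` of `pW`. The remainder bounds, and its primitive has degree `k - 1`,
  -- so it too comes from `pW`.
  have hspan : ∀ v ∈ N.gr k, ∃ y ∈ pW.gr k, ∃ c, v = ι y + γ c := by
    intro v hv
    obtain ⟨x, hx, hd⟩ := hιd v hv
    have hvx : v - ι x ∈ N.gr k := sub_mem hv (ι.map_gr _ _ hx)
    let a : A.gr k := ⟨_, σ.ev_mem (Nat.le_succ k) hvx hd⟩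
    obtain ⟨z, hzk, hz, hza⟩ := (hT _).1 (hFσ a)
    have hu : v - ι x - F a + ι z ∈ N.gr k :=
      add_mem (sub_mem hvx (hZ a).1) (ι.map_gr _ _ hzk)
    obtain ⟨w, hw⟩ := S.iso.inj (Nat.le_succ k) hu
      (by rw [map_add, map_sub, hd, (hZ a).2, ι.toDGAHom.d_eq_zero hz, sub_zero, add_zero])
      (by
        rw [map_add, map_sub, hza]
        change (a : A.carrier) - _ + _ = 0
        abel)
    obtain ⟨w, hwk, hw⟩ := CDGA.exists_primitive hu hw
    obtain ⟨w', hw', rfl⟩ := hιk.low _ (by omega) w hwk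
    have hdw : pW.d w' ∈ pW.gr k := by
      have := pW.d_gr _ _ hw'
      rwa [Nat.sub_add_cancel (by omega)] at this
    refine ⟨x - z + pW.d w', add_mem (sub_mem hx hzk) hdw, Submodule.Quotient.mk a, ?_⟩
    have e : ι (pW.d w') = v - ι x - F a + ι z := (ι.map_d w').trans hw
    rw [hγ, map_add, map_sub, e]
    abel
  have hdisj : ∀ y ∈ pW.gr k, ∀ c, ι y + γ c = 0 → c = 0 := by
    intro y hy c h
    obtain ⟨a, rfl⟩ := Submodule.Quotient.mk_surjective _ c
    rw [hγ] at h
    have hdy : pW.d y = 0 := hιk.d_eq_zero (ι := ι.toDGAHom) (by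
      have := congrArg N.d h
      rw [map_add, (hZ a).2, add_zero, map_zero] at this
      exact this)
    have h1 := congrArg σ.ev h
    rw [map_add, map_zero] at h1
    rw [Submodule.Quotient.mk_eq_zero]
    refine hTmk a ?_
    have h2 : σ.ev (ι y) ∈ T := (hT _).2 ⟨y, hy, hdy, rfl⟩
    have h3 : (a : A.carrier) = -(σ.ev (ι y)) - (σ.ev (F a) - a) := by
      rw [eq_neg_of_add_eq_zero_right h1]
      abel
    rw [h3]
    exact sub_mem (neg_mem h2) (hFσ a)
  exact ⟨
    { pW := pW
      extW := X
      σW := σW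
      σW_ext := by
        intro x hx y hy
        refine (σ.pull_apply ι (Nat.le_succ k) y _ rfl).trans (S.compat x hx ⟨_,
          CDGA.mapH_genLE ι.toDGAHom (Nat.le_succ k) y.2⟩ ?_)
        change ι.toDGAHom.mapH y = _
        rw [hy]
        obtain ⟨z, hz, rfl⟩ := CDGA.exists_cls x
        exact CDGA.cls_congr ((hι _).trans (hj z)) _
      ι := ι
      γ := γ
      free := hιk.isFreeExt γ hγk hspan hdisj
      d_γ := hdγ
      γ_act := by
        intro g a a' h
        rw [hγ, hγ, h]
        exact hFact g a
      σ_ext := fun x y hy => (σ.pull_apply ι (Nat.le_succ k) x y hy).symm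
      σ_coker := by
        rintro c ⟨y, hy⟩ h
        have h : y = N.cls (γ c) (hdγ c) := h
        subst h
        obtain ⟨a, rfl⟩ := Submodule.Quotient.mk_surjective _ c
        refine ⟨⟨σ.ev (F a), σ.ev_mem (Nat.le_succ k) (hZ a).1 (hZ a).2⟩, σ.ev_eq _ hy, ?_⟩
        rw [Submodule.Quotient.eq]
        exact hTmk _ (hFσ a)
      φ_inj := S.φ_inj
      incl := fun x => (hι _).trans (hj x) }⟩

end


/-! ### Finiteness -/

/-- A factor of degree between 1 and `k` splits off from any monomial of positive degree, so `A^i`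
is the sum of the products `A^j A^{i-j}` with `1 ≤ j ≤ min k i`. Since `i - j < i`, strong induction
applies. -/
theorem GCAlg.finite_gr_of_genLE {A : GCAlg.{u}} (hA : A.IsConn) {k : ℕ}
    (hgen : genLE A.gr k = ⊤) (hfin : ∀ i ≤ k, Module.Finite ℚ (A.gr i)) (i : ℕ) :
    Module.Finite ℚ (A.gr i) := by
  let S : ℕ → Submodule ℚ A.carrier := fun i =>
    if i = 0 then A.gr 0 else ⨆ j ∈ Finset.Icc 1 (min k i), A.gr j * A.gr (i - j)
  have hS0 : S 0 = A.gr 0 := if_pos rfl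
  have hS : ∀ i, i ≠ 0 → S i = ⨆ j ∈ Finset.Icc 1 (min k i), A.gr j * A.gr (i - j) :=
    fun i hi => if_neg hi
  have hmulgr : ∀ a b, A.gr a * A.gr b ≤ A.gr (a + b) := fun a b =>
    Submodule.mul_le.2 fun x hx y hy => GCAlg.mul_mem hx hy
  have hSgr : ∀ i, S i ≤ A.gr i := by
    intro i
    rcases eq_or_ne i 0 with rfl | hi
    · exact hS0.le
    · rw [hS i hi]
      refine iSup₂_le fun j hj => ?_
      have hj := Finset.mem_Icc.1 hj
      have := hmulgr j (i - j)
      rwa [Nat.add_sub_cancel' (by omega)] at this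
  have hmul : ∀ a b, a ≠ 0 → S a * A.gr b ≤ S (a + b) := by
    intro a b ha
    rw [hS a ha, hS (a + b) (by omega), Submodule.iSup_mul]
    refine iSup_le fun j => ?_
    rw [Submodule.iSup_mul]
    refine iSup_le fun hj => ?_
    have hj := Finset.mem_Icc.1 hj
    rw [mul_assoc]
    refine le_trans ?_ (le_iSup₂ (f := fun j _ => A.gr j * A.gr (a + b - j)) j
      (Finset.mem_Icc.2 ⟨hj.1, by omega⟩))
    have := hmulgr (a - j) b
    rw [show a - j + b = a + b - j by omega] at this
    exact mul_le_mul_right this _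
  have hle : ∀ i, A.gr i ≤ S i := by
    intro i x hx
    have h := GCAlg.proj_mem_adjoin S hSgr (hS0 ▸ GCAlg.one_mem) ?_ ?_
      (hgen ▸ Algebra.mem_top : x ∈ genLE A.gr k) i
    · rwa [GCAlg.proj_same hx] at h
    · intro a b x y hx hy
      rcases eq_or_ne a 0 with rfl | ha
      · rw [hS0] at hx
        obtain ⟨q, rfl⟩ := hA.zero x hx
        rw [zero_add, ← Algebra.smul_def]
        exact Submodule.smul_mem _ _ hy
      · exact hmul a b ha (Submodule.mul_mem_mul hx (hSgr b hy))
    · rintro x ⟨j, hj, hx⟩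
      refine ⟨j, ?_⟩
      rcases eq_or_ne j 0 with rfl | hj0
      · rwa [hS0]
      · rw [hS j hj0]
        refine le_iSup₂ (f := fun l _ => A.gr l * A.gr (j - l)) j
          (Finset.mem_Icc.2 ⟨by omega, by omega⟩) ?_
        rw [← mul_one x]
        refine Submodule.mul_mem_mul hx ?_
        rw [Nat.sub_self]
        exact GCAlg.one_mem
  have key : ∀ i, (A.gr i).FG := by
    intro i
    induction i using Nat.strong_induction_on with
    | _ i ih =>
      rcases eq_or_ne i 0 with rfl | hi
      · exact Module.Finite.iff_fg.1 (hfin 0 (Nat.zero_le k))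
      · rw [le_antisymm (hle i) (hSgr i), hS i hi]
        refine Submodule.fg_biSup _ _ fun j hj => ?_
        have hj := Finset.mem_Icc.1 hj
        exact (Module.Finite.iff_fg.1 (hfin j (by omega))).mul (ih (i - j) (by omega))
  exact Module.Finite.iff_fg.2 (key i)

/-! ### Towers of extensions -/

section

variable {Γ : Type*} [Group Γ]

/-- The constant algebra `ℚ` is minimal. -/
theorem CDGA.minGen_of_bijective (m : CDGA.{u}) (h : Function.Bijective (algebraMap ℚ m.carrier))
    (n : ℕ) : m.MinGen n fun _ => ⊥ where
  le := fun _ => bot_le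
  zero := rfl
  one := rfl
  above := fun _ _ => rfl
  d_mem := fun i v hv => by
    rw [(Submodule.mem_bot ℚ).1 hv, map_zero]
    exact zero_mem _
  free := fun B b _ => by
    let e : ℚ ≃ₐ[ℚ] m.carrier := AlgEquiv.ofBijective (Algebra.ofId ℚ m.carrier) h
    refine ⟨⟨(Algebra.ofId ℚ B.carrier).comp e.symm.toAlgHom, fun i a ha => ?_⟩, ?_, ?_⟩
    · rcases eq_or_ne i 0 with rfl | hi
      · exact GCAlg.algebraMap_mem _
      · obtain ⟨q, rfl⟩ := h.2 a
        rw [GCAlg.eq_zero_of_mem ha (GCAlg.algebraMap_mem q) hi, map_zero]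
        exact zero_mem _
    · intro i v hv
      rw [(Submodule.mem_bot ℚ).1 hv, map_zero, map_zero]
    · intro f _
      refine GCAlg.Hom.ext_fun fun x => ?_
      obtain ⟨q, rfl⟩ := h.2 x
      exact (AlgHom.commutes _ q).trans (AlgHom.commutes _ q).symm

/-- The algebra `T` is the union of the extensions `St n`, where `St 1 = ℚ` and `St (n + 1)` is
an extension in degree `n + 1` of `St n`. -/
structure Tower (T : EqDGA.{u} Γ) (St : ℕ → EqDGA.{u} Γ)
    (step : ∀ n, EqDGA.Hom (St n) (St (n + 1))) (incl : ∀ n, EqDGA.Hom (St n) T) : Prop where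
  inj : ∀ n, Function.Injective (incl n)
  incl_step : ∀ n x, incl (n + 1) (step n x) = incl n x
  union : ∀ x, ∃ n y, incl n y = x
  const : Function.Bijective (algebraMap ℚ (St 1).carrier)
  ext : ∀ n, 1 ≤ n → (St n).IsConn → KExt (step n).toGAHom (n + 1)

namespace Tower

variable {T : EqDGA.{u} Γ} {St : ℕ → EqDGA.{u} Γ} {step : ∀ n, EqDGA.Hom (St n) (St (n + 1))}
  {incl : ∀ n, EqDGA.Hom (St n) T} (hT : Tower T St step incl)

include hT

theorem conn {n : ℕ} (hn : 1 ≤ n) : (St n).IsConn := by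
  induction n, hn using Nat.le_induction with
  | base =>
    refine ⟨fun x _ => hT.const.2 x, fun x hx => ?_⟩
    obtain ⟨q, rfl⟩ := hT.const.2 x
    exact GCAlg.eq_zero_of_mem hx (GCAlg.algebraMap_mem q) one_ne_zero
  | succ n hn ih => exact (hT.ext n hn ih).conn ih (by omega)

theorem kExt {n : ℕ} (hn : 1 ≤ n) : KExt (step n).toGAHom (n + 1) := hT.ext n hn (hT.conn hn)

theorem exists_minGen {n : ℕ} (hn : 1 ≤ n) : ∃ V, (St n).MinGen n V := by
  induction n, hn using Nat.le_induction with
  | base => exact ⟨_, (St 1).minGen_of_bijective hT.const 1⟩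
  | succ n hn ih =>
    obtain ⟨V, hV⟩ := ih
    exact hV.extend hn (step n).toDGAHom (hT.kExt hn)

theorem exists_incl_add (n j : ℕ) {i : ℕ} {x : (St n).carrier} (hx : x ∈ (St n).gr i) :
    ∃ y ∈ (St (n + j)).gr i, incl (n + j) y = incl n x := by
  induction j with
  | zero => exact ⟨x, hx, rfl⟩
  | succ j ih =>
    obtain ⟨y, hy, h⟩ := ih
    exact ⟨step (n + j) y, (step (n + j)).map_gr _ _ hy, (hT.incl_step _ _).trans h⟩

theorem exists_of_incl_add {n : ℕ} (hn : 1 ≤ n) (j : ℕ) {i : ℕ} (hi : i ≤ n)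
    {x : (St (n + j)).carrier} (hx : x ∈ (St (n + j)).gr i) :
    ∃ y ∈ (St n).gr i, incl n y = incl (n + j) x := by
  induction j with
  | zero => exact ⟨x, hx, rfl⟩
  | succ j ih =>
    obtain ⟨y, hy, rfl⟩ := (hT.kExt (n := n + j) (by omega)).low i (by omega) x hx
    obtain ⟨z, hz, h⟩ := ih hy
    exact ⟨z, hz, h.trans (hT.incl_step _ _).symm⟩

theorem exists_incl {n : ℕ} (hn : 1 ≤ n) {i : ℕ} (hi : i ≤ n) {x : T.carrier} (hx : x ∈ T.gr i) :
    ∃ y ∈ (St n).gr i, incl n y = x := by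
  obtain ⟨m, y, rfl⟩ := hT.union x
  have hy : y ∈ (St m).gr i := (incl m).mem_gr_of_injective (hT.inj m) hx
  rcases le_total m n with h | h
  · obtain ⟨j, rfl⟩ := Nat.exists_eq_add_of_le h
    exact hT.exists_incl_add m j hy
  · obtain ⟨j, rfl⟩ := Nat.exists_eq_add_of_le h
    exact hT.exists_of_incl_add hn j hi hy

variable {A : EqGA.{u} Γ} {ρ : T.Aug A} (hρ : Function.Bijective ρ.onH)

include hρ

theorem exists_cocycle {n : ℕ} (hn : 1 ≤ n) {i : ℕ} (hi : i ≤ n) {a : A.carrier}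
    (ha : a ∈ A.gr i) : ∃ z ∈ (St n).gr i, (St n).d z = 0 ∧ ρ.toAlgHom (incl n z) = a := by
  obtain ⟨x, hx⟩ := hρ.2 a
  obtain ⟨z, hz, rfl⟩ := CDGA.exists_cls x
  have hz' : ρ.toAlgHom (T.proj i z) = a := by
    have h := ρ.toGAHom.proj i z
    have e : ρ.toAlgHom z = a := hx
    rw [e, GCAlg.proj_same ha] at h
    exact h
  have hd : T.d (T.proj i z) = 0 := by rw [CDGA.d_proj, hz, map_zero]
  obtain ⟨y, hy, hyz⟩ := hT.exists_incl hn hi (GCAlg.proj_mem (A := T.toGCAlg) i z)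
  refine ⟨y, hy, hT.inj n ?_, hyz ▸ hz'⟩
  rw [(incl n).map_d, hyz, hd, map_zero]

/-- The bound is `n + 1` rather than `n` because only the primitive, of degree `i - 1 ≤ n`, has to
be found in `St n`. This is the monomorphism in the first degree beyond the stage. -/
theorem exists_primitive {n : ℕ} (hn : 1 ≤ n) {i : ℕ} (hi : i ≤ n + 1) {z : (St n).carrier}
    (hz : z ∈ (St n).gr i) (hd : (St n).d z = 0) (h0 : ρ.toAlgHom (incl n z) = 0) :
    ∃ w ∈ (St n).gr (i - 1), (St n).d w = z := by
  have h : T.cls (incl n z) ((incl n).toDGAHom.d_eq_zero hd) = 0 :=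
    hρ.1 (by rw [map_zero]; exact h0)
  obtain ⟨w, hw⟩ := (CDGA.cls_eq_zero _).1 h
  obtain ⟨w, hwi, hw⟩ := CDGA.exists_primitive ((incl n).map_gr _ _ hz) hw
  obtain ⟨y, hy, rfl⟩ := hT.exists_incl hn (by omega) hwi
  exact ⟨y, hy, hT.inj n (((incl n).map_d y).trans hw)⟩

/-- In the new degree `n + 1`, filter by the differential, whose values lie in a degree coming from
`St n`, then on cocycles by the map to `A`, whose kernel consists of coboundaries of degree `n`
elements. All three pieces are finite-dimensional, and generation in degrees `≤ n + 1` gives the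
rest. -/
theorem finite_gr (hA : ∀ i, Module.Finite ℚ (A.gr i)) {n : ℕ} (hn : 1 ≤ n) (i : ℕ) :
    Module.Finite ℚ ((St n).gr i) := by
  induction n, hn using Nat.le_induction generalizing i with
  | base =>
    have : Module.Finite ℚ (St 1).carrier :=
      Module.Finite.of_surjective (Algebra.linearMap ℚ (St 1).carrier) hT.const.2
    infer_instance
  | succ n hn ih =>
    have hK := hT.kExt hn
    have hmap : ∀ j, (∀ x ∈ (St (n + 1)).gr j, ∃ y ∈ (St n).gr j, step n y = x) →
        ((St (n + 1)).gr j).FG := by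
      intro j hj
      have : (St (n + 1)).gr j = ((St n).gr j).map (step n).toAlgHom.toLinearMap := by
        refine le_antisymm (fun x hx => hj x hx) ?_
        rintro _ ⟨y, hy, rfl⟩
        exact (step n).map_gr _ _ hy
      rw [this]
      exact (Module.Finite.iff_fg.1 (ih j)).map _
    have htop : ((St (n + 1)).gr (n + 1)).FG := by
      refine Submodule.fg_of_fg_map_of_fg_inf_ker (St (n + 1)).d ?_ ?_
      · have : Module.Finite ℚ ((St (n + 1)).gr (n + 1 + 1)) :=
          Module.Finite.iff_fg.2 (hmap _ hK.top)
        refine Module.Finite.iff_fg.1 (Submodule.finiteDimensional_of_le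
          (S₂ := (St (n + 1)).gr (n + 1 + 1)) ?_)
        rintro _ ⟨x, hx, rfl⟩
        exact (St (n + 1)).d_gr _ _ hx
      · refine Submodule.fg_of_fg_map_of_fg_inf_ker
          (ρ.toAlgHom.comp (incl (n + 1)).toAlgHom).toLinearMap ?_ ?_
        · have := hA (n + 1)
          refine Module.Finite.iff_fg.1 (Submodule.finiteDimensional_of_le
            (S₂ := A.gr (n + 1)) ?_)
          rintro _ ⟨x, hx, rfl⟩
          exact ρ.map_gr _ _ ((incl (n + 1)).map_gr _ _ hx.1)
        · have hfg := (hmap n (hK.low n (by omega))).map (St (n + 1)).d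
          have : Module.Finite ℚ (((St (n + 1)).gr n).map (St (n + 1)).d) :=
            Module.Finite.iff_fg.2 hfg
          refine Module.Finite.iff_fg.1 (Submodule.finiteDimensional_of_le
            (S₂ := ((St (n + 1)).gr n).map (St (n + 1)).d) ?_)
          rintro x ⟨⟨hx, hd⟩, h0⟩
          exact hT.exists_primitive hρ (by omega) (by omega) hx hd h0
    obtain ⟨V, hV⟩ := hT.exists_minGen (n := n + 1) (by omega)
    refine GCAlg.finite_gr_of_genLE (hT.conn (by omega)) hV.genLE (fun j hj => ?_) i
    refine Module.Finite.iff_fg.2 ?_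
    rcases Nat.eq_or_lt_of_le hj with rfl | hj
    · exact htop
    · exact hmap j (hK.low j hj)

theorem base (hA : ∀ i, Module.Finite ℚ (A.gr i)) {n k : ℕ} (hn : 1 ≤ n) (hk : k = n + 1) :
    Base (ρ.comp (incl n)) k := by
  subst hk
  refine ⟨hT.conn hn, fun i hi a ha => hT.exists_cocycle hρ hn (by omega) ha,
    fun i hi z hz hd h0 => ?_, hT.exists_minGen hn, hT.finite_gr hρ hA hn⟩
  obtain ⟨w, -, hw⟩ := hT.exists_primitive hρ hn hi hz hd h0
  exact ⟨w, hw⟩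

end Tower

end

/-! ### Minimal systems with injective associated systems -/

section

variable {G : Type} [Group G]

/-- Extend the identity of `V.t` from the system `0 → V.t` to the system `V.t = V.t`. The component
of the extension at `G/e` is a section of `r`. -/
theorem VecSys.Injective.surjective_r {V : VecSys.{u} G} (hV : V.Injective) :
    Function.Surjective V.r := by
  let X : VecSys.{u} G :=
    { e := PUnit, t := V.t, act := 1, r := 0, r_act := fun _ _ => rfl }
  let Y : VecSys.{u} G :=
    { e := V.t, t := V.t, act := 1, r := LinearMap.id, r_act := fun _ _ => rfl }
  obtain ⟨h, -, ht⟩ := hV X Y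
    { e := 0, t := LinearMap.id, map_act := fun _ _ => by simp, comm := fun _ => by simp [X, Y] }
    { e := 0, t := LinearMap.id, map_act := fun _ _ => by simp, comm := fun _ => by simp [X] }
    ⟨fun _ _ _ => rfl, fun _ _ h => h⟩
  exact fun x => ⟨h.e x, (h.comm x).symm.trans (ht x)⟩

/-- The zero system. -/
def VecSys.zero (G : Type) [Group G] : VecSys.{u} G where
  e := PUnit
  t := PUnit
  act := 1
  r := 0
  r_act := fun _ _ => rfl

/-- The zero morphism to the zero system. -/
def VecSys.Hom.toZero (V : VecSys.{u} G) : VecSys.Hom V (VecSys.zero G) where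
  e := 0
  t := 0
  map_act := fun _ _ => rfl
  comm := fun _ => rfl

def VecSys.Hom.id (V : VecSys.{u} G) : VecSys.Hom V V where
  e := LinearMap.id
  t := LinearMap.id
  map_act := fun _ _ => rfl
  comm := fun _ => rfl

variable {U U' : DGADiagram.{u} G} {ι : DGADiagram.Hom U U'} {n : ℕ} {V : VecSys.{u} G}

/-- The minimal injective resolution of an injective system is concentrated in degree `0`. -/
theorem ElemExt.subsingleton (E : ElemExt ι n V) (hV : V.Injective) (i : ℕ) (hi : i ≠ 0) :
    Subsingleton (E.I i).e ∧ Subsingleton (E.I i).t := by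
  obtain ⟨h, he, ht⟩ := hV V (E.I 0) E.ε (VecSys.Hom.id V) E.ε_inj
  have he : ∀ v, h.e (E.ε.e v) = v := he
  have ht : ∀ v, h.t (E.ε.t v) = v := ht
  -- The retraction `h` of `ε` is injective because `ε` is essential, so `ε` is onto and `w 0 = 0`.
  -- Then `I 1` is an essential extension of zero, hence zero, and so on up the resolution.
  obtain ⟨hei, hti⟩ := E.minimal_zero V h (fun v hv => by rwa [he] at hv)
    (fun v hv => by rwa [ht] at hv)
  have key : ∀ i, (∀ v, (E.w i).e v = 0) → (∀ v, (E.w i).t v = 0) →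
      Subsingleton (E.I (i + 1)).e ∧ Subsingleton (E.I (i + 1)).t := by
    intro i h1 h2
    obtain ⟨h3, h4⟩ := E.minimal_succ i _ (VecSys.Hom.toZero _) (fun v _ => h1 v) (fun v _ => h2 v)
    exact ⟨⟨fun _ _ => h3 rfl⟩, ⟨fun _ _ => h4 rfl⟩⟩
  obtain ⟨i, rfl⟩ := Nat.exists_eq_succ_of_ne_zero hi
  clear hi
  induction i with
  | zero =>
    exact key 0 (fun v => (E.exact_zero.1 v).2 ⟨h.e v, hei (he _)⟩)
      (fun v => (E.exact_zero.2 v).2 ⟨h.t v, hti (ht _)⟩)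
  | succ i ih =>
    obtain ⟨h1, h2⟩ := ih
    exact key (i + 1) (fun v => by rw [Subsingleton.elim v 0, map_zero])
      (fun v => by rw [Subsingleton.elim v 0, map_zero])

namespace MinimalSystem

variable (M : MinimalSystem.{u} G) (hV : ∀ n, 2 ≤ n → (M.V n).Injective)

include hV

theorem tower_e : Tower M.total.e (fun n => (M.stage n).e) (fun n => (M.step n).e)
    (fun n => (M.incl n).e) where
  inj := fun n => (M.incl_inj n).1
  incl_step := fun n => (M.incl_step n).1
  union := M.union.1
  const := M.const_one.1
  ext := fun n hn hc => ((M.ext n hn).free_e.kExt hc (by omega) 0 rfl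
    fun i hi => ((M.ext n hn).subsingleton (hV _ (by omega)) i hi).1).1

theorem tower_t : Tower M.total.t (fun n => (M.stage n).t) (fun n => (M.step n).t)
    (fun n => (M.incl n).t) where
  inj := fun n => (M.incl_inj n).2
  incl_step := fun n => (M.incl_step n).2
  union := M.union.2
  const := M.const_one.2
  ext := fun n hn hc => ((M.ext n hn).free_t.kExt hc (by omega) 0 rfl
    fun i hi => ((M.ext n hn).subsingleton (hV _ (by omega)) i hi).2).1

/-- The generators at `G/G` are hit because the system `I 0` is injective. The range is a
subalgebra, so induction over the stages suffices. -/
theorem surjective_r {n : ℕ} (hn : 1 ≤ n) : Function.Surjective (M.stage n).r := by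
  induction n, hn using Nat.le_induction with
  | base =>
    intro x
    obtain ⟨q, rfl⟩ := M.const_one.2.2 x
    exact ⟨algebraMap ℚ _ q, AlgHom.commutes _ q⟩
  | succ n hn ih =>
    have hc := (M.tower_t hV).conn hn
    obtain ⟨hK, hspan⟩ := (M.ext n hn).free_t.kExt hc (by omega) 0 rfl
      fun i hi => ((M.ext n hn).subsingleton (hV _ (by omega)) i hi).2
    have hr := ((M.ext n hn).inj 0).surjective_r
    rw [← AlgHom.range_eq_top, eq_top_iff, ← hK.gen]
    have hι : ∀ y, (M.step n).t y ∈ (M.stage (n + 1)).r.toAlgHom.range := by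
      intro y
      obtain ⟨x, rfl⟩ := ih y
      exact ⟨(M.step n).e x, ((M.step n).comm x).symm⟩
    refine Algebra.adjoin_le ?_
    rintro _ (⟨i, y, -, rfl⟩ | hx)
    · exact hι y
    · obtain ⟨y, -, v, rfl⟩ := hspan _ hx
      obtain ⟨v, rfl⟩ := hr v
      exact add_mem (hι y) ⟨_, (((M.ext n hn).γ 0).comm v).symm⟩

end MinimalSystem

/-- A surjective graded algebra map is surjective in each degree. -/
theorem GCAlg.Hom.exists_mem_gr {A B : GCAlg.{u}} {f : GCAlg.Hom A B} (hf : Function.Surjective f)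
    {i : ℕ} {b : B.carrier} (hb : b ∈ B.gr i) : ∃ a ∈ A.gr i, f a = b := by
  obtain ⟨a, rfl⟩ := hf b
  exact ⟨A.proj i a, GCAlg.proj_mem i a, by rw [f.proj, GCAlg.proj_same hb]⟩

end


/-! ### The classification -/

section

variable {Γ : Type*} [Group Γ] {P N : EqDGA.{u} Γ} {A : EqGA.{u} Γ} {ρ : P.Aug A} {k : ℕ}

/-- Below degree `k` both cohomologies are identified with `A`, and in degree `k` that of `P`
injects into it. So `P → N` satisfies the cohomological hypotheses of `CDGA.IsMinimal.kExt`. -/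
theorem Base.isLevelStage (B : Base ρ k) (hk : 2 ≤ k) (hN : N.IsMinimal)
    (hNk : genLE N.gr k = ⊤) {i : EqDGA.Hom P N} (hi : Function.Injective i)
    {σ : PartialMap N A (k + 1)} (hσ : σ.IsNIso)
    (hc : ∀ x ∈ genLE P.Hgr k, ∀ y : genLE N.Hgr (k + 1),
      (y : N.H) = i.toDGAHom.mapH x → σ y = ρ.onH x) : IsLevelStage ρ k i σ := by
  obtain ⟨V, hV⟩ := B.min
  have hev : ∀ {j : ℕ}, j ≤ k → ∀ {p : P.carrier}, p ∈ P.gr j → P.d p = 0 →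
      σ.ev (i p) = ρ.toAlgHom p := fun hj _ hpj hp =>
    ev_of_compat hc hp (CDGA.mem_genLE hj (CDGA.cls_mem hp hpj))
  refine ⟨hN.kExt hk hNk B.conn hV.genLE i.toDGAHom hi ?_ ?_, hσ, hc⟩
  · intro j hj z hz hd
    obtain ⟨p, hp, hdp, h⟩ := B.surj j hj _ (σ.ev_mem (by omega) hz hd)
    have hzp : z - i p ∈ N.gr j := sub_mem hz (i.map_gr _ _ hp)
    obtain ⟨w, hw⟩ := hσ.inj (by omega) hzp
      (by rw [map_sub, hd, i.toDGAHom.d_eq_zero hdp, sub_zero])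
      (by rw [map_sub, hev hj.le hp hdp, h, sub_self])
    exact ⟨p, hp, hdp, w, by rw [hw]; exact (add_sub_cancel _ _).symm⟩
  · rintro j hj p hp hdp ⟨w, hw⟩
    refine B.inj j hj p hp hdp ?_
    rw [← hev hj hp hdp, ← σ.ev_d w]
    exact congrArg σ.ev hw.symm

end

section

variable {G : Type} [Group G] {P : DGADiagram.{u} G} {A : GADiagram.{u} G} {ρ : P.Aug A} {k : ℕ}
  {D₁ : DStage ρ.e k} {D₂ : DStage ρ.t k} {W₁ : Submodule ℚ D₁.pD.H} {W₂ : Submodule ℚ D₂.pD.H}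

theorem PairData.isStage (B₁ : Base ρ.e k) (B₂ : Base ρ.t k) (hk : 2 ≤ k)
    (X : PairData D₁ D₂ W₁ W₂) : IsStage ρ k X.diagram := by
  obtain ⟨V₁, h₁⟩ := X.L₁.exists_minGen B₁ hk
  obtain ⟨V₂, h₂⟩ := X.L₂.exists_minGen B₂ hk
  exact ⟨h₁.genLE, h₂.genLE, h₁.isMinimal, h₂.isMinimal,
    ⟨X.L₁.inclP, X.L₂.inclP, fun x => (X.θ_ext x).symm⟩,
    ⟨(X.L₁.kExt B₁ hk).inj, (X.L₂.kExt B₂ hk).inj⟩, X.L₁.σ, X.L₂.σ, X.L₁.isNIso B₁ hk,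
    X.L₂.isNIso B₂ hk, X.square, X.L₁.compat, X.L₂.compat⟩

/-- Every stage is the diagram of a pair. -/
theorem IsStage.exists_pairData [Finite G] (B₁ : Base ρ.e k) (B₂ : Base ρ.t k) (hk : 2 ≤ k)
    [Module.Finite ℚ (A.e.gr (k + 1))] [Module.Finite ℚ (A.t.gr (k + 1))]
    (D₁ : DStage ρ.e k) (D₂ : DStage ρ.t k) {N : DGADiagram.{u} G} (hN : IsStage ρ k N) :
    ∃ (l : LIndex D₁ D₂) (W : OSet D₁ D₂ l.1.1 l.1.2) (X : PairData D₁ D₂ W.1.1 W.1.2),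
      X.diagram = N := by
  obtain ⟨hNe, hNt, hme, hmt, ι, hι, σe, σt, hσe, hσt, hsq, hce, hct⟩ := hN
  obtain ⟨W₁, ⟨F₁⟩, l₁, hl₁, ha₁, hb₁⟩ :=
    (B₁.isLevelStage hk hme hNe hι.1 hσe hce).exists_fill B₁ hk D₁
  obtain ⟨W₂, ⟨F₂⟩, l₂, hl₂, ha₂, hb₂⟩ :=
    (B₂.isLevelStage hk hmt hNt hι.2 hσt hct).exists_fill B₂ hk D₂
  let X : PairData D₁ D₂ W₁ W₂ :=
    { L₁ := F₁.toLevelData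
      L₂ := F₂.toLevelData
      θ := N.r
      θ_act := N.r_act
      θ_ext := fun x => (congrArg N.r (F₁.incl x)).trans
        ((ι.comm x).symm.trans (F₂.incl (P.r x)).symm)
      square := hsq }
  -- The filled level data keep `N` itself as final algebra at both orbits and its structure map as
  -- `θ`, so the diagram is `N` on the nose.
  exact ⟨⟨(l₁, l₂), ⟨ha₁, hb₁⟩, ha₂, hb₂⟩, ⟨(W₁, W₂), hl₁, hl₂, ⟨X⟩⟩, X, rfl⟩

theorem finrank_gr_eq_of_iso {U U' : DGADiagram.{u} G} (h : U.Iso U') (i : ℕ) :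
    Module.finrank ℚ (U.e.gr i) = Module.finrank ℚ (U'.e.gr i) ∧
      Module.finrank ℚ (U.t.gr i) = Module.finrank ℚ (U'.t.gr i) := by
  obtain ⟨f, g, h1, h2, h3, h4⟩ := h
  have key : ∀ {X Y : CDGA.{u}} (a : CDGA.Hom X Y) (b : CDGA.Hom Y X), (∀ x, b (a x) = x) →
      (∀ x, a (b x) = x) → Module.finrank ℚ (X.gr i) = Module.finrank ℚ (Y.gr i) := by
    intro X Y a b hab hba
    exact LinearEquiv.finrank_eq (LinearEquiv.ofLinearMap
      (a.toAlgHom.toLinearMap.restrict (a.map_gr i)) (b.toAlgHom.toLinearMap.restrict (b.map_gr i))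
      (LinearMap.ext fun x => Subtype.ext (hba x)) (LinearMap.ext fun x => Subtype.ext (hab x)))
  exact ⟨key f.e.toDGAHom g.e.toDGAHom h1 h2, key f.t.toDGAHom g.t.toDGAHom h3 h4⟩

theorem finite_kerK {Γ : Type*} [Group Γ] {P : EqDGA.{u} Γ} {A : EqGA.{u} Γ} {ρ : P.Aug A}
    (B : Base ρ k) : Module.Finite ℚ (kerK ρ k) := by
  have := B.fin (k + 1)
  have := P.finite_Hgr (k + 1)
  exact Submodule.finiteDimensional_of_le (S₂ := P.Hgr (k + 1)) (inf_le_left.trans inf_le_left)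

/-- The classification, from the properties of the base and of the structure maps. -/
theorem exists_classification [Finite G] (B₁ : Base ρ.e k) (B₂ : Base ρ.t k) (hk : 2 ≤ k)
    (hfin : ∀ i, Module.Finite ℚ (A.e.gr i) ∧ Module.Finite ℚ (A.t.gr i))
    (hA : ∀ a ∈ A.t.gr k, ∃ b ∈ A.e.gr k, A.r b = a)
    (hP : ∀ a ∈ P.t.gr (k - 1), ∃ b ∈ P.e.gr (k - 1), P.r b = a)
    (D₁ : DStage ρ.e k) (D₂ : DStage ρ.t k) :
    ∃ hκ : ∀ l : LIndex D₁ D₂, Equivalence (kappa D₁ D₂ l.1.1 l.1.2),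
    ∃ Φ : (Σ l : LIndex D₁ D₂, Quotient (Setoid.mk (kappa D₁ D₂ l.1.1 l.1.2) (hκ l))) ≃
        Quotient (stageSetoid ρ k),
      ∀ (l : LIndex D₁ D₂) (W : OSet D₁ D₂ l.1.1 l.1.2) (X : PairData D₁ D₂ W.1.1 W.1.2),
        ∃ hX : IsStage ρ k X.diagram,
          Φ ⟨l, Quotient.mk (Setoid.mk (kappa D₁ D₂ l.1.1 l.1.2) (hκ l)) W⟩ =
            Quotient.mk (stageSetoid ρ k) ⟨X.diagram, hX⟩ := by
  have := (hfin k).1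
  have := (hfin k).2
  have := (hfin (k + 1)).1
  have := (hfin (k + 1)).2
  have hiso : ∀ {W₁ : Submodule ℚ D₁.pD.H} {W₂ : Submodule ℚ D₂.pD.H}
      (X X' : PairData D₁ D₂ W₁ W₂), X.diagram.Iso X'.diagram :=
    fun X X' => PairData.iso B₁ B₂ hk hA hP X X'
  -- Transitivity needs uniqueness: the two given isomorphisms may involve different diagrams
  -- belonging to the middle pair.
  have hκ : ∀ l : LIndex D₁ D₂, Equivalence (kappa D₁ D₂ l.1.1 l.1.2) := fun l =>
    ⟨fun W => W.2.2.2.elim fun X => ⟨X, X, DGADiagram.iso_equivalence.refl _⟩,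
      fun ⟨X, X', h⟩ => ⟨X', X, DGADiagram.iso_equivalence.symm h⟩,
      fun ⟨X, X', h⟩ ⟨Y, Y', h'⟩ => ⟨X, Y', DGADiagram.iso_equivalence.trans h
        (DGADiagram.iso_equivalence.trans (hiso X' Y) h')⟩⟩
  let φ : ∀ l : LIndex D₁ D₂, OSet D₁ D₂ l.1.1 l.1.2 → Quotient (stageSetoid ρ k) := fun l W =>
    Quotient.mk (stageSetoid ρ k) ⟨W.2.2.2.some.diagram, W.2.2.2.some.isStage B₁ B₂ hk⟩
  have hφ : ∀ l W (X : PairData D₁ D₂ W.1.1 W.1.2),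
      φ l W = Quotient.mk (stageSetoid ρ k) ⟨X.diagram, X.isStage B₁ B₂ hk⟩ :=
    fun l W X => Quotient.sound (hiso _ X)
  let Φ : (Σ l : LIndex D₁ D₂, Quotient (Setoid.mk (kappa D₁ D₂ l.1.1 l.1.2) (hκ l))) →
      Quotient (stageSetoid ρ k) := fun x => Quotient.lift (φ x.1) (by
    rintro W W' ⟨X, X', h⟩
    rw [hφ x.1 W X, hφ x.1 W' X']
    exact Quotient.sound h) x.2
  have hΦ : Function.Bijective Φ := by
    constructor
    · rintro ⟨l, x⟩ ⟨l', x'⟩ h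
      induction x using Quotient.inductionOn with | _ W
      induction x' using Quotient.inductionOn with | _ W'
      obtain ⟨X⟩ := W.2.2.2
      obtain ⟨X'⟩ := W'.2.2.2
      have h : φ l W = φ l' W' := h
      rw [hφ l W X, hφ l' W' X'] at h
      have h : X.diagram.Iso X'.diagram := Quotient.exact h
      -- Isomorphic diagrams have equal dimensions in degree `k`, which determine `dim W₁` and `dim
      -- W₂`.
      have hl : l = l' := by
        have := W.2.1.2.1
        have := W.2.2.1.2.1
        have := W'.2.1.2.1
        have := W'.2.2.1.2.1
        have := finite_kerK B₁
        have := finite_kerK B₂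
        have e₁ := X.L₁.finrank_eq_of_finrank_gr_eq B₁ hk X'.L₁ (finrank_gr_eq_of_iso h k).1
        have e₂ := X.L₂.finrank_eq_of_finrank_gr_eq B₂ hk X'.L₂ (finrank_gr_eq_of_iso h k).2
        rw [W.2.1.2.2.1, W'.2.1.2.2.1] at e₁
        rw [W.2.2.1.2.2.1, W'.2.2.1.2.2.1] at e₂
        exact Subtype.ext (Prod.ext e₁ e₂)
      subst hl
      exact Sigma.ext rfl (heq_of_eq (Quotient.sound ⟨X, X', h⟩))
    · intro y
      induction y using Quotient.inductionOn with | _ N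
      obtain ⟨l, W, X, h⟩ := N.2.exists_pairData B₁ B₂ hk D₁ D₂
      refine ⟨⟨l, Quotient.mk _ W⟩, ?_⟩
      refine (hφ l W X).trans (congrArg _ (Subtype.ext h))
  exact ⟨hκ, Equiv.ofBijective Φ hΦ, fun l W X => ⟨X.isStage B₁ B₂ hk, hφ l W X⟩⟩

end

end EqFormality

/-! ### The theorem. -/

theorem mainTheorem1 (p : ℕ) (hp : p.Prime) (G : Type) [Group G] (hG : Nat.card G = p)
    (A : GADiagram.{u} G)
    (hfin : ∀ i, Module.Finite ℚ (A.e.gr i) ∧ Module.Finite ℚ (A.t.gr i))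
    (hA : A.toVecSys.Injective)
    (M : MinimalSystem.{u} G) (ρ : M.total.Aug A) (hρ : ρ.IsQuasiIso)
    (hV : ∀ n, 2 ≤ n → (M.V n).Injective)
    (k : ℕ) (hk : 2 ≤ k)
    (D₁ : DStage (ρ.comp (M.incl (k - 1))).e k) (D₂ : DStage (ρ.comp (M.incl (k - 1))).t k) :
    ∃ hκ : ∀ l : LIndex D₁ D₂, Equivalence (kappa D₁ D₂ l.1.1 l.1.2),
    ∃ Φ : (Σ l : LIndex D₁ D₂, Quotient (Setoid.mk (kappa D₁ D₂ l.1.1 l.1.2) (hκ l))) ≃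
        Quotient (stageSetoid (ρ.comp (M.incl (k - 1))) k),
      ∀ (l : LIndex D₁ D₂) (W : OSet D₁ D₂ l.1.1 l.1.2) (X : PairData D₁ D₂ W.1.1 W.1.2),
        ∃ hX : IsStage (ρ.comp (M.incl (k - 1))) k X.diagram,
          Φ ⟨l, Quotient.mk (Setoid.mk (kappa D₁ D₂ l.1.1 l.1.2) (hκ l)) W⟩ =
            Quotient.mk (stageSetoid (ρ.comp (M.incl (k - 1))) k) ⟨X.diagram, hX⟩ := by
  have : Finite G := Nat.finite_of_card_ne_zero (hG ▸ hp.ne_zero)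
  have hk1 : 1 ≤ k - 1 := by omega
  have hk2 : k = k - 1 + 1 := by omega
  exact exists_classification
    ((M.tower_e hV).base hρ.1 (fun i => (hfin i).1) hk1 hk2)
    ((M.tower_t hV).base hρ.2 (fun i => (hfin i).2) hk1 hk2) hk hfin
    -- Injectivity of `A`, and then of the associated systems, is used as surjectivity of the
    -- structure maps in degrees `k` and `k - 1`.
    (fun _ ha => GCAlg.Hom.exists_mem_gr hA.surjective_r ha)
    (fun _ ha => GCAlg.Hom.exists_mem_gr (f := (M.stage (k - 1)).r.toGAHom)
      (M.surjective_r hV hk1) ha) D₁ D₂
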